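/- Let $(V,g)$ be the tangent space at a point of a four-dimensional spacetime, with signature $(-,+,+,+)$, and let $W$ be the Weyl tensor there (any tensor with the algebraic symmetries of a Weyl tensor). Let $$T_{\alpha\mu\beta\nu}=\tfrac14\left(W_\alpha{}^\rho{}_\beta{}^\sigma W_{\mu\rho\nu\sigma}+{*W}_\alpha{}^\rho{}_\beta{}^\sigma\,{*W}_{\mu\rho\nu\sigma}\right)$$ be its Bel-Robinson tensor. For an observer $u$ (a future-directed unit timelike vector) put $$\tau=T(u,u,u,u),\quad q_\perp=-T(u,u,u)_\perp,\quad t_\perp=T(u,u)_\perp,\quad Q_\perp=-T(u)_\perp,\quad T_\perp,$$ where $\perp$ is the projection by $\gamma=u\otimes u+g$. The super-energy scalars are $\tau$, $|q_\perp|$, $|t_\perp|$, $|Q_\perp|$, $|T_\perp|$, with $|A|=\sqrt{(A,A)}$. The proper super-energy scalars are their infima over all observers. Let $\alpha=\frac12\sqrt{(T,T)}$, where $(T,T)=T_{\alpha\beta\lambda\mu}T^{\alpha\beta\lambda\mu}$, and $\xi=\frac14\sum_{i=1}^3|\rho_i|^2$, where $\rho_1,\rho_2,\rho_3$ are the complex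 eigenvalues of $W$ on self-dual bivectors (the eigenvalues, up to sign, of $E+\mathrm{i}H$, the electric and magnetic parts of $W$). An observer is at rest if $q_\perp=0$. The field is Bel radiative if no observer is at rest. **Theorem.** One has $(T,T)\ge 0$ and $2\xi^2-\frac12\alpha^2\ge0$. The infimum of $\tau$ is $\xi$, and those of $|q_\perp|,|t_\perp|,|Q_\perp|,|T_\perp|$ are respectively $$\xi_q=0,\qquad \xi_t=\sqrt{\tfrac13\xi^2+\tfrac16\alpha^2},\qquad \xi_Q=\sqrt{2\xi^2-\tfrac12\alpha^2},\qquad \xi_T=\sqrt{5\xi^2+\alpha^2}.$$ 1. The field is Bel radiative if and only if it is of Petrov-Bel type N, III or II; if $W\neq0$, it is Bel non-radiative if and only if it is of type I or D. 2. If the field is Bel non-radiative, observers at rest exist and every observer at rest $e_0$ acquires the proper scalars: $\tau_0=\xi$, $|q_{0\perp}|=0$, $|t_{0\perp}|=\xi_t$, $|Q_{0\perp}|=\xi_Q$, $|T_{0\perp}|=\xi_T$. 3. If the field is Bel radiative, there is exactly one fundamental direction, that is, one null direction spanned by some $\ell\ne0$ with $(\ell,\ell)=0$ and $W(\ell,\cdot,\ell,\cdot)=c\,\ell\otimes\ell$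 for a scalar $c$ (the multiple Debever direction). Each of $\tau,|q_\perp|,|t_\perp|,|Q_\perp|,|T_\perp|$ decreases and tends to its proper scalar $\xi,0,\xi_t,\xi_Q,\xi_T$ as $u$ approaches $\ell$: along the boosts of any observer towards $\ell$ (motion relative to that observer in the spatial direction of $\ell$ with rapidity $\phi$) it is a strictly decreasing function of $\phi\in\mathbb R$ and tends to the proper scalar as $\phi\to+\infty$; and it tends to the proper scalar whenever the distance from $u$ to the line $\mathbb R\ell$ (in any fixed norm of $V$) tends to $0$. -/

import Mathlib

open Filter Topology

namespace SuperEnergy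

noncomputable section

variable {V : Type*} [AddCommGroup V] [Module ℝ V]

/-- Signature `(-,+,+,+)`. -/
def sgn (i : Fin 4) : ℝ := if i = 0 then -1 else 1

/-- `e` is an orthonormal frame of the tangent space `V` with metric `g`; in particular `V` is
four-dimensional and `g` is Lorentzian. The frame fixes an orientation and a time orientation
(for which `e 0` is future-directed), and it is used to write contractions with `g`. -/
def IsOrthonormalFrame (g : LinearMap.BilinForm ℝ V) (e : Module.Basis (Fin 4) ℝ V) : Prop :=
  ∀ i j, g (e i) (e j) = if i = j then sgn i else 0

/-- Covariant tensors of rank four on `V`. -/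
abbrev Tensor4 (V : Type*) [AddCommGroup V] [Module ℝ V] : Type _ :=
  V →ₗ[ℝ] V →ₗ[ℝ] V →ₗ[ℝ] V →ₗ[ℝ] ℝ

/-- The algebraic symmetries of a Weyl tensor: those of a curvature tensor, and tracelessness. -/
structure IsWeylTensor (e : Module.Basis (Fin 4) ℝ V) (W : Tensor4 V) : Prop where
  antisymm : ∀ x y z w, W x y z w = - W y x z w
  pairSymm : ∀ x y z w, W x y z w = W z w x y
  bianchi : ∀ x y z w, W x y z w + W x z w y + W x w y z = 0
  traceless : ∀ x y, ∑ i, sgn i * W (e i) x (e i) y = 0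

/-- The Hodge dual `*W`, with components `½ ε_{ab}{}^{ij} W_{ijcd}`, where `ε` is the volume form
of the oriented orthonormal frame `e`. -/
def dual (e : Module.Basis (Fin 4) ℝ V) (W : Tensor4 V) (x y z w : V) : ℝ :=
  (1 / 2) * ∑ i, ∑ j, sgn i * sgn j * e.det ![x, y, e i, e j] * W (e i) (e j) z w

/-- The Bel-Robinson tensor
`T_{αμβν} = ¼ (W_α^ρ_β^σ W_{μρνσ} + *W_α^ρ_β^σ *W_{μρνσ})`. -/
def belRobinson (e : Module.Basis (Fin 4) ℝ V) (W : Tensor4 V) (x y z w : V) : ℝ :=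
  (1 / 4) * ∑ i, ∑ j, sgn i * sgn j *
    (W x (e i) z (e j) * W y (e i) w (e j)
      + dual e W x (e i) z (e j) * dual e W y (e i) w (e j))

/-- The full contraction `(T,T) = T_{αβλμ} T^{αβλμ}`. -/
def belRobinsonSq (e : Module.Basis (Fin 4) ℝ V) (W : Tensor4 V) : ℝ :=
  ∑ i, ∑ j, ∑ k, ∑ l, sgn i * sgn j * sgn k * sgn l *
    belRobinson e W (e i) (e j) (e k) (e l) ^ 2

/-- The main quadratic scalar `α = ½ √(T,T)`. -/
def alpha (e : Module.Basis (Fin 4) ℝ V) (W : Tensor4 V) : ℝ :=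
  (1 / 2) * √(belRobinsonSq e W)

/-- The complex matrix `E + i H` of the electric and magnetic parts of `W` relative to `e 0`, in
the spatial triad `e 1, e 2, e 3`. Up to sign, it represents the Weyl tensor as an endomorphism of
the complex three-dimensional space of self-dual bivectors. -/
def weylMatrix (e : Module.Basis (Fin 4) ℝ V) (W : Tensor4 V) : Matrix (Fin 3) (Fin 3) ℂ :=
  Matrix.of fun i j =>
    ((W (e i.succ) (e 0) (e j.succ) (e 0) : ℝ) : ℂ)
      + Complex.I * ((dual e W (e i.succ) (e 0) (e j.succ) (e 0) : ℝ) : ℂ)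

/-- The proper super-energy density `ξ = ¼ (t₁ + t₂ + t₃)`, `t_k = |ρ_k|²`, where `ρ₁, ρ₂, ρ₃`
are the Weyl eigenvalues, counted with multiplicity. -/
def xi (e : Module.Basis (Fin 4) ℝ V) (W : Tensor4 V) : ℝ :=
  (1 / 4) * ((weylMatrix e W).charpoly.roots.map fun ρ => ‖ρ‖ ^ 2).sum

/-! Petrov-Bel types. -/

/-- Type I: three different Weyl eigenvalues. -/
def IsTypeI (e : Module.Basis (Fin 4) ℝ V) (W : Tensor4 V) : Prop :=
  (weylMatrix e W).charpoly.roots.Nodup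

/-- Type D: minimal polynomial `(X - a)(X + 2a)`, `a ≠ 0`. -/
def IsTypeD (e : Module.Basis (Fin 4) ℝ V) (W : Tensor4 V) : Prop :=
  ∃ a : ℂ, a ≠ 0 ∧ minpoly ℂ (weylMatrix e W) =
    (Polynomial.X - Polynomial.C a) * (Polynomial.X + Polynomial.C (2 * a))

/-- Type II: minimal polynomial `(X - a)²(X + 2a)`, `a ≠ 0`. -/
def IsTypeII (e : Module.Basis (Fin 4) ℝ V) (W : Tensor4 V) : Prop :=
  ∃ a : ℂ, a ≠ 0 ∧ minpoly ℂ (weylMatrix e W) =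
    (Polynomial.X - Polynomial.C a) ^ 2 * (Polynomial.X + Polynomial.C (2 * a))

/-- Type III: minimal polynomial `X³`. -/
def IsTypeIII (e : Module.Basis (Fin 4) ℝ V) (W : Tensor4 V) : Prop :=
  minpoly ℂ (weylMatrix e W) = Polynomial.X ^ 3

/-- Type N: minimal polynomial `X²`. -/
def IsTypeN (e : Module.Basis (Fin 4) ℝ V) (W : Tensor4 V) : Prop :=
  minpoly ℂ (weylMatrix e W) = Polynomial.X ^ 2

/-! Observers and relative super-energy quantities. -/

/-- Observers: future-directed unit timelike vectors. -/
def IsObserver (g : LinearMap.BilinForm ℝ V) (e : Module.Basis (Fin 4) ℝ V) (u : V) : Prop :=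
  g u u = -1 ∧ g u (e 0) < 0

/-- The projector `γ = u ⊗ u + g` onto the space orthogonal to the observer `u`. -/
def proj (g : LinearMap.BilinForm ℝ V) (u x : V) : V := x + g u x • u

/-- The super-energy density `τ = T(u,u,u,u)`. -/
def tau (e : Module.Basis (Fin 4) ℝ V) (W : Tensor4 V) (u : V) : ℝ :=
  belRobinson e W u u u u

/-- The super-Poynting vector `q_⊥ = -T(u,u,u)_⊥` (as a covector). -/
def qPerp (g : LinearMap.BilinForm ℝ V) (e : Module.Basis (Fin 4) ℝ V) (W : Tensor4 V)
    (u x : V) : ℝ :=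
  - belRobinson e W u u u (proj g u x)

/-- The super-stress tensor `t_⊥ = T(u,u)_⊥`. -/
def tPerp (g : LinearMap.BilinForm ℝ V) (e : Module.Basis (Fin 4) ℝ V) (W : Tensor4 V)
    (u x y : V) : ℝ :=
  belRobinson e W u u (proj g u x) (proj g u y)

/-- The stress flux tensor `Q_⊥ = -T(u)_⊥`. -/
def QPerp (g : LinearMap.BilinForm ℝ V) (e : Module.Basis (Fin 4) ℝ V) (W : Tensor4 V)
    (u x y z : V) : ℝ :=
  - belRobinson e W u (proj g u x) (proj g u y) (proj g u z)

/-- The stress-stress tensor `T_⊥`. -/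
def TPerp (g : LinearMap.BilinForm ℝ V) (e : Module.Basis (Fin 4) ℝ V) (W : Tensor4 V)
    (u x y z w : V) : ℝ :=
  belRobinson e W (proj g u x) (proj g u y) (proj g u z) (proj g u w)

/-- The super-energy scalar `|q_⊥| = √(q_⊥, q_⊥)`. -/
def absq (g : LinearMap.BilinForm ℝ V) (e : Module.Basis (Fin 4) ℝ V) (W : Tensor4 V)
    (u : V) : ℝ :=
  √(∑ i, sgn i * qPerp g e W u (e i) ^ 2)

/-- The super-energy scalar `|t_⊥| = √(t_⊥, t_⊥)`. -/
def abst (g : LinearMap.BilinForm ℝ V) (e : Module.Basis (Fin 4) ℝ V) (W : Tensor4 V)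
    (u : V) : ℝ :=
  √(∑ i, ∑ j, sgn i * sgn j * tPerp g e W u (e i) (e j) ^ 2)

/-- The super-energy scalar `|Q_⊥| = √(Q_⊥, Q_⊥)`. -/
def absQ (g : LinearMap.BilinForm ℝ V) (e : Module.Basis (Fin 4) ℝ V) (W : Tensor4 V)
    (u : V) : ℝ :=
  √(∑ i, ∑ j, ∑ k, sgn i * sgn j * sgn k * QPerp g e W u (e i) (e j) (e k) ^ 2)

/-- The super-energy scalar `|T_⊥| = √(T_⊥, T_⊥)`. -/
def absT (g : LinearMap.BilinForm ℝ V) (e : Module.Basis (Fin 4) ℝ V) (W : Tensor4 V)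
    (u : V) : ℝ :=
  √(∑ i, ∑ j, ∑ k, ∑ l, sgn i * sgn j * sgn k * sgn l *
    TPerp g e W u (e i) (e j) (e k) (e l) ^ 2)

/-- `c` is the proper scalar of the super-energy scalar `S`: its infimum over all observers. -/
def IsProperScalar (g : LinearMap.BilinForm ℝ V) (e : Module.Basis (Fin 4) ℝ V)
    (S : V → ℝ) (c : ℝ) : Prop :=
  IsGLB (S '' {u | IsObserver g e u}) c

/-- An observer at rest with respect to the field: its super-Poynting vector vanishes. -/
def IsAtRest (g : LinearMap.BilinForm ℝ V) (e : Module.Basis (Fin 4) ℝ V) (W : Tensor4 V)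
    (u : V) : Prop :=
  IsObserver g e u ∧ ∀ x, qPerp g e W u x = 0

/-- Bel radiative field: no observer sees a vanishing super-Poynting vector. -/
def IsBelRadiative (g : LinearMap.BilinForm ℝ V) (e : Module.Basis (Fin 4) ℝ V)
    (W : Tensor4 V) : Prop :=
  ∀ u, IsObserver g e u → ∃ x, qPerp g e W u x ≠ 0

/-- `ℓ` spans a fundamental direction: it is a multiple (at least double) Debever null vector,
`W(ℓ, ·, ℓ, ·) = c ℓ ⊗ ℓ` for some scalar `c`. -/
def IsFundamental (g : LinearMap.BilinForm ℝ V) (W : Tensor4 V) (ℓ : V) : Prop :=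
  ℓ ≠ 0 ∧ g ℓ ℓ = 0 ∧ ∃ c : ℝ, ∀ x y, W ℓ x ℓ y = c * g ℓ x * g ℓ y

/-- The observer that moves with rapidity `φ` relative to the observer `u`, in the spatial
direction `ℓ / (-g(u,ℓ)) - u` in which `u` sees the null direction of `ℓ`. -/
def boost (g : LinearMap.BilinForm ℝ V) (u ℓ : V) (φ : ℝ) : V :=
  Real.cosh φ • u + Real.sinh φ • ((- g u ℓ)⁻¹ • ℓ - u)

/-- The scalar `S` decreases and tends to `c` as the observer approaches the direction of `ℓ`:
it decreases strictly and tends to `c` along the boosts of any observer towards `ℓ`; and it tends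
to `c` whenever the distance of the observer's velocity to the line spanned by `ℓ` tends to `0`. -/
def DecreasesTo (g : LinearMap.BilinForm ℝ V) (e : Module.Basis (Fin 4) ℝ V) (ℓ : V)
    (S : V → ℝ) (c : ℝ) : Prop :=
  (∀ u, IsObserver g e u →
    StrictAnti (fun φ : ℝ => S (boost g u ℓ φ)) ∧
    Tendsto (fun φ : ℝ => S (boost g u ℓ φ)) atTop (𝓝 c)) ∧
  ∀ ε : ℝ, 0 < ε → ∃ δ : ℝ, 0 < δ ∧ ∀ u, IsObserver g e u →
    (∃ a : ℝ, ∀ i, |e.repr (u - a • ℓ) i| < δ) → |S u - c| < ε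

end

end SuperEnergy

open SuperEnergy

namespace SuperEnergy

open scoped Matrix

variable {V : Type*} [AddCommGroup V] [Module ℝ V]
  {g : LinearMap.BilinForm ℝ V} {e e' : Module.Basis (Fin 4) ℝ V} {W : Tensor4 V}

/-! ### Orthonormal frames -/

/-! Everything is read off the symmetric traceless complex matrix M = E + iH. The tensor W + i*W
factors through the self-dual parts of its two bivectors, with coefficient matrix M
(`weyl_add_dual`). Hence the Bel-Robinson tensor is a trace, T(x,y,z,w) = ¼ tr(M K(x,y) M̄ K(z,w)ᵀ)
with K = `hermMatrix` (`belRobinson_eq_trace`). A change of frame conjugates M by a complex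
orthogonal matrix, real for rotations and of imaginary angle for boosts. Contractions do not depend
on the frame, so any observer may be taken to be `e 0`.

In the observer's own frame τ = ¼‖M‖² (Frobenius norm) and α = ½|tr M²|. Polynomial identities in
the entries of M and M̄ express the remaining scalars through τ, α and P = τ² - |q|², where 16 P =
3‖M²‖² - ½|tr M²|² (`ScalarRelations`). Schur's inequalities for M and M² (`schur`), with the
identity `norm_sq_identity` for eigenvalues of sum zero, give τ ≥ ξ and P ≥ ξ², hence all lower
bounds. Moreover |q|² ≤ τ² - ξ², so τ → ξ forces every scalar to its proper value
(`controlledByDensity`): only τ needs a limit argument.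

The super-Poynting vector vanishes exactly when M is normal. Then M is diagonalizable, Schur's first
inequality is an equality, and the type is I or D unless M = 0.

If no observer is at rest, an eigenvector of M leads to a frame with M = `nullMatrix a p r` and (p,
r) ≠ 0 (`exists_canonical_frame`); otherwise a boost would make M normal. This form says that e₀ +
e₃ is fundamental. Boosts towards it multiply r by e^{-φ} and p by e^{-2φ} and keep the eigenvalues
a, a, -2a, so τ = ξ + |r|² e^{-2φ} + |p|² e^{-4φ} decreases to ξ. That |q| also decreases, although
|q|² = τ² - P is a difference of decreasing quantities, is `quartic_strictMono`. A second
fundamental direction would force p = r = 0, and the minimal polynomials of the canonical forms give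
the types N, III and II. -/

lemma sgn_mul_self (i : Fin 4) : sgn i * sgn i = 1 := by
  unfold sgn; split_ifs <;> norm_num

@[simp] lemma sgn_zero : sgn 0 = -1 := by simp [sgn]

@[simp] lemma sgn_succ (i : Fin 3) : sgn i.succ = 1 := by simp [sgn, Fin.succ_ne_zero]

@[simp] lemma sgn_one : sgn 1 = 1 := by simp [sgn]
@[simp] lemma sgn_two : sgn 2 = 1 := by simp [sgn]
@[simp] lemma sgn_three : sgn 3 = 1 := by simp [sgn]

lemma IsOrthonormalFrame.metric_eq (he : IsOrthonormalFrame g e) (x y : V) :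
    g x y = ∑ i, sgn i * e.repr x i * e.repr y i := by
  conv_lhs => rw [← e.sum_repr x, ← e.sum_repr y]
  simp only [map_sum, LinearMap.map_smul, LinearMap.sum_apply, LinearMap.smul_apply, he _ _,
    smul_eq_mul, mul_ite, mul_zero, Finset.sum_ite_eq', Finset.mem_univ, if_true]
  exact Finset.sum_congr rfl fun i _ => by ring

lemma IsOrthonormalFrame.symm (he : IsOrthonormalFrame g e) (x y : V) : g x y = g y x := by
  rw [he.metric_eq, he.metric_eq]
  exact Finset.sum_congr rfl fun i _ => by ring

lemma IsOrthonormalFrame.metric_frame (he : IsOrthonormalFrame g e) (x : V) (i : Fin 4) :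
    g x (e i) = sgn i * e.repr x i := by
  rw [he.metric_eq]
  simp [Finsupp.single_apply]

lemma IsOrthonormalFrame.repr_eq (he : IsOrthonormalFrame g e) (x : V) (i : Fin 4) :
    e.repr x i = sgn i * g x (e i) := by
  rw [he.metric_frame, ← mul_assoc, sgn_mul_self, one_mul]

lemma IsOrthonormalFrame.expand (he : IsOrthonormalFrame g e) (x : V) :
    x = ∑ i, (sgn i * g x (e i)) • e i := by
  conv_lhs => rw [← e.sum_repr x]
  simp only [he.repr_eq]

/-- A contraction with the metric does not depend on the orthonormal frame. -/
lemma contraction_eq (he : IsOrthonormalFrame g e) (he' : IsOrthonormalFrame g e')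
    (f : V → V → ℝ) (hl : ∀ y, IsLinearMap ℝ fun x => f x y) (hr : ∀ x, IsLinearMap ℝ (f x)) :
    ∑ i, sgn i * f (e i) (e i) = ∑ i, sgn i * f (e' i) (e' i) := by
  set B : V →ₗ[ℝ] V →ₗ[ℝ] ℝ := LinearMap.mk₂ ℝ f (fun a b y => (hl y).map_add a b)
    (fun c a y => (hl y).map_smul c a) (fun x => (hr x).map_add)
    (fun c x y => (hr x).map_smul c y) with hB
  have hf : ∀ x y, f x y = B x y := fun x y => rfl
  simp only [hf]
  -- Expanding a single slot in the other frame turns both sides into the same double sum.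
  have h1 : ∀ i, B (e i) (e i) = ∑ j, sgn j * g (e i) (e' j) * B (e i) (e' j) := by
    intro i
    conv_lhs => rw [he'.expand (e i), ← he'.expand (e i)]
    conv_lhs => arg 2; rw [he'.expand (e i)]
    simp [map_sum]
  have h2 : ∀ j, B (e' j) (e' j) = ∑ i, sgn i * g (e i) (e' j) * B (e i) (e' j) := by
    intro j
    conv_lhs => arg 1; arg 2; rw [he.expand (e' j)]
    simp [map_sum, he.symm]
  simp only [h1, h2, Finset.mul_sum]
  rw [Finset.sum_comm]
  exact Finset.sum_congr rfl fun i _ => Finset.sum_congr rfl fun j _ => by ring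

/-- The frames `e` and `e'` are both orthonormal for `g`, with the same orientation and the same
time orientation. -/
structure FrameEquiv (g : LinearMap.BilinForm ℝ V) (e e' : Module.Basis (Fin 4) ℝ V) : Prop where
  left : IsOrthonormalFrame g e
  right : IsOrthonormalFrame g e'
  det_eq : e'.det = e.det
  observer_iff : ∀ u, IsObserver g e u ↔ IsObserver g e' u

lemma FrameEquiv.trans {e'' : Module.Basis (Fin 4) ℝ V} (h : FrameEquiv g e e')
    (h' : FrameEquiv g e' e'') : FrameEquiv g e e'' :=
  ⟨h.left, h'.right, h'.det_eq.trans h.det_eq,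
    fun u => (h.observer_iff u).trans (h'.observer_iff u)⟩

lemma FrameEquiv.refl (he : IsOrthonormalFrame g e) : FrameEquiv g e e :=
  ⟨he, he, rfl, fun _ => Iff.rfl⟩

/-! ### Multilinearity -/

/-- `dual` and `belRobinson` are plain functions, so their multilinearity is recorded slot by slot
with `IsLinearMap`, the form that `contraction_eq` takes. -/
lemma isLinearMap_sum {ι : Type*} (s : Finset ι) (f : ι → V → ℝ)
    (hf : ∀ i ∈ s, IsLinearMap ℝ (f i)) : IsLinearMap ℝ fun x => ∑ i ∈ s, f i x :=
  ⟨fun x y => by rw [← Finset.sum_add_distrib]; exact Finset.sum_congr rfl fun i hi => (hf i hi).map_add x y,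
   fun c x => by
    rw [smul_eq_mul, Finset.mul_sum]
    exact Finset.sum_congr rfl fun i hi => (hf i hi).map_smul c x⟩

lemma _root_.IsLinearMap.const_mul' {f : V → ℝ} (hf : IsLinearMap ℝ f) (c : ℝ) :
    IsLinearMap ℝ fun x => c * f x :=
  ⟨fun x y => by rw [hf.map_add]; ring, fun a x => by rw [hf.map_smul]; simp; ring⟩

lemma _root_.IsLinearMap.mul_const' {f : V → ℝ} (hf : IsLinearMap ℝ f) (c : ℝ) :
    IsLinearMap ℝ fun x => f x * c :=
  ⟨fun x y => by rw [hf.map_add]; ring, fun a x => by rw [hf.map_smul]; simp; ring⟩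

lemma _root_.IsLinearMap.add' {f h : V → ℝ} (hf : IsLinearMap ℝ f) (hh : IsLinearMap ℝ h) :
    IsLinearMap ℝ fun x => f x + h x :=
  ⟨fun x y => by rw [hf.map_add, hh.map_add]; ring, fun a x => by
    rw [hf.map_smul, hh.map_smul]; simp; ring⟩

lemma det_isLinearMap (e : Module.Basis (Fin 4) ℝ V) (v : Fin 4 → V) (k : Fin 4) :
    IsLinearMap ℝ fun x => e.det (Function.update v k x) :=
  ⟨fun x y => e.det.map_update_add v k x y, fun c x => e.det.map_update_smul v k c x⟩

lemma det_isLinearMap_zero (e : Module.Basis (Fin 4) ℝ V) (b c d : V) :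
    IsLinearMap ℝ fun x => e.det ![x, b, c, d] := by
  convert det_isLinearMap e ![0, b, c, d] 0 using 3 with x
  ext i; fin_cases i <;> simp

lemma det_isLinearMap_one (e : Module.Basis (Fin 4) ℝ V) (a c d : V) :
    IsLinearMap ℝ fun x => e.det ![a, x, c, d] := by
  convert det_isLinearMap e ![a, 0, c, d] 1 using 3 with x
  ext i; fin_cases i <;> simp

lemma det_isLinearMap_two (e : Module.Basis (Fin 4) ℝ V) (a b d : V) :
    IsLinearMap ℝ fun x => e.det ![a, b, x, d] := by
  convert det_isLinearMap e ![a, b, 0, d] 2 using 3 with x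
  ext i; fin_cases i <;> simp

lemma det_isLinearMap_three (e : Module.Basis (Fin 4) ℝ V) (a b c : V) :
    IsLinearMap ℝ fun x => e.det ![a, b, c, x] := by
  convert det_isLinearMap e ![a, b, c, 0] 3 using 3 with x
  ext i; fin_cases i <;> simp

lemma tensor_isLinearMap_one (W : Tensor4 V) (y z w : V) : IsLinearMap ℝ fun x => W x y z w :=
  ⟨fun a b => by simp, fun c a => by simp⟩
lemma tensor_isLinearMap_two (W : Tensor4 V) (x z w : V) : IsLinearMap ℝ fun y => W x y z w :=
  ⟨fun a b => by simp, fun c a => by simp⟩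
lemma tensor_isLinearMap_three (W : Tensor4 V) (x y w : V) : IsLinearMap ℝ fun z => W x y z w :=
  ⟨fun a b => by simp, fun c a => by simp⟩
lemma tensor_isLinearMap_four (W : Tensor4 V) (x y z : V) : IsLinearMap ℝ fun w => W x y z w :=
  ⟨fun a b => by simp, fun c a => by simp⟩

lemma dual_isLinearMap_one (e : Module.Basis (Fin 4) ℝ V) (W : Tensor4 V) (y z w : V) :
    IsLinearMap ℝ fun x => dual e W x y z w := by
  unfold dual
  refine IsLinearMap.const_mul' (isLinearMap_sum _ _ fun i _ => isLinearMap_sum _ _ fun j _ => ?_) _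
  exact ((det_isLinearMap_zero e _ _ _).const_mul' _).mul_const' _

lemma dual_isLinearMap_two (e : Module.Basis (Fin 4) ℝ V) (W : Tensor4 V) (x z w : V) :
    IsLinearMap ℝ fun y => dual e W x y z w := by
  unfold dual
  refine IsLinearMap.const_mul' (isLinearMap_sum _ _ fun i _ => isLinearMap_sum _ _ fun j _ => ?_) _
  exact ((det_isLinearMap_one e _ _ _).const_mul' _).mul_const' _

lemma dual_isLinearMap_three (e : Module.Basis (Fin 4) ℝ V) (W : Tensor4 V) (x y w : V) :
    IsLinearMap ℝ fun z => dual e W x y z w := by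
  unfold dual
  refine IsLinearMap.const_mul' (isLinearMap_sum _ _ fun i _ => isLinearMap_sum _ _ fun j _ => ?_) _
  exact (tensor_isLinearMap_three W _ _ _).const_mul' _

lemma dual_isLinearMap_four (e : Module.Basis (Fin 4) ℝ V) (W : Tensor4 V) (x y z : V) :
    IsLinearMap ℝ fun w => dual e W x y z w := by
  unfold dual
  refine IsLinearMap.const_mul' (isLinearMap_sum _ _ fun i _ => isLinearMap_sum _ _ fun j _ => ?_) _
  exact (tensor_isLinearMap_four W _ _ _).const_mul' _

lemma belRobinson_isLinearMap_one (e : Module.Basis (Fin 4) ℝ V) (W : Tensor4 V) (y z w : V) :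
    IsLinearMap ℝ fun x => belRobinson e W x y z w := by
  unfold belRobinson
  refine IsLinearMap.const_mul' (isLinearMap_sum _ _ fun i _ => isLinearMap_sum _ _ fun j _ => ?_) _
  exact (((tensor_isLinearMap_one W _ _ _).mul_const' _).add'
    ((dual_isLinearMap_one e W _ _ _).mul_const' _)).const_mul' _

lemma belRobinson_isLinearMap_two (e : Module.Basis (Fin 4) ℝ V) (W : Tensor4 V) (x z w : V) :
    IsLinearMap ℝ fun y => belRobinson e W x y z w := by
  unfold belRobinson
  refine IsLinearMap.const_mul' (isLinearMap_sum _ _ fun i _ => isLinearMap_sum _ _ fun j _ => ?_) _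
  exact (((tensor_isLinearMap_one W _ _ _).const_mul' _).add'
    ((dual_isLinearMap_one e W _ _ _).const_mul' _)).const_mul' _

lemma belRobinson_isLinearMap_three (e : Module.Basis (Fin 4) ℝ V) (W : Tensor4 V) (x y w : V) :
    IsLinearMap ℝ fun z => belRobinson e W x y z w := by
  unfold belRobinson
  refine IsLinearMap.const_mul' (isLinearMap_sum _ _ fun i _ => isLinearMap_sum _ _ fun j _ => ?_) _
  exact (((tensor_isLinearMap_three W _ _ _).mul_const' _).add'
    ((dual_isLinearMap_three e W _ _ _).mul_const' _)).const_mul' _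

lemma belRobinson_isLinearMap_four (e : Module.Basis (Fin 4) ℝ V) (W : Tensor4 V) (x y z : V) :
    IsLinearMap ℝ fun w => belRobinson e W x y z w := by
  unfold belRobinson
  refine IsLinearMap.const_mul' (isLinearMap_sum _ _ fun i _ => isLinearMap_sum _ _ fun j _ => ?_) _
  exact (((tensor_isLinearMap_three W _ _ _).const_mul' _).add'
    ((dual_isLinearMap_three e W _ _ _).const_mul' _)).const_mul' _

/-! ### Independence of the frame -/

lemma contraction_sq_eq (he : IsOrthonormalFrame g e) (he' : IsOrthonormalFrame g e')
    (f : V → ℝ) (hf : IsLinearMap ℝ f) :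
    ∑ i, sgn i * f (e i) ^ 2 = ∑ i, sgn i * f (e' i) ^ 2 := by
  simpa only [pow_two] using contraction_eq he he' (fun x y => f x * f y)
    (fun y => hf.mul_const' _) (fun x => hf.const_mul' _)

/-- Induction on the number of slots: `contraction_eq` changes the frame in the first slot while the
others stay contracted in `e`, and the previous case changes those. -/
lemma contraction_sq_two_eq (he : IsOrthonormalFrame g e) (he' : IsOrthonormalFrame g e')
    (f : V → V → ℝ) (h1 : ∀ y, IsLinearMap ℝ fun x => f x y) (h2 : ∀ x, IsLinearMap ℝ (f x)) :
    ∑ i, ∑ j, sgn i * sgn j * f (e i) (e j) ^ 2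
      = ∑ i, ∑ j, sgn i * sgn j * f (e' i) (e' j) ^ 2 := by
  have h := contraction_eq he he' (fun x x' => ∑ j, sgn j * (f x (e j) * f x' (e j)))
    (fun y => isLinearMap_sum _ _ fun j _ => ((h1 _).mul_const' _).const_mul' _)
    (fun y => isLinearMap_sum _ _ fun j _ => ((h1 _).const_mul' _).const_mul' _)
  simp only [mul_assoc, ← Finset.mul_sum]
  simp only [← pow_two] at h
  rw [h]
  exact Finset.sum_congr rfl fun i _ => by rw [contraction_sq_eq he he' (f (e' i)) (h2 _)]

lemma contraction_sq_three_eq (he : IsOrthonormalFrame g e) (he' : IsOrthonormalFrame g e')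
    (f : V → V → V → ℝ) (h1 : ∀ y z, IsLinearMap ℝ fun x => f x y z)
    (h2 : ∀ x z, IsLinearMap ℝ fun y => f x y z) (h3 : ∀ x y, IsLinearMap ℝ (f x y)) :
    ∑ i, ∑ j, ∑ k, sgn i * sgn j * sgn k * f (e i) (e j) (e k) ^ 2
      = ∑ i, ∑ j, ∑ k, sgn i * sgn j * sgn k * f (e' i) (e' j) (e' k) ^ 2 := by
  have h := contraction_eq he he'
    (fun x x' => ∑ j, ∑ k, sgn j * sgn k * (f x (e j) (e k) * f x' (e j) (e k)))
    (fun y => isLinearMap_sum _ _ fun j _ => isLinearMap_sum _ _ fun k _ =>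
      ((h1 _ _).mul_const' _).const_mul' _)
    (fun y => isLinearMap_sum _ _ fun j _ => isLinearMap_sum _ _ fun k _ =>
      ((h1 _ _).const_mul' _).const_mul' _)
  simp only [mul_assoc (sgn _) (sgn _) (sgn _), mul_assoc (sgn _) (sgn _ * sgn _) (_ ^ 2),
    ← Finset.mul_sum]
  simp only [← pow_two] at h
  rw [h]
  exact Finset.sum_congr rfl fun i _ => by
    rw [contraction_sq_two_eq he he' (f (e' i)) (fun _ => h2 _ _) (fun _ => h3 _ _)]

lemma contraction_sq_four_eq (he : IsOrthonormalFrame g e) (he' : IsOrthonormalFrame g e')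
    (f : V → V → V → V → ℝ) (h1 : ∀ y z w, IsLinearMap ℝ fun x => f x y z w)
    (h2 : ∀ x z w, IsLinearMap ℝ fun y => f x y z w)
    (h3 : ∀ x y w, IsLinearMap ℝ fun z => f x y z w)
    (h4 : ∀ x y z, IsLinearMap ℝ (f x y z)) :
    ∑ i, ∑ j, ∑ k, ∑ l, sgn i * sgn j * sgn k * sgn l * f (e i) (e j) (e k) (e l) ^ 2
      = ∑ i, ∑ j, ∑ k, ∑ l, sgn i * sgn j * sgn k * sgn l *
        f (e' i) (e' j) (e' k) (e' l) ^ 2 := by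
  have h := contraction_eq he he'
    (fun x x' => ∑ j, ∑ k, ∑ l, sgn j * sgn k * sgn l *
      (f x (e j) (e k) (e l) * f x' (e j) (e k) (e l)))
    (fun y => isLinearMap_sum _ _ fun j _ => isLinearMap_sum _ _ fun k _ =>
      isLinearMap_sum _ _ fun l _ => ((h1 _ _ _).mul_const' _).const_mul' _)
    (fun y => isLinearMap_sum _ _ fun j _ => isLinearMap_sum _ _ fun k _ =>
      isLinearMap_sum _ _ fun l _ => ((h1 _ _ _).const_mul' _).const_mul' _)
  have ha : ∀ (i j k l : Fin 4) (a : ℝ), sgn i * sgn j * sgn k * sgn l * a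
      = sgn i * (sgn j * sgn k * sgn l * a) := fun i j k l a => by ring
  simp only [ha, ← Finset.mul_sum]
  simp only [← pow_two] at h
  rw [h]
  exact Finset.sum_congr rfl fun i _ => by
    rw [contraction_sq_three_eq he he' (f (e' i)) (fun _ _ => h2 _ _ _) (fun _ _ => h3 _ _ _)
      (fun _ _ => h4 _ _ _)]

/-- The first slot is paired with the third and the second with the fourth, the pattern in which
frame vectors occur in `dual` and `belRobinson`. -/
lemma contraction_two_eq (he : IsOrthonormalFrame g e) (he' : IsOrthonormalFrame g e')
    (f : V → V → V → V → ℝ) (h1 : ∀ y z w, IsLinearMap ℝ fun x => f x y z w)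
    (h2 : ∀ x z w, IsLinearMap ℝ fun y => f x y z w)
    (h3 : ∀ x y w, IsLinearMap ℝ fun z => f x y z w)
    (h4 : ∀ x y z, IsLinearMap ℝ (f x y z)) :
    ∑ i, ∑ j, sgn i * sgn j * f (e i) (e j) (e i) (e j)
      = ∑ i, ∑ j, sgn i * sgn j * f (e' i) (e' j) (e' i) (e' j) := by
  have h := contraction_eq he he' (fun x z => ∑ j, sgn j * f x (e j) z (e j))
    (fun y => isLinearMap_sum _ _ fun j _ => (h1 _ _ _).const_mul' _)
    (fun y => isLinearMap_sum _ _ fun j _ => (h3 _ _ _).const_mul' _)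
  simp only [mul_assoc, ← Finset.mul_sum]
  rw [h]
  exact Finset.sum_congr rfl fun i _ => by
    rw [contraction_eq he he' (fun y w => f (e' i) y (e' i) w) (fun _ => h2 _ _ _)
      (fun _ => h4 _ _ _)]

namespace FrameEquiv

lemma dual_eq (h : FrameEquiv g e e') (W : Tensor4 V) : dual e' W = dual e W := by
  funext x y z w
  unfold dual
  rw [h.det_eq]
  congr 1
  have := contraction_two_eq h.left h.right (fun a b c d => e.det ![x, y, a, b] * W c d z w)
    (fun _ _ _ => (det_isLinearMap_two e _ _ _).mul_const' _)
    (fun _ _ _ => (det_isLinearMap_three e _ _ _).mul_const' _)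
    (fun _ _ _ => (tensor_isLinearMap_one W _ _ _).const_mul' _)
    (fun _ _ _ => (tensor_isLinearMap_two W _ _ _).const_mul' _)
  simpa only [← mul_assoc] using this.symm

lemma belRobinson_eq (h : FrameEquiv g e e') (W : Tensor4 V) :
    belRobinson e' W = belRobinson e W := by
  funext x y z w
  unfold belRobinson
  rw [h.dual_eq]
  congr 1
  have := contraction_two_eq h.left h.right
    (fun a b c d => W x a z b * W y c w d + dual e W x a z b * dual e W y c w d)
    (fun _ _ _ => ((tensor_isLinearMap_two W _ _ _).mul_const' _).add'
      ((dual_isLinearMap_two e W _ _ _).mul_const' _))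
    (fun _ _ _ => ((tensor_isLinearMap_four W _ _ _).mul_const' _).add'
      ((dual_isLinearMap_four e W _ _ _).mul_const' _))
    (fun _ _ _ => ((tensor_isLinearMap_two W _ _ _).const_mul' _).add'
      ((dual_isLinearMap_two e W _ _ _).const_mul' _))
    (fun _ _ _ => ((tensor_isLinearMap_four W _ _ _).const_mul' _).add'
      ((dual_isLinearMap_four e W _ _ _).const_mul' _))
  exact this.symm

lemma belRobinsonSq_eq (h : FrameEquiv g e e') (W : Tensor4 V) :
    belRobinsonSq e' W = belRobinsonSq e W := by
  unfold belRobinsonSq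
  rw [h.belRobinson_eq]
  exact (contraction_sq_four_eq h.left h.right (belRobinson e W)
    (belRobinson_isLinearMap_one e W) (belRobinson_isLinearMap_two e W)
    (belRobinson_isLinearMap_three e W) (belRobinson_isLinearMap_four e W)).symm

lemma alpha_eq (h : FrameEquiv g e e') (W : Tensor4 V) : alpha e' W = alpha e W := by
  unfold alpha; rw [h.belRobinsonSq_eq]

lemma tau_eq (h : FrameEquiv g e e') (W : Tensor4 V) : tau e' W = tau e W := by
  funext u; unfold tau; rw [h.belRobinson_eq]

lemma qPerp_eq (h : FrameEquiv g e e') (W : Tensor4 V) : qPerp g e' W = qPerp g e W := by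
  funext u x; unfold qPerp; rw [h.belRobinson_eq]

lemma isWeylTensor (h : FrameEquiv g e e') (hW : IsWeylTensor e W) : IsWeylTensor e' W where
  antisymm := hW.antisymm
  pairSymm := hW.pairSymm
  bianchi := hW.bianchi
  traceless x y := by
    rw [← hW.traceless x y]
    exact (contraction_eq h.left h.right (fun a b => W a x b y)
      (fun _ => tensor_isLinearMap_one W _ _ _) (fun _ => tensor_isLinearMap_three W _ _ _)).symm

end FrameEquiv

lemma proj_isLinearMap (g : LinearMap.BilinForm ℝ V) (u : V) {f : V → ℝ} (hf : IsLinearMap ℝ f) :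
    IsLinearMap ℝ fun x => f (proj g u x) :=
  ⟨fun x y => by
    have : proj g u (x + y) = proj g u x + proj g u y := by
      simp only [proj, map_add, add_smul]; abel
    rw [this, hf.map_add],
   fun c x => by
    have : proj g u (c • x) = c • proj g u x := by
      simp only [proj, map_smul, smul_add, smul_eq_mul, mul_smul]
    rw [this, hf.map_smul]⟩

namespace FrameEquiv

lemma absq_eq (h : FrameEquiv g e e') (W : Tensor4 V) : absq g e' W = absq g e W := by
  funext u
  unfold absq qPerp
  rw [h.belRobinson_eq]
  refine congrArg Real.sqrt ?_
  simp only [neg_sq]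
  exact (contraction_sq_eq h.left h.right (fun x => belRobinson e W u u u (proj g u x))
    (proj_isLinearMap g u (belRobinson_isLinearMap_four e W u u u))).symm

lemma abst_eq (h : FrameEquiv g e e') (W : Tensor4 V) : abst g e' W = abst g e W := by
  funext u
  unfold abst tPerp
  rw [h.belRobinson_eq]
  refine congrArg Real.sqrt ?_
  exact (contraction_sq_two_eq h.left h.right
    (fun x y => belRobinson e W u u (proj g u x) (proj g u y))
    (fun _ => proj_isLinearMap g u (belRobinson_isLinearMap_three e W _ _ _))
    (fun _ => proj_isLinearMap g u (belRobinson_isLinearMap_four e W _ _ _))).symm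

lemma absQ_eq (h : FrameEquiv g e e') (W : Tensor4 V) : absQ g e' W = absQ g e W := by
  funext u
  unfold absQ QPerp
  rw [h.belRobinson_eq]
  refine congrArg Real.sqrt ?_
  simp only [neg_sq]
  have l2 := belRobinson_isLinearMap_two e W
  have l3 := belRobinson_isLinearMap_three e W
  have l4 := belRobinson_isLinearMap_four e W
  generalize belRobinson e W = B at l2 l3 l4 ⊢
  have := contraction_sq_three_eq h.left h.right
    (fun x y z => B u (proj g u x) (proj g u y) (proj g u z))
    (fun y z => proj_isLinearMap g u (l2 u (proj g u y) (proj g u z)))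
    (fun x z => proj_isLinearMap g u (l3 u (proj g u x) (proj g u z)))
    (fun x y => proj_isLinearMap g u (l4 u (proj g u x) (proj g u y)))
  exact this.symm

lemma absT_eq (h : FrameEquiv g e e') (W : Tensor4 V) : absT g e' W = absT g e W := by
  funext u
  unfold absT TPerp
  rw [h.belRobinson_eq]
  refine congrArg Real.sqrt ?_
  have l1 := belRobinson_isLinearMap_one e W
  have l2 := belRobinson_isLinearMap_two e W
  have l3 := belRobinson_isLinearMap_three e W
  have l4 := belRobinson_isLinearMap_four e W
  generalize belRobinson e W = B at l1 l2 l3 l4 ⊢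
  have := contraction_sq_four_eq h.left h.right
    (fun x y z w => B (proj g u x) (proj g u y) (proj g u z) (proj g u w))
    (fun y z w => proj_isLinearMap g u (l1 (proj g u y) (proj g u z) (proj g u w)))
    (fun x z w => proj_isLinearMap g u (l2 (proj g u x) (proj g u z) (proj g u w)))
    (fun x y w => proj_isLinearMap g u (l3 (proj g u x) (proj g u y) (proj g u w)))
    (fun x y z => proj_isLinearMap g u (l4 (proj g u x) (proj g u y) (proj g u z)))
  exact this.symm

end FrameEquiv

/-! ### The Weyl tensor in terms of its complex matrix -/

/-- The coordinates of the self-dual part of the bivector `x ∧ y`. -/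
noncomputable def selfDual (e : Module.Basis (Fin 4) ℝ V) (x y : V) : Fin 3 → ℂ :=
  ![((e.repr x 1 * e.repr y 0 - e.repr x 0 * e.repr y 1 : ℝ) : ℂ)
      + Complex.I * ((e.repr x 2 * e.repr y 3 - e.repr x 3 * e.repr y 2 : ℝ) : ℂ),
    ((e.repr x 2 * e.repr y 0 - e.repr x 0 * e.repr y 2 : ℝ) : ℂ)
      + Complex.I * ((e.repr x 3 * e.repr y 1 - e.repr x 1 * e.repr y 3 : ℝ) : ℂ),
    ((e.repr x 3 * e.repr y 0 - e.repr x 0 * e.repr y 3 : ℝ) : ℂ)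
      + Complex.I * ((e.repr x 1 * e.repr y 2 - e.repr x 2 * e.repr y 1 : ℝ) : ℂ)]

lemma antisymm_expand (e : Module.Basis (Fin 4) ℝ V) (f : V → V → ℝ)
    (hl : ∀ y, IsLinearMap ℝ fun x => f x y) (hr : ∀ x, IsLinearMap ℝ (f x))
    (ha : ∀ x y, f x y = - f y x) (x y : V) :
    f x y = (e.repr x 1 * e.repr y 0 - e.repr x 0 * e.repr y 1) * f (e 1) (e 0)
      + (e.repr x 2 * e.repr y 0 - e.repr x 0 * e.repr y 2) * f (e 2) (e 0)
      + (e.repr x 3 * e.repr y 0 - e.repr x 0 * e.repr y 3) * f (e 3) (e 0)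
      + (e.repr x 2 * e.repr y 3 - e.repr x 3 * e.repr y 2) * f (e 2) (e 3)
      + (e.repr x 3 * e.repr y 1 - e.repr x 1 * e.repr y 3) * f (e 3) (e 1)
      + (e.repr x 1 * e.repr y 2 - e.repr x 2 * e.repr y 1) * f (e 1) (e 2) := by
  have h0 : ∀ x, f x x = 0 := fun x => by linarith [ha x x]
  have hx : ∀ x : V, x = e.repr x 0 • e 0 + e.repr x 1 • e 1 + e.repr x 2 • e 2
      + e.repr x 3 • e 3 := fun x => by
    conv_lhs => rw [← e.sum_repr x, Fin.sum_univ_four]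
  have e1 : ∀ z, f x z = e.repr x 0 * f (e 0) z + e.repr x 1 * f (e 1) z
      + e.repr x 2 * f (e 2) z + e.repr x 3 * f (e 3) z := fun z => by
    conv_lhs => rw [hx x]
    rw [(hl z).map_add, (hl z).map_add, (hl z).map_add, (hl z).map_smul, (hl z).map_smul,
      (hl z).map_smul, (hl z).map_smul]
    simp
  have e2 : ∀ z, f z y = e.repr y 0 * f z (e 0) + e.repr y 1 * f z (e 1)
      + e.repr y 2 * f z (e 2) + e.repr y 3 * f z (e 3) := fun z => by
    conv_lhs => rw [hx y]
    rw [(hr z).map_add, (hr z).map_add, (hr z).map_add, (hr z).map_smul, (hr z).map_smul,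
      (hr z).map_smul, (hr z).map_smul]
    simp
  rw [e1, e2, e2, e2, e2, h0, h0, h0, h0, ha (e 0) (e 1), ha (e 0) (e 2), ha (e 0) (e 3),
    ha (e 3) (e 2), ha (e 1) (e 3), ha (e 2) (e 1)]
  ring

lemma det_coord (e : Module.Basis (Fin 4) ℝ V) (x y z w : V) :
    e.det ![x, y, z, w] =
      e.repr x 0 * e.repr y 1 * e.repr z 2 * e.repr w 3
      - e.repr x 0 * e.repr y 1 * e.repr z 3 * e.repr w 2
      - e.repr x 0 * e.repr y 2 * e.repr z 1 * e.repr w 3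
      + e.repr x 0 * e.repr y 2 * e.repr z 3 * e.repr w 1
      + e.repr x 0 * e.repr y 3 * e.repr z 1 * e.repr w 2
      - e.repr x 0 * e.repr y 3 * e.repr z 2 * e.repr w 1
      - e.repr x 1 * e.repr y 0 * e.repr z 2 * e.repr w 3
      + e.repr x 1 * e.repr y 0 * e.repr z 3 * e.repr w 2
      + e.repr x 1 * e.repr y 2 * e.repr z 0 * e.repr w 3
      - e.repr x 1 * e.repr y 2 * e.repr z 3 * e.repr w 0
      - e.repr x 1 * e.repr y 3 * e.repr z 0 * e.repr w 2
      + e.repr x 1 * e.repr y 3 * e.repr z 2 * e.repr w 0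
      + e.repr x 2 * e.repr y 0 * e.repr z 1 * e.repr w 3
      - e.repr x 2 * e.repr y 0 * e.repr z 3 * e.repr w 1
      - e.repr x 2 * e.repr y 1 * e.repr z 0 * e.repr w 3
      + e.repr x 2 * e.repr y 1 * e.repr z 3 * e.repr w 0
      + e.repr x 2 * e.repr y 3 * e.repr z 0 * e.repr w 1
      - e.repr x 2 * e.repr y 3 * e.repr z 1 * e.repr w 0
      - e.repr x 3 * e.repr y 0 * e.repr z 1 * e.repr w 2
      + e.repr x 3 * e.repr y 0 * e.repr z 2 * e.repr w 1
      + e.repr x 3 * e.repr y 1 * e.repr z 0 * e.repr w 2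
      - e.repr x 3 * e.repr y 1 * e.repr z 2 * e.repr w 0
      - e.repr x 3 * e.repr y 2 * e.repr z 0 * e.repr w 1
      + e.repr x 3 * e.repr y 2 * e.repr z 1 * e.repr w 0 := by
  rw [Module.Basis.det_apply]
  simp only [Matrix.det_succ_row_zero, Fin.sum_univ_succ, Module.Basis.toMatrix_apply,
    Matrix.submatrix_apply, Fin.sum_univ_zero, Matrix.det_fin_zero]
  simp [Fin.succAbove, Fin.ext_iff]
  ring

lemma dual_antisymm (e : Module.Basis (Fin 4) ℝ V) (W : Tensor4 V) (x y z w : V) :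
    dual e W x y z w = - dual e W y x z w := by
  unfold dual
  rw [← mul_neg, ← Finset.sum_neg_distrib]
  congr 1
  refine Finset.sum_congr rfl fun i _ => ?_
  rw [← Finset.sum_neg_distrib]
  refine Finset.sum_congr rfl fun j _ => ?_
  have : e.det ![x, y, e i, e j] = - e.det ![y, x, e i, e j] := by
    have := e.det.map_swap ![x, y, e i, e j] (i := 0) (j := 1) (by decide)
    rw [← neg_eq_iff_eq_neg, ← this]
    congr 1
    ext k; fin_cases k <;> simp [Equiv.swap_apply_of_ne_of_ne]
  rw [this]; ring

/-- The dual exchanges the bivectors e_i ∧ e₀ and e_j ∧ e_k for cyclic i, j, k, with signs that make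
its square -1. -/
lemma dual_frame (hW : IsWeylTensor e W) (z w : V) :
    dual e W (e 1) (e 0) z w = - W (e 2) (e 3) z w ∧
    dual e W (e 2) (e 0) z w = - W (e 3) (e 1) z w ∧
    dual e W (e 3) (e 0) z w = - W (e 1) (e 2) z w ∧
    dual e W (e 2) (e 3) z w = W (e 1) (e 0) z w ∧
    dual e W (e 3) (e 1) z w = W (e 2) (e 0) z w ∧
    dual e W (e 1) (e 2) z w = W (e 3) (e 0) z w := by
  have a1 := hW.antisymm (e 3) (e 2) z w
  have a2 := hW.antisymm (e 1) (e 3) z w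
  have a3 := hW.antisymm (e 2) (e 1) z w
  have a4 := hW.antisymm (e 0) (e 1) z w
  have a5 := hW.antisymm (e 0) (e 2) z w
  have a6 := hW.antisymm (e 0) (e 3) z w
  refine ⟨?_, ?_, ?_, ?_, ?_, ?_⟩ <;>
  · simp only [dual, det_coord, Fin.sum_univ_four, Module.Basis.repr_self, Finsupp.single_apply]
    simp
    linarith

/-- The components of a Weyl tensor in a frame satisfy `W_{jk lm} = - W_{i0 n0}` and
`W_{i0 lm} = W_{jk n0}` for cyclic `i j k` and `n l m`; the latter matrix is symmetric and
traceless. -/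
lemma weyl_frame (hW : IsWeylTensor e W) :
    (W (e 2) (e 3) (e 2) (e 3) = - W (e 1) (e 0) (e 1) (e 0) ∧
     W (e 2) (e 3) (e 3) (e 1) = - W (e 1) (e 0) (e 2) (e 0) ∧
     W (e 2) (e 3) (e 1) (e 2) = - W (e 1) (e 0) (e 3) (e 0) ∧
     W (e 3) (e 1) (e 3) (e 1) = - W (e 2) (e 0) (e 2) (e 0) ∧
     W (e 3) (e 1) (e 1) (e 2) = - W (e 2) (e 0) (e 3) (e 0) ∧
     W (e 1) (e 2) (e 1) (e 2) = - W (e 3) (e 0) (e 3) (e 0)) ∧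
    (W (e 3) (e 1) (e 1) (e 0) = W (e 2) (e 3) (e 2) (e 0) ∧
     W (e 1) (e 2) (e 1) (e 0) = W (e 2) (e 3) (e 3) (e 0) ∧
     W (e 1) (e 2) (e 2) (e 0) = W (e 3) (e 1) (e 3) (e 0)) ∧
    W (e 1) (e 0) (e 1) (e 0) + W (e 2) (e 0) (e 2) (e 0) + W (e 3) (e 0) (e 3) (e 0) = 0 ∧
    W (e 2) (e 3) (e 1) (e 0) + W (e 3) (e 1) (e 2) (e 0) + W (e 1) (e 2) (e 3) (e 0) = 0 := by
  have h0 : ∀ x z w, W x x z w = 0 := fun x z w => by linarith [hW.antisymm x x z w]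
  have h0' : ∀ x y z, W x y z z = 0 := fun x y z => by rw [hW.pairSymm, h0]
  have an := hW.antisymm
  have an' : ∀ x y z w, W x y z w = - W x y w z := fun x y z w => by
    rw [hW.pairSymm, an, hW.pairSymm]
  have tr : ∀ a b, - W (e 0) (e a) (e 0) (e b) + W (e 1) (e a) (e 1) (e b)
      + W (e 2) (e a) (e 2) (e b) + W (e 3) (e a) (e 3) (e b) = 0 := fun a b => by
    simpa [Fin.sum_univ_four] using hW.traceless (e a) (e b)
  have bi := hW.bianchi (e 1) (e 0) (e 2) (e 3)
  have t00 := tr 0 0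
  have t01 := tr 0 1
  have t02 := tr 0 2
  have t03 := tr 0 3
  have t11 := tr 1 1
  have t12 := tr 1 2
  have t13 := tr 1 3
  have t22 := tr 2 2
  have t23 := tr 2 3
  have t33 := tr 3 3
  have n1 : ∀ z w, W (e 0) (e 1) z w = - W (e 1) (e 0) z w := an _ _
  have n2 : ∀ z w, W (e 0) (e 2) z w = - W (e 2) (e 0) z w := an _ _
  have n3 : ∀ z w, W (e 0) (e 3) z w = - W (e 3) (e 0) z w := an _ _
  have n4 : ∀ z w, W (e 3) (e 2) z w = - W (e 2) (e 3) z w := an _ _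
  have n5 : ∀ z w, W (e 1) (e 3) z w = - W (e 3) (e 1) z w := an _ _
  have n6 : ∀ z w, W (e 2) (e 1) z w = - W (e 1) (e 2) z w := an _ _
  have m1 : ∀ x y, W x y (e 0) (e 1) = - W x y (e 1) (e 0) := fun x y => an' _ _ _ _
  have m2 : ∀ x y, W x y (e 0) (e 2) = - W x y (e 2) (e 0) := fun x y => an' _ _ _ _
  have m3 : ∀ x y, W x y (e 0) (e 3) = - W x y (e 3) (e 0) := fun x y => an' _ _ _ _
  have m4 : ∀ x y, W x y (e 3) (e 2) = - W x y (e 2) (e 3) := fun x y => an' _ _ _ _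
  have m5 : ∀ x y, W x y (e 1) (e 3) = - W x y (e 3) (e 1) := fun x y => an' _ _ _ _
  have m6 : ∀ x y, W x y (e 2) (e 1) = - W x y (e 1) (e 2) := fun x y => an' _ _ _ _
  have p1 := hW.pairSymm (e 1) (e 0)
  have p2 := hW.pairSymm (e 2) (e 0)
  have p3 := hW.pairSymm (e 3) (e 0)
  have p4 := hW.pairSymm (e 2) (e 3)
  have p5 := hW.pairSymm (e 3) (e 1) (e 1) (e 2)
  -- Every pair of indices is brought to one of 10, 20, 30, 23, 31, 12; the trace and Bianchi
  -- equations are then linear in the components that remain.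
  simp only [n1, n2, n3, n4, n5, n6, m1, m2, m3, m4, m5, m6, h0, h0', neg_neg, neg_zero]
    at t00 t01 t02 t03 t11 t12 t13 t22 t23 t33 bi
  have q1 := p1 (e 2) (e 3)
  have q2 := p2 (e 3) (e 1)
  have q3 := p3 (e 1) (e 2)
  have q4 := p1 (e 3) (e 1)
  have q5 := p1 (e 1) (e 2)
  have q6 := p2 (e 2) (e 3)
  have q7 := p2 (e 1) (e 2)
  have q8 := p3 (e 2) (e 3)
  have q9 := p3 (e 3) (e 1)
  have r1 := p1 (e 2) (e 0)
  have r2 := p1 (e 3) (e 0)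
  have r3 := p2 (e 3) (e 0)
  have r4 := p4 (e 3) (e 1)
  have r5 := p4 (e 1) (e 2)
  refine ⟨⟨?_, ?_, ?_, ?_, ?_, ?_⟩, ⟨?_, ?_, ?_⟩, ?_, ?_⟩ <;> linarith

/-- With the dual eliminated, symmetry and tracelessness of the matrix become the component
relations of `weyl_frame`. -/
lemma weylMatrix_eq (hW : IsWeylTensor e W) :
    weylMatrix e W = Matrix.of fun i j =>
      ((W (e i.succ) (e 0) (e j.succ) (e 0) : ℝ) : ℂ) - Complex.I *
        ((![W (e 2) (e 3) (e j.succ) (e 0), W (e 3) (e 1) (e j.succ) (e 0),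
          W (e 1) (e 2) (e j.succ) (e 0)] i : ℝ) : ℂ) := by
  ext i j
  have h := dual_frame hW (e j.succ) (e 0)
  fin_cases i
  · simp [weylMatrix, h.1, sub_eq_add_neg]
  · have : (Fin.succ (1 : Fin 3)) = 2 := rfl
    simp [weylMatrix, h.2.1, this, sub_eq_add_neg]
  · have : (Fin.succ (2 : Fin 3)) = 3 := rfl
    simp [weylMatrix, h.2.2.1, this, sub_eq_add_neg]

lemma weylMatrix_isSymm (hW : IsWeylTensor e W) : (weylMatrix e W).IsSymm := by
  obtain ⟨-, ⟨h1, h2, h3⟩, -, -⟩ := weyl_frame hW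
  have p := fun i j => hW.pairSymm (e i) (e 0) (e j) (e 0)
  have s1 : (Fin.succ (1 : Fin 3)) = 2 := rfl
  have s2 : (Fin.succ (2 : Fin 3)) = 3 := rfl
  rw [weylMatrix_eq hW]
  ext i j
  fin_cases i <;> fin_cases j <;> simp [s1, s2, h1, h2, h3, p]

lemma weylMatrix_trace (hW : IsWeylTensor e W) : (weylMatrix e W).trace = 0 := by
  obtain ⟨-, -, h1, h2⟩ := weyl_frame hW
  have s1 : (Fin.succ (1 : Fin 3)) = 2 := rfl
  have s2 : (Fin.succ (2 : Fin 3)) = 3 := rfl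
  rw [weylMatrix_eq hW]
  have h1' : ((W (e 1) (e 0) (e 1) (e 0) : ℝ) : ℂ) + (W (e 2) (e 0) (e 2) (e 0) : ℝ)
    + (W (e 3) (e 0) (e 3) (e 0) : ℝ) = 0 := by exact_mod_cast h1
  have h2' : ((W (e 2) (e 3) (e 1) (e 0) : ℝ) : ℂ) + (W (e 3) (e 1) (e 2) (e 0) : ℝ)
    + (W (e 1) (e 2) (e 3) (e 0) : ℝ) = 0 := by exact_mod_cast h2
  simp [Matrix.trace, Fin.sum_univ_three, s1, s2]
  linear_combination h1' - Complex.I * h2'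

/-- The self-dual Weyl tensor is determined by its complex matrix. -/
theorem weyl_add_dual (hW : IsWeylTensor e W) (x y z w : V) :
    (W x y z w : ℂ) + Complex.I * (dual e W x y z w : ℝ) =
      ∑ k, ∑ l, selfDual e x y k * weylMatrix e W k l * selfDual e z w l := by
  -- For a Weyl tensor the left and right duals agree, so W + i*W sees only the self-dual part of
  -- each bivector. In components this is the content of `weyl_frame`.
  obtain ⟨⟨a1, a2, a3, a4, a5, a6⟩, ⟨b1, b2, b3⟩, c1, c2⟩ := weyl_frame hW
  have an' : ∀ x y z w, W x y z w = - W x y w z := fun x y z w => by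
    rw [hW.pairSymm, hW.antisymm, hW.pairSymm]
  have E1 := antisymm_expand e (fun x y => W x y z w) (fun _ => tensor_isLinearMap_one W _ _ _)
    (fun _ => tensor_isLinearMap_two W _ _ _) (fun _ _ => hW.antisymm _ _ _ _) x y
  have E2 := antisymm_expand e (fun x y => dual e W x y z w)
    (fun _ => dual_isLinearMap_one e W _ _ _)
    (fun _ => dual_isLinearMap_two e W _ _ _) (fun _ _ => dual_antisymm e W _ _ _ _) x y
  have E3 := fun x y => antisymm_expand e (fun z w => W x y z w)
    (fun _ => tensor_isLinearMap_three W _ _ _)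
    (fun _ => tensor_isLinearMap_four W _ _ _) (fun _ _ => an' _ _ _ _) z w
  obtain ⟨d1, d2, d3, d4, d5, d6⟩ := dual_frame hW z w
  simp only [d1, d2, d3, d4, d5, d6] at E2
  have p := hW.pairSymm
  have s1 : (Fin.succ (1 : Fin 3)) = 2 := rfl
  have s2 : (Fin.succ (2 : Fin 3)) = 3 := rfl
  have m := weylMatrix_eq hW
  have sy : ∀ i j, weylMatrix e W i j = weylMatrix e W j i := fun i j =>
    ((weylMatrix_isSymm hW).apply i j).symm
  have z1 : ∀ i, W (e i) (e 0) (e 2) (e 3) = W (e 2) (e 3) (e i) (e 0) := fun i => p _ _ _ _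
  have z2 : ∀ i, W (e i) (e 0) (e 3) (e 1) = W (e 3) (e 1) (e i) (e 0) := fun i => p _ _ _ _
  have z3 : ∀ i, W (e i) (e 0) (e 1) (e 2) = W (e 1) (e 2) (e i) (e 0) := fun i => p _ _ _ _
  have z4 : W (e 3) (e 1) (e 2) (e 3) = W (e 2) (e 3) (e 3) (e 1) := p _ _ _ _
  have z5 : W (e 1) (e 2) (e 2) (e 3) = W (e 2) (e 3) (e 1) (e 2) := p _ _ _ _
  have z6 : W (e 1) (e 2) (e 3) (e 1) = W (e 3) (e 1) (e 1) (e 2) := p _ _ _ _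
  have z7 : W (e 2) (e 0) (e 1) (e 0) = W (e 1) (e 0) (e 2) (e 0) := p _ _ _ _
  have z8 : W (e 3) (e 0) (e 1) (e 0) = W (e 1) (e 0) (e 3) (e 0) := p _ _ _ _
  have z9 : W (e 3) (e 0) (e 2) (e 0) = W (e 2) (e 0) (e 3) (e 0) := p _ _ _ _
  rw [E1, E2]
  simp only [E3, z1, z2, z3, z4, z5, z6, z7, z8, z9, a1, a2, a3, a4, a5, a6, b1, b2, b3]
  rw [m]
  simp only [Fin.sum_univ_three, selfDual, Matrix.of_apply, Matrix.cons_val_zero,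
    Matrix.cons_val_one, Matrix.cons_val, Fin.succ_zero_eq_one, s1, s2,
    z7, z8, z9, b1, b2, b3]
  apply Complex.ext
  · simp
    ring
  · simp
    ring

/-! ### The Bel-Robinson tensor in terms of the complex matrix -/

/-- The Hermitian matrix of the symmetric traceless part of `X ⊗ Y`, as a map from anti-self-dual
to self-dual bivectors, in terms of the coordinates of `X` and `Y`. -/
noncomputable def hermCoord (X Y : Fin 4 → ℂ) : Matrix (Fin 3) (Fin 3) ℂ :=
  let t := X 0 * Y 0 + X 1 * Y 1 + X 2 * Y 2 + X 3 * Y 3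
  !![t - 2 * X 1 * Y 1,
      - X 1 * Y 2 - X 2 * Y 1 + Complex.I * (X 0 * Y 3 + X 3 * Y 0),
      - X 1 * Y 3 - X 3 * Y 1 - Complex.I * (X 0 * Y 2 + X 2 * Y 0);
    - X 1 * Y 2 - X 2 * Y 1 - Complex.I * (X 0 * Y 3 + X 3 * Y 0),
      t - 2 * X 2 * Y 2,
      - X 2 * Y 3 - X 3 * Y 2 + Complex.I * (X 0 * Y 1 + X 1 * Y 0);
    - X 1 * Y 3 - X 3 * Y 1 + Complex.I * (X 0 * Y 2 + X 2 * Y 0),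
      - X 2 * Y 3 - X 3 * Y 2 - Complex.I * (X 0 * Y 1 + X 1 * Y 0),
      t - 2 * X 3 * Y 3]

/-- The matrix `hermCoord` of two vectors. -/
noncomputable def hermMatrix (e : Module.Basis (Fin 4) ℝ V) (x y : V) : Matrix (Fin 3) (Fin 3) ℂ :=
  hermCoord (fun i => (e.repr x i : ℝ)) (fun i => (e.repr y i : ℝ))

lemma hermMatrix_symm (e : Module.Basis (Fin 4) ℝ V) (x y : V) :
    hermMatrix e x y = hermMatrix e y x := by
  ext i j
  fin_cases i <;> fin_cases j <;> simp [hermMatrix, hermCoord, hermCoord] <;> ring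

/-- This is the contraction over a frame index that arises in `belRobinson` once `weyl_add_dual` has
factored W + i*W. -/
lemma hermMatrix_eq_sum (e : Module.Basis (Fin 4) ℝ V) (x y : V) (k l : Fin 3) :
    hermMatrix e x y k l = ∑ i, ((sgn i : ℝ) : ℂ) * selfDual e x (e i) k *
      (starRingEnd ℂ) (selfDual e y (e i) l) := by
  have hI : Complex.I ^ 2 = -1 := Complex.I_sq
  fin_cases k <;> fin_cases l <;>
  · simp [hermMatrix, hermCoord, selfDual, Fin.sum_univ_four, Finsupp.single_apply]
    ring_nf
    try simp only [hI]
    try ring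

/-- With F = W + i*W, the sum of products of W and of *W is the real part of F F̄. Since F(x, ·, z,
·) = A_x M A_zᵀ, contracting the frame indices leaves `hermMatrix` between M and M̄. -/
theorem belRobinson_eq_trace (hW : IsWeylTensor e W) (x y z w : V) :
    ((belRobinson e W x y z w : ℝ) : ℂ) = (1 / 4) * (weylMatrix e W * hermMatrix e x y *
      (weylMatrix e W).map (starRingEnd ℂ) * (hermMatrix e z w)ᵀ).trace := by
  set M := weylMatrix e W with hM
  have hs : Mᵀ = M := weylMatrix_isSymm hW
  let A : V → Matrix (Fin 4) (Fin 3) ℂ := fun x => Matrix.of fun i k => selfDual e x (e i) k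
  let F : V → V → Matrix (Fin 4) (Fin 4) ℂ := fun x z => A x * M * (A z)ᵀ
  let D : Matrix (Fin 4) (Fin 4) ℂ := Matrix.diagonal fun i => ((sgn i : ℝ) : ℂ)
  have hF : ∀ x z i j, F x z i j = (W x (e i) z (e j) : ℂ) + Complex.I *
      (dual e W x (e i) z (e j) : ℝ) := fun x z i j => by
    rw [weyl_add_dual hW]
    simp only [F, Matrix.mul_apply, A, Matrix.of_apply, Matrix.transpose_apply, Finset.sum_mul]
    rw [Finset.sum_comm]
  have hK : ∀ x y, hermMatrix e x y = (A x)ᵀ * D * (A y).map (starRingEnd ℂ) := fun x y => by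
    ext k l
    rw [hermMatrix_eq_sum]
    rw [Matrix.mul_apply]
    refine Finset.sum_congr rfl fun i _ => ?_
    rw [Matrix.mul_diagonal]
    simp only [A, Matrix.transpose_apply, Matrix.of_apply, Matrix.map_apply]
    ring
  have hB : ∀ x y z w, ∑ i, ∑ j, ((sgn i : ℝ) : ℂ) * (sgn j : ℝ) *
      (F x z i j * (starRingEnd ℂ) (F y w i j)) =
      (M * hermMatrix e x y * M.map (starRingEnd ℂ) * (hermMatrix e z w)ᵀ).trace := by
    intro x y z w
    have h1 : ∑ i, ∑ j, ((sgn i : ℝ) : ℂ) * (sgn j : ℝ) *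
        (F x z i j * (starRingEnd ℂ) (F y w i j)) =
        ((F x z)ᵀ * D * (F y w).map (starRingEnd ℂ) * D).trace := by
      rw [Finset.sum_comm, Matrix.trace]
      refine Finset.sum_congr rfl fun j _ => ?_
      rw [Matrix.diag_apply, Matrix.mul_diagonal, Matrix.mul_apply, Finset.sum_mul]
      refine Finset.sum_congr rfl fun i _ => ?_
      rw [Matrix.mul_diagonal, Matrix.transpose_apply, Matrix.map_apply]
      ring
    have hD : Dᵀ = D := Matrix.diagonal_transpose _
    have h2 : (F y w).map (starRingEnd ℂ) = (A y).map (starRingEnd ℂ) * M.map (starRingEnd ℂ) *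
        ((A w).map (starRingEnd ℂ))ᵀ := by
      simp only [F, Matrix.map_mul, Matrix.transpose_map]
    rw [h1, h2, hK, hK]
    simp only [F, Matrix.transpose_mul, Matrix.transpose_transpose, hs, hD]
    simp only [Matrix.mul_assoc]
    rw [Matrix.trace_mul_comm]
    simp only [Matrix.mul_assoc]
  -- Exchanging x with y and z with w conjugates the sum, while the symmetry of `hermMatrix` leaves
  -- the trace fixed. So the trace equals its own real part.
  have h1 := hB x y z w
  have h2 := hB y x w z
  rw [hermMatrix_symm e y x, hermMatrix_symm e w z, ← h1] at h2
  have : ((belRobinson e W x y z w : ℝ) : ℂ) = (1 / 4) * ((1 / 2) *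
      ((∑ i, ∑ j, ((sgn i : ℝ) : ℂ) * (sgn j : ℝ) * (F x z i j * (starRingEnd ℂ) (F y w i j)))
      + ∑ i, ∑ j, ((sgn i : ℝ) : ℂ) * (sgn j : ℝ) *
        (F y w i j * (starRingEnd ℂ) (F x z i j)))) := by
    unfold belRobinson
    push_cast
    congr 1
    rw [← Finset.sum_add_distrib, Finset.mul_sum]
    refine Finset.sum_congr rfl fun i _ => ?_
    rw [← Finset.sum_add_distrib, Finset.mul_sum]
    refine Finset.sum_congr rfl fun j _ => ?_
    rw [hF, hF]
    simp only [map_add, map_mul, Complex.conj_ofReal, Complex.conj_I]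
    ring_nf
    simp only [Complex.I_sq]
    ring
  rw [this, h2, h1]
  ring

/-- The matrix `hermCoord` of two frame vectors. -/
noncomputable def frameMatrix (a b : Fin 4) : Matrix (Fin 3) (Fin 3) ℂ :=
  hermCoord (Pi.single a 1) (Pi.single b 1)

lemma hermMatrix_frame (e : Module.Basis (Fin 4) ℝ V) (a b : Fin 4) :
    hermMatrix e (e a) (e b) = frameMatrix a b := by
  have : ∀ a, (fun i => ((e.repr (e a) i : ℝ) : ℂ)) = Pi.single a 1 := fun a => by
    funext i
    by_cases h : i = a
    · subst h; simp
    · simp [h]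
  rw [hermMatrix, this, this, frameMatrix]

/-- `frameMatrix 0 0` is the identity, the mixed `frameMatrix 0 i` are i times antisymmetric
matrices and the spatial ones are real symmetric. Contraction with them thus reads off the trace,
the antisymmetric part and the symmetric part of P. -/
lemma trace_frameMatrix_zero (P : Matrix (Fin 3) (Fin 3) ℂ) :
    (P * (frameMatrix 0 0)ᵀ).trace = P.trace := by
  simp [frameMatrix, hermCoord, Matrix.trace, Matrix.mul_apply, Fin.sum_univ_three]

lemma trace_frameMatrix_mixed_sq (P : Matrix (Fin 3) (Fin 3) ℂ) :
    ∑ i : Fin 3, (P * (frameMatrix 0 i.succ)ᵀ).trace ^ 2 =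
      ∑ k, ∑ l, P k l * P l k - ∑ k, ∑ l, P k l ^ 2 := by
  have s1 : (Fin.succ (1 : Fin 3)) = 2 := rfl
  have s2 : (Fin.succ (2 : Fin 3)) = 3 := rfl
  simp [frameMatrix, hermCoord, Matrix.trace, Matrix.mul_apply, Fin.sum_univ_three, s1, s2]
  ring_nf
  simp only [Complex.I_sq]
  ring

lemma trace_frameMatrix_space_sq (P : Matrix (Fin 3) (Fin 3) ℂ) :
    ∑ i : Fin 3, ∑ j : Fin 3, (P * (frameMatrix i.succ j.succ)ᵀ).trace ^ 2 =
      2 * ∑ k, ∑ l, P k l ^ 2 + 2 * ∑ k, ∑ l, P k l * P l k - P.trace ^ 2 := by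
  have s1 : (Fin.succ (1 : Fin 3)) = 2 := rfl
  have s2 : (Fin.succ (2 : Fin 3)) = 3 := rfl
  simp [frameMatrix, hermCoord, Matrix.trace, Matrix.mul_apply, Fin.sum_univ_three, s1, s2]
  ring

/-- Five free entries remain, so that the invariants below become polynomial identities that `ring`
can decide. -/
lemma eq_of_symm_trace {M : Matrix (Fin 3) (Fin 3) ℂ} (hs : M.IsSymm) (ht : M.trace = 0) :
    M = !![M 0 0, M 0 1, M 0 2; M 0 1, M 1 1, M 1 2; M 0 2, M 1 2, - M 0 0 - M 1 1] := by
  have h1 := hs.apply 0 1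
  have h2 := hs.apply 0 2
  have h3 := hs.apply 1 2
  have h4 : M 2 2 = - M 0 0 - M 1 1 := by
    rw [Matrix.trace, Fin.sum_univ_three] at ht
    simp only [Matrix.diag_apply] at ht
    linear_combination ht
  ext i j
  fin_cases i <;> fin_cases j <;> simp [h1, h2, h3, h4]

/-! ### Quartic invariants of a pair of symmetric traceless matrices. -/

section Quartic

variable {M N : Matrix (Fin 3) (Fin 3) ℂ}

/-- Here and below N stands for the conjugate of M. Conjugation is not polynomial, so the entries of
N are treated as independent variables. -/
lemma quartic_two (hM : M.IsSymm) (hM0 : M.trace = 0) (hN : N.IsSymm) (hN0 : N.trace = 0) :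
    ∑ i : Fin 3, (M * frameMatrix 0 0 * N * (frameMatrix 0 i.succ)ᵀ).trace ^ 2 =
      (M * N).trace ^ 2 - (3 * ∑ k, ∑ l, (M * M) k l * (N * N) k l
        - (1 / 2) * (M * M).trace * (N * N).trace) := by
  rw [trace_frameMatrix_mixed_sq]
  rw [eq_of_symm_trace hM hM0, eq_of_symm_trace hN hN0]
  generalize M 0 0 = a, M 0 1 = b, M 0 2 = c, M 1 1 = d, M 1 2 = f
  generalize N 0 0 = a', N 0 1 = b', N 0 2 = c', N 1 1 = d', N 1 2 = f'
  simp [frameMatrix, hermCoord, Matrix.trace, Matrix.mul_apply, Fin.sum_univ_three]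
  ring

lemma quartic_stress (hM : M.IsSymm) (hM0 : M.trace = 0) (hN : N.IsSymm) (hN0 : N.trace = 0) :
    ∑ i : Fin 3, ∑ j : Fin 3,
      (M * frameMatrix 0 0 * N * (frameMatrix i.succ j.succ)ᵀ).trace ^ 2 =
      (1 / 3) * (M * N).trace ^ 2 + (2 / 3) * ((M * M).trace * (N * N).trace)
        + (2 / 3) * ((M * N).trace ^ 2 - (3 * ∑ k, ∑ l, (M * M) k l * (N * N) k l
          - (1 / 2) * (M * M).trace * (N * N).trace)) := by
  rw [trace_frameMatrix_space_sq]
  rw [eq_of_symm_trace hM hM0, eq_of_symm_trace hN hN0]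
  generalize M 0 0 = a, M 0 1 = b, M 0 2 = c, M 1 1 = d, M 1 2 = f
  generalize N 0 0 = a', N 0 1 = b', N 0 2 = c', N 1 1 = d', N 1 2 = f'
  simp [frameMatrix, hermCoord, Matrix.trace, Matrix.mul_apply, Fin.sum_univ_three]
  ring

lemma quartic_flux (hM : M.IsSymm) (hM0 : M.trace = 0) (hN : N.IsSymm) (hN0 : N.trace = 0) :
    ∑ h : Fin 3, ∑ i : Fin 3, ∑ j : Fin 3,
      (M * frameMatrix 0 h.succ * N * (frameMatrix i.succ j.succ)ᵀ).trace ^ 2 =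
      (M * N).trace ^ 2 + (3 * ∑ k, ∑ l, (M * M) k l * (N * N) k l
          - (1 / 2) * (M * M).trace * (N * N).trace) - 2 * ((M * M).trace * (N * N).trace) := by
  simp only [trace_frameMatrix_space_sq]
  rw [eq_of_symm_trace hM hM0, eq_of_symm_trace hN hN0]
  generalize M 0 0 = a, M 0 1 = b, M 0 2 = c, M 1 1 = d, M 1 2 = f
  generalize N 0 0 = a', N 0 1 = b', N 0 2 = c', N 1 1 = d', N 1 2 = f'
  have s1 : (Fin.succ (1 : Fin 3)) = 2 := rfl
  have s2 : (Fin.succ (2 : Fin 3)) = 3 := rfl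
  simp [frameMatrix, hermCoord, Matrix.trace, Matrix.mul_apply, Fin.sum_univ_three, s1, s2]
  ring_nf
  simp only [Complex.I_sq]
  ring

lemma quartic_stress_stress (hM : M.IsSymm) (hM0 : M.trace = 0) (hN : N.IsSymm)
    (hN0 : N.trace = 0) :
    ∑ h : Fin 3, ∑ h' : Fin 3, ∑ i : Fin 3, ∑ j : Fin 3,
      (M * frameMatrix h.succ h'.succ * N * (frameMatrix i.succ j.succ)ᵀ).trace ^ 2 =
      (M * N).trace ^ 2 + 4 * (3 * ∑ k, ∑ l, (M * M) k l * (N * N) k l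
          - (1 / 2) * (M * M).trace * (N * N).trace) + 4 * ((M * M).trace * (N * N).trace) := by
  simp only [trace_frameMatrix_space_sq]
  rw [eq_of_symm_trace hM hM0, eq_of_symm_trace hN hN0]
  generalize M 0 0 = a, M 0 1 = b, M 0 2 = c, M 1 1 = d, M 1 2 = f
  generalize N 0 0 = a', N 0 1 = b', N 0 2 = c', N 1 1 = d', N 1 2 = f'
  have s1 : (Fin.succ (1 : Fin 3)) = 2 := rfl
  have s2 : (Fin.succ (2 : Fin 3)) = 3 := rfl
  simp [frameMatrix, hermCoord, Matrix.trace, Matrix.mul_apply, Fin.sum_univ_three, s1, s2]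
  ring

/-- A completeness relation: with Lorentzian signs, the frame matrices resolve the bilinear form Σ
P_kl² on all 3 × 3 matrices. It is used twice in `quartic_full`, once for each pair of indices. -/
lemma trace_frameMatrix_sq (P : Matrix (Fin 3) (Fin 3) ℂ) :
    ∑ a : Fin 4, ∑ b : Fin 4, ((sgn a : ℝ) : ℂ) * (sgn b : ℝ) *
      (P * (frameMatrix a b)ᵀ).trace ^ 2 = 4 * ∑ k, ∑ l, P k l ^ 2 := by
  simp [frameMatrix, hermCoord, Matrix.trace, Matrix.mul_apply, Fin.sum_univ_three,
    Fin.sum_univ_four]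
  ring_nf
  simp only [Complex.I_sq]
  ring

lemma quartic_full (hM : M.IsSymm) (hN : N.IsSymm) :
    ∑ a : Fin 4, ∑ b : Fin 4, ((sgn a : ℝ) : ℂ) * (sgn b : ℝ) *
      ∑ c : Fin 4, ∑ d : Fin 4, ((sgn c : ℝ) : ℂ) * (sgn d : ℝ) *
        (M * frameMatrix a b * N * (frameMatrix c d)ᵀ).trace ^ 2 =
      16 * ((M * M).trace * (N * N).trace) := by
  simp only [trace_frameMatrix_sq]
  -- An entry of M K N is the contraction of K with a product of a row of M and a column of N, so
  -- the completeness relation applies a second time.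
  have h1 : ∀ k l a b, (M * frameMatrix a b * N) k l =
      ((Matrix.of fun m n => M k m * N n l) * (frameMatrix a b)ᵀ).trace := by
    intro k l a b
    simp only [Matrix.trace, Matrix.diag_apply, Matrix.mul_apply, Matrix.of_apply,
      Matrix.transpose_apply, Finset.sum_mul]
    rw [Finset.sum_comm]
    exact Finset.sum_congr rfl fun i _ => Finset.sum_congr rfl fun j _ => by ring
  have h2 : ∑ a : Fin 4, ∑ b : Fin 4, ((sgn a : ℝ) : ℂ) * (sgn b : ℝ) *
      (4 * ∑ k, ∑ l, (M * frameMatrix a b * N) k l ^ 2) =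
      4 * ∑ k, ∑ l, ∑ a : Fin 4, ∑ b : Fin 4, ((sgn a : ℝ) : ℂ) * (sgn b : ℝ) *
        (M * frameMatrix a b * N) k l ^ 2 := by
    simp only [Fin.sum_univ_three, Fin.sum_univ_four]
    ring
  rw [h2]
  simp only [h1, trace_frameMatrix_sq, Matrix.of_apply]
  have h3 := hM.apply
  have h4 := hN.apply
  simp only [Matrix.trace, Matrix.diag_apply, Matrix.mul_apply, Fin.sum_univ_three, h3 0 1, h3 0 2,
    h3 1 2, h4 0 1, h4 0 2, h4 1 2]
  ring

end Quartic

/-! ### The super-energy scalars of the observer of a frame -/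

/-- The squared Frobenius norm. -/
noncomputable def frob (A : Matrix (Fin 3) (Fin 3) ℂ) : ℝ := ∑ i, ∑ j, ‖A i j‖ ^ 2

lemma frob_eq (A : Matrix (Fin 3) (Fin 3) ℂ) :
    ((frob A : ℝ) : ℂ) = ∑ i, ∑ j, A i j * (A.map (starRingEnd ℂ)) i j := by
  unfold frob
  push_cast
  simp only [Matrix.map_apply, Complex.mul_conj']

lemma trace_mul_conj {M : Matrix (Fin 3) (Fin 3) ℂ} (hM : M.IsSymm) :
    (M * M.map (starRingEnd ℂ)).trace = ((frob M : ℝ) : ℂ) := by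
  rw [frob_eq, Matrix.trace]
  refine Finset.sum_congr rfl fun i _ => ?_
  rw [Matrix.diag_apply, Matrix.mul_apply]
  refine Finset.sum_congr rfl fun j _ => ?_
  rw [Matrix.map_apply, Matrix.map_apply, hM.apply]

/-- `16` times the causal norm `τ² - |q|²` of the four-momentum `T(u,u,u,·)`. -/
noncomputable def momentumSq (M : Matrix (Fin 3) (Fin 3) ℂ) : ℝ :=
  3 * frob (M * M) - (1 / 2) * ‖(M * M).trace‖ ^ 2

lemma trace_map_conj (A : Matrix (Fin 3) (Fin 3) ℂ) :
    (A.map (starRingEnd ℂ)).trace = (starRingEnd ℂ) A.trace := by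
  simp [Matrix.trace, Fin.sum_univ_three]

lemma momentumSq_eq (M : Matrix (Fin 3) (Fin 3) ℂ) :
    ((momentumSq M : ℝ) : ℂ) = 3 * ∑ k, ∑ l, (M * M) k l *
      (M.map (starRingEnd ℂ) * M.map (starRingEnd ℂ)) k l
        - (1 / 2) * (M * M).trace * (M.map (starRingEnd ℂ) * M.map (starRingEnd ℂ)).trace := by
  unfold momentumSq
  rw [← Matrix.map_mul, trace_map_conj]
  push_cast
  rw [frob_eq, mul_assoc (1 / 2 : ℂ), Complex.mul_conj']

lemma conj_isSymm {M : Matrix (Fin 3) (Fin 3) ℂ} (hM : M.IsSymm) :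
    (M.map (starRingEnd ℂ)).IsSymm := hM.map _

lemma conj_trace_zero {M : Matrix (Fin 3) (Fin 3) ℂ} (hM : M.trace = 0) :
    (M.map (starRingEnd ℂ)).trace = 0 := by rw [trace_map_conj, hM, map_zero]

lemma belRobinson_frame (hW : IsWeylTensor e W) (a b c d : Fin 4) :
    ((belRobinson e W (e a) (e b) (e c) (e d) : ℝ) : ℂ) = (1 / 4) * (weylMatrix e W *
      frameMatrix a b * (weylMatrix e W).map (starRingEnd ℂ) * (frameMatrix c d)ᵀ).trace := by
  rw [belRobinson_eq_trace hW, hermMatrix_frame, hermMatrix_frame]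

lemma frameMatrix_zero_zero : frameMatrix 0 0 = 1 := by
  ext i j
  fin_cases i <;> fin_cases j <;> simp [frameMatrix, hermCoord]

lemma proj_frame_zero (he : IsOrthonormalFrame g e) : proj g (e 0) (e 0) = 0 := by
  simp [proj, he 0 0]

lemma proj_frame_succ (he : IsOrthonormalFrame g e) (i : Fin 3) :
    proj g (e 0) (e i.succ) = e i.succ := by
  simp [proj, he 0 i.succ, (Fin.succ_ne_zero i).symm]

lemma tau_frame (hW : IsWeylTensor e W) : tau e W (e 0) = frob (weylMatrix e W) / 4 := by
  have h := belRobinson_frame hW 0 0 0 0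
  rw [trace_frameMatrix_zero, frameMatrix_zero_zero, mul_one,
    trace_mul_conj (weylMatrix_isSymm hW)] at h
  rw [tau, div_eq_mul_inv, mul_comm, ← one_div]
  apply Complex.ofReal_injective
  rw [h]
  push_cast
  ring

lemma belRobinsonSq_frame (hW : IsWeylTensor e W) :
    belRobinsonSq e W = ‖(weylMatrix e W * weylMatrix e W).trace‖ ^ 2 := by
  have h := quartic_full (weylMatrix_isSymm hW) (conj_isSymm (weylMatrix_isSymm hW))
  rw [← Matrix.map_mul, trace_map_conj, Complex.mul_conj'] at h
  have h2 : ((belRobinsonSq e W : ℝ) : ℂ) = ∑ a : Fin 4, ∑ b : Fin 4, ((sgn a : ℝ) : ℂ) *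
      (sgn b : ℝ) * ∑ c : Fin 4, ∑ d : Fin 4, ((sgn c : ℝ) : ℂ) * (sgn d : ℝ) * ((1 / 16) *
        (weylMatrix e W * frameMatrix a b * (weylMatrix e W).map (starRingEnd ℂ) *
          (frameMatrix c d)ᵀ).trace ^ 2) := by
    unfold belRobinsonSq
    push_cast
    simp only [belRobinson_frame hW, Finset.mul_sum]
    refine Finset.sum_congr rfl fun a _ => Finset.sum_congr rfl fun b _ =>
      Finset.sum_congr rfl fun c _ => Finset.sum_congr rfl fun d _ => by ring
  have h3 : ((belRobinsonSq e W : ℝ) : ℂ) = (1 / 16) * (16 *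
      (‖(weylMatrix e W * weylMatrix e W).trace‖ : ℂ) ^ 2) := by
    rw [← h, h2]
    simp only [Finset.mul_sum]
    refine Finset.sum_congr rfl fun a _ => Finset.sum_congr rfl fun b _ =>
      Finset.sum_congr rfl fun c _ => Finset.sum_congr rfl fun d _ => by ring
  have h4 : belRobinsonSq e W = (1 / 16) * (16 *
      ‖(weylMatrix e W * weylMatrix e W).trace‖ ^ 2) := by
    apply Complex.ofReal_injective
    rw [h3]
    push_cast
    ring
  rw [h4]; ring

lemma alpha_frame (hW : IsWeylTensor e W) :
    alpha e W = ‖(weylMatrix e W * weylMatrix e W).trace‖ / 2 := by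
  rw [alpha, belRobinsonSq_frame hW, Real.sqrt_sq (norm_nonneg _)]
  ring

lemma belRobinson_zero (e : Module.Basis (Fin 4) ℝ V) (W : Tensor4 V) :
    (∀ y z w, belRobinson e W 0 y z w = 0) ∧ (∀ x z w, belRobinson e W x 0 z w = 0) ∧
    (∀ x y w, belRobinson e W x y 0 w = 0) ∧ (∀ x y z, belRobinson e W x y z 0 = 0) :=
  ⟨fun y z w => (belRobinson_isLinearMap_one e W y z w).map_zero,
   fun x z w => (belRobinson_isLinearMap_two e W x z w).map_zero,
   fun x y w => (belRobinson_isLinearMap_three e W x y w).map_zero,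
   fun x y z => (belRobinson_isLinearMap_four e W x y z).map_zero⟩

/-- In the observer's own frame the projection kills `e 0` and fixes the triad, so the Lorentzian
norm is a sum of squares of spatial components, given by `quartic_two` with N = M̄. The next three
lemmas follow the same pattern. -/
lemma absq_frame (he : IsOrthonormalFrame g e) (hW : IsWeylTensor e W) :
    absq g e W (e 0) = √(tau e W (e 0) ^ 2 - momentumSq (weylMatrix e W) / 16) := by
  unfold absq
  congr 1
  have hM := weylMatrix_isSymm hW
  have ht := weylMatrix_trace hW
  have h := quartic_two hM ht (conj_isSymm hM) (conj_trace_zero ht)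
  rw [← momentumSq_eq, trace_mul_conj hM] at h
  rw [tau_frame hW]
  have h2 : ((∑ i, sgn i * qPerp g e W (e 0) (e i) ^ 2 : ℝ) : ℂ) = (1 / 16) *
      (((frob (weylMatrix e W) : ℝ) : ℂ) ^ 2 - (momentumSq (weylMatrix e W) : ℝ)) := by
    rw [← h, Finset.mul_sum, Fin.sum_univ_succ]
    simp only [qPerp, proj_frame_zero he, proj_frame_succ he, (belRobinson_zero e W).2.2.2,
      sgn_succ]
    push_cast
    simp only [belRobinson_frame hW]
    simp only [neg_zero, ne_eq, OfNat.ofNat_ne_zero, not_false_eq_true, zero_pow, mul_zero,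
      zero_add]
    exact Finset.sum_congr rfl fun i _ => by ring
  have h3 : ∑ i, sgn i * qPerp g e W (e 0) (e i) ^ 2 = (1 / 16) *
      (frob (weylMatrix e W) ^ 2 - momentumSq (weylMatrix e W)) := by
    apply Complex.ofReal_injective
    rw [h2]
    push_cast
    ring
  rw [h3]; ring

lemma abst_frame (he : IsOrthonormalFrame g e) (hW : IsWeylTensor e W) :
    abst g e W (e 0) = √((1 / 3) * tau e W (e 0) ^ 2 + (1 / 6) * alpha e W ^ 2
      + (2 / 3) * (tau e W (e 0) ^ 2 - momentumSq (weylMatrix e W) / 16)) := by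
  unfold abst
  congr 1
  have hM := weylMatrix_isSymm hW
  have ht := weylMatrix_trace hW
  have h := quartic_stress hM ht (conj_isSymm hM) (conj_trace_zero ht)
  rw [← momentumSq_eq, trace_mul_conj hM, ← Matrix.map_mul, trace_map_conj,
    Complex.mul_conj'] at h
  rw [tau_frame hW, alpha_frame hW]
  have h2 : ((∑ i, ∑ j, sgn i * sgn j * tPerp g e W (e 0) (e i) (e j) ^ 2 : ℝ) : ℂ) =
      (1 / 16) * ((1 / 3) * ((frob (weylMatrix e W) : ℝ) : ℂ) ^ 2 +
        (2 / 3) * (‖(weylMatrix e W * weylMatrix e W).trace‖ : ℂ) ^ 2 +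
        (2 / 3) * (((frob (weylMatrix e W) : ℝ) : ℂ) ^ 2
          - (momentumSq (weylMatrix e W) : ℝ))) := by
    rw [← h]
    simp only [Finset.mul_sum]
    simp only [Fin.sum_univ_succ (n := 3), tPerp, proj_frame_zero he, proj_frame_succ he,
      (belRobinson_zero e W).2.2.2, (belRobinson_zero e W).2.2.1, sgn_succ]
    push_cast
    simp only [belRobinson_frame hW]
    simp only [ne_eq, OfNat.ofNat_ne_zero, not_false_eq_true, zero_pow, mul_zero,
      zero_add, Finset.sum_const_zero]
    exact Finset.sum_congr rfl fun i _ => Finset.sum_congr rfl fun j _ => by ring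
  have h3 : ∑ i, ∑ j, sgn i * sgn j * tPerp g e W (e 0) (e i) (e j) ^ 2 = (1 / 16) *
      ((1 / 3) * frob (weylMatrix e W) ^ 2 +
        (2 / 3) * ‖(weylMatrix e W * weylMatrix e W).trace‖ ^ 2 +
        (2 / 3) * (frob (weylMatrix e W) ^ 2 - momentumSq (weylMatrix e W))) := by
    apply Complex.ofReal_injective
    rw [h2]
    push_cast
    ring
  rw [h3]; ring

lemma absQ_frame (he : IsOrthonormalFrame g e) (hW : IsWeylTensor e W) :
    absQ g e W (e 0) = √(tau e W (e 0) ^ 2 + momentumSq (weylMatrix e W) / 16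
      - (1 / 2) * alpha e W ^ 2) := by
  unfold absQ
  refine congrArg Real.sqrt ?_
  have hM := weylMatrix_isSymm hW
  have ht := weylMatrix_trace hW
  have h := quartic_flux hM ht (conj_isSymm hM) (conj_trace_zero ht)
  rw [← momentumSq_eq, trace_mul_conj hM, ← Matrix.map_mul, trace_map_conj,
    Complex.mul_conj'] at h
  rw [tau_frame hW, alpha_frame hW]
  have h2 : ((∑ i, ∑ j, ∑ k, sgn i * sgn j * sgn k *
      QPerp g e W (e 0) (e i) (e j) (e k) ^ 2 : ℝ) : ℂ) =
      (1 / 16) * (((frob (weylMatrix e W) : ℝ) : ℂ) ^ 2 + (momentumSq (weylMatrix e W) : ℝ) -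
        2 * (‖(weylMatrix e W * weylMatrix e W).trace‖ : ℂ) ^ 2) := by
    rw [← h]
    simp only [Finset.mul_sum]
    simp only [Fin.sum_univ_succ (n := 3), QPerp, proj_frame_zero he, proj_frame_succ he,
      (belRobinson_zero e W).2.2.2, (belRobinson_zero e W).2.2.1, (belRobinson_zero e W).2.1,
      sgn_succ]
    push_cast
    simp only [belRobinson_frame hW]
    simp only [ne_eq, OfNat.ofNat_ne_zero, not_false_eq_true, zero_pow, mul_zero, neg_zero,
      zero_add, Finset.sum_const_zero]
    exact Finset.sum_congr rfl fun i _ => Finset.sum_congr rfl fun j _ =>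
      Finset.sum_congr rfl fun k _ => by ring
  have h3 : ∑ i, ∑ j, ∑ k, sgn i * sgn j * sgn k *
      QPerp g e W (e 0) (e i) (e j) (e k) ^ 2 = (1 / 16) *
      (frob (weylMatrix e W) ^ 2 + momentumSq (weylMatrix e W) -
        2 * ‖(weylMatrix e W * weylMatrix e W).trace‖ ^ 2) := by
    apply Complex.ofReal_injective
    rw [h2]
    push_cast
    ring
  rw [h3]; ring

lemma absT_frame (he : IsOrthonormalFrame g e) (hW : IsWeylTensor e W) :
    absT g e W (e 0) = √(tau e W (e 0) ^ 2 + 4 * (momentumSq (weylMatrix e W) / 16)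
      + alpha e W ^ 2) := by
  unfold absT
  refine congrArg Real.sqrt ?_
  have hM := weylMatrix_isSymm hW
  have ht := weylMatrix_trace hW
  have h := quartic_stress_stress hM ht (conj_isSymm hM) (conj_trace_zero ht)
  rw [← momentumSq_eq, trace_mul_conj hM, ← Matrix.map_mul, trace_map_conj,
    Complex.mul_conj'] at h
  rw [tau_frame hW, alpha_frame hW]
  have h2 : ((∑ i, ∑ j, ∑ k, ∑ l, sgn i * sgn j * sgn k * sgn l *
      TPerp g e W (e 0) (e i) (e j) (e k) (e l) ^ 2 : ℝ) : ℂ) =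
      (1 / 16) * (((frob (weylMatrix e W) : ℝ) : ℂ) ^ 2 +
        4 * (momentumSq (weylMatrix e W) : ℝ) +
        4 * (‖(weylMatrix e W * weylMatrix e W).trace‖ : ℂ) ^ 2) := by
    rw [← h]
    simp only [Finset.mul_sum]
    simp only [Fin.sum_univ_succ (n := 3), TPerp, proj_frame_zero he, proj_frame_succ he,
      (belRobinson_zero e W).2.2.2, (belRobinson_zero e W).2.2.1, (belRobinson_zero e W).2.1,
      (belRobinson_zero e W).1, sgn_succ]
    push_cast
    simp only [belRobinson_frame hW]
    simp only [ne_eq, OfNat.ofNat_ne_zero, not_false_eq_true, zero_pow, mul_zero,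
      zero_add, Finset.sum_const_zero]
    exact Finset.sum_congr rfl fun i _ => Finset.sum_congr rfl fun j _ =>
      Finset.sum_congr rfl fun k _ => Finset.sum_congr rfl fun l _ => by ring
  have h3 : ∑ i, ∑ j, ∑ k, ∑ l, sgn i * sgn j * sgn k * sgn l *
      TPerp g e W (e 0) (e i) (e j) (e k) (e l) ^ 2 = (1 / 16) *
      (frob (weylMatrix e W) ^ 2 + 4 * momentumSq (weylMatrix e W) +
        4 * ‖(weylMatrix e W * weylMatrix e W).trace‖ ^ 2) := by
    apply Complex.ofReal_injective
    rw [h2]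
    push_cast
    ring
  rw [h3]; ring

/-! ### Change of frame -/

/-- The dot product of the self-dual parts of two general bivectors also has an imaginary part,
proportional to the volume of their four vectors. It vanishes here because `y` is shared. -/
lemma selfDual_mul (he : IsOrthonormalFrame g e) (x y z : V) :
    ∑ k, selfDual e x y k * selfDual e z y k =
      ((g x y * g z y - g x z * g y y : ℝ) : ℂ) := by
  rw [he.metric_eq, he.metric_eq, he.metric_eq, he.metric_eq]
  simp only [Fin.sum_univ_three, Fin.sum_univ_four, selfDual, Matrix.cons_val_zero,
    Matrix.cons_val_one, Matrix.cons_val, sgn_zero, sgn_one, sgn_two, sgn_three]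
  apply Complex.ext
  · simp
    ring
  · simp
    ring

/-- The complex orthogonal matrix of a change of frame. -/
noncomputable def frameRotation (e e' : Module.Basis (Fin 4) ℝ V) : Matrix (Fin 3) (Fin 3) ℂ :=
  Matrix.of fun i k => selfDual e (e' i.succ) (e' 0) k

lemma FrameEquiv.rotation_mul_transpose (h : FrameEquiv g e e') :
    frameRotation e e' * (frameRotation e e')ᵀ = 1 := by
  ext i j
  rw [Matrix.mul_apply]
  simp only [frameRotation, Matrix.of_apply, Matrix.transpose_apply]
  rw [selfDual_mul h.left, h.right, h.right, h.right, h.right]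
  by_cases hij : i = j
  · subst hij; simp [Fin.succ_ne_zero]
  · simp [Fin.succ_ne_zero, hij]

lemma FrameEquiv.weylMatrix_eq (h : FrameEquiv g e e') (hW : IsWeylTensor e W) :
    weylMatrix e' W = frameRotation e e' * weylMatrix e W * (frameRotation e e')ᵀ := by
  ext i j
  have h1 : weylMatrix e' W i j = (W (e' i.succ) (e' 0) (e' j.succ) (e' 0) : ℂ) + Complex.I *
      (dual e W (e' i.succ) (e' 0) (e' j.succ) (e' 0) : ℝ) := by
    rw [weylMatrix, h.dual_eq]; rfl
  rw [h1, weyl_add_dual hW, Matrix.mul_apply]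
  simp only [Matrix.mul_apply, Matrix.transpose_apply, frameRotation, Matrix.of_apply,
    Finset.sum_mul]
  rw [Finset.sum_comm]

/-- The unit of a matrix with orthonormal rows. -/
def orthUnit (Q : Matrix (Fin 3) (Fin 3) ℂ) (h : Q * Qᵀ = 1) : (Matrix (Fin 3) (Fin 3) ℂ)ˣ :=
  ⟨Q, Qᵀ, h, mul_eq_one_comm.mp h⟩

lemma orthUnit_val (Q : Matrix (Fin 3) (Fin 3) ℂ) (h : Q * Qᵀ = 1) :
    (orthUnit Q h).val = Q := rfl

lemma orthUnit_inv (Q : Matrix (Fin 3) (Fin 3) ℂ) (h : Q * Qᵀ = 1) :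
    (orthUnit Q h)⁻¹.val = Qᵀ := rfl

/-- The transpose of a complex orthogonal matrix is its inverse, so a change of frame is a
similarity: eigenvalues and minimal polynomial belong to W alone. -/
lemma charpoly_conj {M Q : Matrix (Fin 3) (Fin 3) ℂ} (h : Q * Qᵀ = 1) :
    (Q * M * Qᵀ).charpoly = M.charpoly := by
  have hi : Q⁻¹ = Qᵀ := Matrix.inv_eq_right_inv h
  have := Matrix.charpoly_units_conj (orthUnit Q h) M
  rwa [orthUnit_val, hi] at this

lemma minpoly_units_conj (u : (Matrix (Fin 3) (Fin 3) ℂ)ˣ) (M : Matrix (Fin 3) (Fin 3) ℂ) :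
    minpoly ℂ (u.val * M * u⁻¹.val) = minpoly ℂ M :=
  minpoly.algEquiv_eq (MulSemiringAction.toAlgEquiv ℂ (Matrix (Fin 3) (Fin 3) ℂ)
    (ConjAct.toConjAct u)) M

lemma FrameEquiv.charpoly_eq (h : FrameEquiv g e e') (hW : IsWeylTensor e W) :
    (weylMatrix e' W).charpoly = (weylMatrix e W).charpoly := by
  rw [h.weylMatrix_eq hW, charpoly_conj h.rotation_mul_transpose]

lemma FrameEquiv.minpoly_eq (h : FrameEquiv g e e') (hW : IsWeylTensor e W) :
    minpoly ℂ (weylMatrix e' W) = minpoly ℂ (weylMatrix e W) := by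
  rw [h.weylMatrix_eq hW]
  have := minpoly_units_conj (orthUnit _ h.rotation_mul_transpose) (weylMatrix e W)
  rwa [orthUnit_val, orthUnit_inv] at this

lemma FrameEquiv.xi_eq (h : FrameEquiv g e e') (hW : IsWeylTensor e W) : xi e' W = xi e W := by
  unfold xi; rw [h.charpoly_eq hW]

/-! ### Construction of rotated and boosted frames. -/

/-- Four vectors with the products and the volume of an orthonormal frame are one. -/
lemma exists_frameEquiv (he : IsOrthonormalFrame g e) (v : Fin 4 → V)
    (hv : ∀ i j, g (v i) (v j) = if i = j then sgn i else 0) (hd : e.det v = 1)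
    (ho : ∀ u, g u u = -1 → (g u (e 0) < 0 ↔ g u (v 0) < 0)) :
    ∃ e' : Module.Basis (Fin 4) ℝ V, FrameEquiv g e e' ∧ ⇑e' = v := by
  have hb := (Module.Basis.is_basis_iff_det e (v := v)).2 (by rw [hd]; exact isUnit_one)
  refine ⟨Module.Basis.mk hb.1 hb.2.ge, ?_, Module.Basis.coe_mk _ _⟩
  have hc : ⇑(Module.Basis.mk hb.1 hb.2.ge) = v := Module.Basis.coe_mk _ _
  set e' := Module.Basis.mk hb.1 hb.2.ge
  refine ⟨he, fun i j => by rw [hc, hv], ?_, fun u => ?_⟩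
  · have := e.det.eq_smul_basis_det e'
    rw [hc, hd, one_smul] at this
    exact this.symm
  · unfold IsObserver
    rw [hc]
    exact and_congr_right (ho u)

/-- The frame with spatial vectors given by a rotation matrix. -/
lemma exists_rotated_frame (he : IsOrthonormalFrame g e) (R : Matrix (Fin 3) (Fin 3) ℝ)
    (hR : R * Rᵀ = 1) (hd : R.det = 1) :
    ∃ e' : Module.Basis (Fin 4) ℝ V, FrameEquiv g e e' ∧ e' 0 = e 0 ∧
      ∀ i : Fin 3, e' i.succ = ∑ j, R i j • e j.succ := by
  suffices ∃ e' : Module.Basis (Fin 4) ℝ V, FrameEquiv g e e' ∧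
      ⇑e' = Fin.cons (e 0) fun i : Fin 3 => ∑ j, R i j • e j.succ by
    obtain ⟨e', h, hv⟩ := this
    exact ⟨e', h, by rw [hv]; rfl, fun i => by rw [hv]; rfl⟩
  apply exists_frameEquiv he
  · intro i j
    refine Fin.cases ?_ (fun i => ?_) i <;> refine Fin.cases ?_ (fun j => ?_) j
    · simp [he 0 0]
    · simp [he 0 _, (Fin.succ_ne_zero _).symm]
    · simp [he _ 0, Fin.succ_ne_zero]
    · have := congrFun (congrFun hR i) j
      rw [Matrix.mul_apply] at this
      simp [he _ _, Matrix.one_apply] at this ⊢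
      rw [← this]
      exact Finset.sum_congr rfl fun k _ => by ring
  · have : (Fin.cons (e 0) fun i : Fin 3 => ∑ j, R i j • e j.succ : Fin 4 → V) =
        ![e 0, ∑ j, R 0 j • e j.succ, ∑ j, R 1 j • e j.succ, ∑ j, R 2 j • e j.succ] := by
      ext i; fin_cases i <;> rfl
    have s1 : (Fin.succ (1 : Fin 3)) = 2 := rfl
    have s2 : (Fin.succ (2 : Fin 3)) = 3 := rfl
    rw [this, det_coord, ← hd, Matrix.det_fin_three]
    simp [Fin.sum_univ_three, s1, s2]
  · intro u _
    exact Iff.rfl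

/-- The frame boosted along its third spatial vector. -/
lemma exists_boosted_frame (he : IsOrthonormalFrame g e) {c s : ℝ} (hc : 0 < c)
    (hcs : c ^ 2 - s ^ 2 = 1) :
    ∃ e' : Module.Basis (Fin 4) ℝ V, FrameEquiv g e e' ∧ e' 0 = c • e 0 + s • e 3 ∧
      e' 1 = e 1 ∧ e' 2 = e 2 ∧ e' 3 = s • e 0 + c • e 3 := by
  suffices ∃ e' : Module.Basis (Fin 4) ℝ V, FrameEquiv g e e' ∧
      ⇑e' = ![c • e 0 + s • e 3, e 1, e 2, s • e 0 + c • e 3] by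
    obtain ⟨e', h, hv⟩ := this
    exact ⟨e', h, by rw [hv]; rfl, by rw [hv]; rfl, by rw [hv]; rfl, by rw [hv]; rfl⟩
  apply exists_frameEquiv he
  · intro i j
    fin_cases i <;> fin_cases j <;> simp [he _ _] <;> linarith
  · rw [det_coord]
    simp
    linarith
  · intro u hu
    have h0 := he.metric_frame u 0
    have h3 := he.metric_frame u 3
    rw [he.metric_eq, Fin.sum_univ_four] at hu
    simp only [sgn_zero, sgn_one, sgn_two, sgn_three] at hu h0 h3
    simp only [Matrix.cons_val_zero, map_add, map_smul, smul_eq_mul, h0, h3]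
    generalize e.repr u 0 = A at *
    generalize e.repr u 1 = B1 at *
    generalize e.repr u 2 = B2 at *
    generalize e.repr u 3 = B at *
    have hAB : B ^ 2 < A ^ 2 := by nlinarith [sq_nonneg B1, sq_nonneg B2]
    -- Since u is timelike, cA dominates sB, and -cA + sB has the sign of -A: the boost preserves
    -- the time orientation.
    have key : (s * B) ^ 2 < (c * A) ^ 2 := by
      have : (c * A) ^ 2 - (s * B) ^ 2 = c ^ 2 * (A ^ 2 - B ^ 2) + B ^ 2 := by
        linear_combination B ^ 2 * hcs
      have := mul_pos (pow_pos hc 2) (sub_pos.2 hAB)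
      nlinarith [sq_nonneg B]
    constructor
    · intro hA
      have : 0 ≤ c * A := by nlinarith
      have := abs_lt_of_sq_lt_sq key this
      linarith [(abs_lt.1 this).2]
    · intro hA
      by_contra hn
      have : 0 ≤ -(c * A) := by nlinarith
      have := abs_lt_of_sq_lt_sq (a := s * B) (by rwa [neg_sq]) this
      linarith [(abs_lt.1 this).1]

/-! ### Adapted frames -/

/-- A matrix with rows x, y, 0 is singular, and its kernel is orthogonal to x and y. -/
lemma exists_unit_orthogonal (x y : Fin 3 → ℝ) : ∃ f : Fin 3 → ℝ, f ⬝ᵥ f = 1 ∧ x ⬝ᵥ f = 0 ∧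
    y ⬝ᵥ f = 0 := by
  obtain ⟨v, hv, h⟩ := (Matrix.exists_mulVec_eq_zero_iff (M := Matrix.of ![x, y, 0])).2
    (Matrix.det_eq_zero_of_row_eq_zero 2 fun j => by simp)
  have h1 : x ⬝ᵥ v = 0 := by simpa [Matrix.mulVec] using congrFun h 0
  have h2 : y ⬝ᵥ v = 0 := by simpa [Matrix.mulVec] using congrFun h 1
  have h3 : 0 < v ⬝ᵥ v := lt_of_le_of_ne (by
    simp only [dotProduct]; exact Finset.sum_nonneg fun i _ => mul_self_nonneg _)
    (Ne.symm (by rwa [ne_eq, dotProduct_self_eq_zero]))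
  refine ⟨(√(v ⬝ᵥ v))⁻¹ • v, ?_, by simp [h1], by simp [h2]⟩
  rw [smul_dotProduct, dotProduct_smul, smul_eq_mul, smul_eq_mul, ← mul_assoc, ← mul_inv,
    Real.mul_self_sqrt h3.le, inv_mul_cancel₀ h3.ne']

/-- For a = 0 the direction is arbitrary, but it must still be chosen orthogonal to b. -/
lemma exists_unit_direction (a b : Fin 3 → ℝ) (hab : a ⬝ᵥ b = 0) :
    ∃ f : Fin 3 → ℝ, f ⬝ᵥ f = 1 ∧ a = √(a ⬝ᵥ a) • f ∧ f ⬝ᵥ b = 0 := by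
  by_cases ha : a = 0
  · obtain ⟨f, h1, h2, -⟩ := exists_unit_orthogonal b b
    exact ⟨f, h1, by simp [ha], by rwa [dotProduct_comm]⟩
  · have h3 : 0 < a ⬝ᵥ a := lt_of_le_of_ne (by
      simp only [dotProduct]; exact Finset.sum_nonneg fun i _ => mul_self_nonneg _)
      (Ne.symm (by rwa [ne_eq, dotProduct_self_eq_zero]))
    have h4 : √(a ⬝ᵥ a) ≠ 0 := (Real.sqrt_pos.2 h3).ne'
    refine ⟨(√(a ⬝ᵥ a))⁻¹ • a, ?_, ?_, by simp [hab]⟩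
    · rw [smul_dotProduct, dotProduct_smul, smul_eq_mul, smul_eq_mul, ← mul_assoc, ← mul_inv,
        Real.mul_self_sqrt h3.le, inv_mul_cancel₀ h3.ne']
    · rw [smul_smul, mul_inv_cancel₀ h4, one_smul]

lemma exists_rotation (a b : Fin 3 → ℝ) (hab : a ⬝ᵥ b = 0) :
    ∃ R : Matrix (Fin 3) (Fin 3) ℝ, R * Rᵀ = 1 ∧ R.det = 1 ∧
      R *ᵥ a = ![√(a ⬝ᵥ a), 0, 0] ∧ R *ᵥ b = ![0, √(b ⬝ᵥ b), 0] := by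
  obtain ⟨f, f1, f2, f3⟩ := exists_unit_direction a b hab
  obtain ⟨h, h1, h2, h3⟩ := exists_unit_direction b f (by rwa [dotProduct_comm])
  generalize √(a ⬝ᵥ a) = r at *
  generalize √(b ⬝ᵥ b) = t at *
  simp only [dotProduct, Fin.sum_univ_three] at f1 h1 h3
  -- The third row is the cross product f × h, which gives determinant 1.
  refine ⟨!![f 0, f 1, f 2; h 0, h 1, h 2; f 1 * h 2 - f 2 * h 1, f 2 * h 0 - f 0 * h 2,
    f 0 * h 1 - f 1 * h 0], ?_, ?_, ?_, ?_⟩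
  · ext i j
    fin_cases i <;> fin_cases j <;> simp [Matrix.mul_apply, Fin.sum_univ_three]
    · linear_combination f1
    · linear_combination h3
    · ring
    · linear_combination h3
    · linear_combination h1
    · ring
    · ring
    · ring
    · linear_combination (h 0 * h 0 + h 1 * h 1 + h 2 * h 2) * f1 + h1 -
        (h 0 * f 0 + h 1 * f 1 + h 2 * f 2) * h3
  · rw [Matrix.det_fin_three]
    simp
    linear_combination (h 0 * h 0 + h 1 * h 1 + h 2 * h 2) * f1 + h1 -
        (h 0 * f 0 + h 1 * f 1 + h 2 * f 2) * h3
  · rw [f2]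
    ext i
    fin_cases i <;> simp [Matrix.mulVec, dotProduct, Fin.sum_univ_three]
    · linear_combination r * f1
    · linear_combination r * h3
    · ring
  · rw [h2]
    ext i
    fin_cases i <;> simp [Matrix.mulVec, dotProduct, Fin.sum_univ_three]
    · linear_combination t * h3
    · linear_combination t * h1
    · ring

/-- A cyclic permutation of the axes, which is a rotation, carries the first axis to the third. -/
lemma exists_rotation_axis (a : Fin 3 → ℝ) :
    ∃ R : Matrix (Fin 3) (Fin 3) ℝ, R * Rᵀ = 1 ∧ R.det = 1 ∧
      R *ᵥ a = ![0, 0, √(a ⬝ᵥ a)] := by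
  obtain ⟨R, h1, h2, h3, -⟩ := exists_rotation a 0 (by simp)
  have hP : (!![0, 1, 0; 0, 0, 1; 1, 0, 0] : Matrix (Fin 3) (Fin 3) ℝ) *
      !![0, 1, 0; 0, 0, 1; 1, 0, 0]ᵀ = 1 := by
    ext i j
    fin_cases i <;> fin_cases j <;> simp [Matrix.mul_apply, Fin.sum_univ_three]
  refine ⟨!![0, 1, 0; 0, 0, 1; 1, 0, 0] * R, ?_, ?_, ?_⟩
  · rw [Matrix.transpose_mul, Matrix.mul_assoc, ← Matrix.mul_assoc R, h1, Matrix.one_mul, hP]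
  · rw [Matrix.det_mul, h2, Matrix.det_fin_three]
    simp
  · rw [← Matrix.mulVec_mulVec, h3]
    ext i
    fin_cases i <;> simp [Matrix.mulVec, dotProduct, Fin.sum_univ_three]

/-- The spatial coordinates of a vector. -/
noncomputable def spatial (e : Module.Basis (Fin 4) ℝ V) (x : V) : Fin 3 → ℝ := fun i => e.repr x i.succ

lemma repr_rotated (he : IsOrthonormalFrame g e) (he' : IsOrthonormalFrame g e')
    {R : Matrix (Fin 3) (Fin 3) ℝ} (h0 : e' 0 = e 0)
    (h : ∀ i : Fin 3, e' i.succ = ∑ j, R i j • e j.succ) (x : V) :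
    e'.repr x 0 = e.repr x 0 ∧ spatial e' x = R *ᵥ spatial e x := by
  refine ⟨by rw [he'.repr_eq, he.repr_eq, h0], ?_⟩
  ext i
  simp only [spatial]
  rw [he'.repr_eq, h, Matrix.mulVec, dotProduct]
  simp only [map_sum, map_smul, he.metric_frame, smul_eq_mul, sgn_succ, one_mul]
  rfl

lemma eq_of_spatial (e : Module.Basis (Fin 4) ℝ V) (x : V) {r : ℝ}
    (h : spatial e x = ![0, 0, r]) : x = e.repr x 0 • e 0 + r • e 3 := by
  have h1 : e.repr x 1 = 0 := congrFun h 0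
  have h2 : e.repr x 2 = 0 := congrFun h 1
  have h3 : e.repr x 3 = r := congrFun h 2
  conv_lhs => rw [← e.sum_repr x, Fin.sum_univ_four, h1, h2, h3]
  simp

lemma metric_self_eq (he : IsOrthonormalFrame g e) (x : V) :
    g x x = - e.repr x 0 ^ 2 + spatial e x ⬝ᵥ spatial e x := by
  rw [he.metric_eq, Fin.sum_univ_succ]
  simp only [sgn_zero, sgn_succ, one_mul, spatial, dotProduct]
  ring

/-- Every observer is the timelike vector of an equivalent frame. -/
lemma exists_frame_of_observer (he : IsOrthonormalFrame g e) {u : V} (hu : IsObserver g e u) :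
    ∃ e' : Module.Basis (Fin 4) ℝ V, FrameEquiv g e e' ∧ e' 0 = u := by
  obtain ⟨R, h1, h2, h3⟩ := exists_rotation_axis (spatial e u)
  obtain ⟨e₁, hf, h0, hs⟩ := exists_rotated_frame he R h1 h2
  obtain ⟨hr0, hrs⟩ := repr_rotated he hf.right h0 hs u
  have hu0 : 0 < e.repr u 0 := by
    have := hu.2
    rw [he.metric_frame, sgn_zero] at this
    linarith
  have hn := metric_self_eq he u
  rw [hu.1] at hn
  have hnn : 0 ≤ spatial e u ⬝ᵥ spatial e u := by
    simp only [dotProduct]; exact Finset.sum_nonneg fun i _ => mul_self_nonneg _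
  -- After the rotation, u = c e₀ + s e₃ with s the length of its spatial part; g(u,u) = -1 is the
  -- condition c² - s² = 1.
  obtain ⟨e₂, hf2, h20, -⟩ := exists_boosted_frame hf.right (c := e.repr u 0)
    (s := √(spatial e u ⬝ᵥ spatial e u)) hu0 (by rw [Real.sq_sqrt hnn]; linarith)
  refine ⟨e₂, hf.trans hf2, ?_⟩
  rw [h20, ← hr0]
  exact (eq_of_spatial e₁ u (hrs.trans h3)).symm

/-- A null vector lies in the plane of the first and last vector of an equivalent frame. -/
lemma exists_frame_of_null (he : IsOrthonormalFrame g e) {ℓ : V} (h0 : ℓ ≠ 0) (hn : g ℓ ℓ = 0) :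
    ∃ e' : Module.Basis (Fin 4) ℝ V, FrameEquiv g e e' ∧ e' 0 = e 0 ∧
      ∃ a : ℝ, a ≠ 0 ∧ ℓ = a • (e' 0 + e' 3) := by
  rw [metric_self_eq he] at hn
  set a := e.repr ℓ 0 with ha
  have ha0 : a ≠ 0 := by
    intro h
    rw [h] at hn
    have hs : spatial e ℓ = 0 := dotProduct_self_eq_zero.1 (by linarith)
    apply h0
    apply e.repr.injective
    rw [map_zero]
    ext i
    refine Fin.cases ?_ (fun j => ?_) i
    · exact h
    · exact congrFun hs j
  -- Dividing by a, which may be negative, gives a unit spatial vector. A past-directed ℓ is thereby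
  -- also a multiple of e₀ + e₃.
  obtain ⟨R, h1, h2, h3⟩ := exists_rotation_axis (a⁻¹ • spatial e ℓ)
  have hu : (a⁻¹ • spatial e ℓ) ⬝ᵥ (a⁻¹ • spatial e ℓ) = 1 := by
    rw [smul_dotProduct, dotProduct_smul, smul_eq_mul, smul_eq_mul,
      show spatial e ℓ ⬝ᵥ spatial e ℓ = a ^ 2 by linarith]
    field_simp
  rw [hu, Real.sqrt_one, Matrix.mulVec_smul] at h3
  obtain ⟨e₁, hf, he0, hs⟩ := exists_rotated_frame he R h1 h2
  obtain ⟨hr0, hrs⟩ := repr_rotated he hf.right he0 hs ℓ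
  refine ⟨e₁, hf, he0, a, ha0, ?_⟩
  have h4 : spatial e₁ ℓ = ![0, 0, a] := by
    rw [hrs]
    have : R *ᵥ spatial e ℓ = a • (a⁻¹ • R *ᵥ spatial e ℓ) := by
      rw [smul_smul, mul_inv_cancel₀ ha0, one_smul]
    rw [this, h3]
    simp
  conv_lhs => rw [eq_of_spatial e₁ ℓ h4, hr0]
  rw [smul_add]

lemma exists_frame_of_observer_of_null (he : IsOrthonormalFrame g e) {u ℓ : V}
    (hu : IsObserver g e u) (h0 : ℓ ≠ 0) (hn : g ℓ ℓ = 0) :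
    ∃ e' : Module.Basis (Fin 4) ℝ V, FrameEquiv g e e' ∧ e' 0 = u ∧
      ∃ a : ℝ, a ≠ 0 ∧ ℓ = a • (e' 0 + e' 3) := by
  obtain ⟨e₁, h1, hu1⟩ := exists_frame_of_observer he hu
  obtain ⟨e₂, h2, hu2, ha⟩ := exists_frame_of_null h1.right h0 hn
  exact ⟨e₂, h1.trans h2, hu2.trans hu1, ha⟩

/-! ### The complex matrix in a rotated and in a boosted frame -/

lemma frameRotation_rotated {R : Matrix (Fin 3) (Fin 3) ℝ} (h0 : e' 0 = e 0)
    (h : ∀ i : Fin 3, e' i.succ = ∑ j, R i j • e j.succ) :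
    frameRotation e e' = R.map (fun x : ℝ => (x : ℂ)) := by
  have s1 : (Fin.succ (1 : Fin 3)) = 2 := rfl
  have s2 : (Fin.succ (2 : Fin 3)) = 3 := rfl
  ext i k
  simp only [frameRotation, Matrix.of_apply, h, h0, Matrix.map_apply]
  fin_cases k <;> simp [selfDual, Fin.sum_univ_three, s1, s2]

/-- On self-dual bivectors a boost along `e 3` is a rotation about the third axis by an imaginary
angle. -/
lemma frameRotation_boosted {c s : ℝ} (hcs : c ^ 2 - s ^ 2 = 1)
    (h0 : e' 0 = c • e 0 + s • e 3) (h1 : e' 1 = e 1) (h2 : e' 2 = e 2)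
    (h3 : e' 3 = s • e 0 + c • e 3) :
    frameRotation e e' = !![(c : ℂ), - (Complex.I * s), 0; Complex.I * s, c, 0; 0, 0, 1] := by
  have s1 : (Fin.succ (1 : Fin 3)) = 2 := rfl
  have s2 : (Fin.succ (2 : Fin 3)) = 3 := rfl
  have hcs' : (c : ℂ) ^ 2 - (s : ℂ) ^ 2 = 1 := by exact_mod_cast hcs
  ext i k
  fin_cases i <;> fin_cases k <;> simp [frameRotation, selfDual, s1, s2, h0, h1, h2, h3]
  linear_combination hcs'

/-! ### Unitary triangularization -/

lemma star_dotProduct_self (v : Fin 3 → ℂ) :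
    star v ⬝ᵥ v = ((∑ i, ‖v i‖ ^ 2 : ℝ) : ℂ) := by
  push_cast
  exact Finset.sum_congr rfl fun i _ => Complex.conj_mul' _

lemma exists_smul_unit {v : Fin 3 → ℂ} (hv : v ≠ 0) :
    ∃ c : ℂ, star (c • v) ⬝ᵥ (c • v) = 1 := by
  have h : 0 < ∑ i, ‖v i‖ ^ 2 := by
    obtain ⟨i, hi⟩ := Function.ne_iff.1 hv
    exact Finset.sum_pos' (fun _ _ => by positivity) ⟨i, Finset.mem_univ _, by
      have : 0 < ‖v i‖ := norm_pos_iff.2 hi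
      positivity⟩
  refine ⟨((√(∑ i, ‖v i‖ ^ 2))⁻¹ : ℝ), ?_⟩
  rw [star_smul, smul_dotProduct, dotProduct_smul, star_dotProduct_self, smul_eq_mul,
    smul_eq_mul, Complex.star_def, Complex.conj_ofReal, ← Complex.ofReal_mul,
    ← Complex.ofReal_mul, ← mul_assoc, ← mul_inv, Real.mul_self_sqrt h.le,
    inv_mul_cancel₀ h.ne', Complex.ofReal_one]

lemma exists_orthogonal_ne_zero (x y : Fin 3 → ℂ) : ∃ f : Fin 3 → ℂ, f ≠ 0 ∧ x ⬝ᵥ f = 0 ∧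
    y ⬝ᵥ f = 0 := by
  obtain ⟨v, hv, h⟩ := (Matrix.exists_mulVec_eq_zero_iff (M := Matrix.of ![x, y, 0])).2
    (Matrix.det_eq_zero_of_row_eq_zero 2 fun j => by simp)
  exact ⟨v, hv, by simpa [Matrix.mulVec] using congrFun h 0,
    by simpa [Matrix.mulVec] using congrFun h 1⟩

lemma exists_eigenvector (A : Matrix (Fin 3) (Fin 3) ℂ) :
    ∃ (a : ℂ) (v : Fin 3 → ℂ), v ≠ 0 ∧ A *ᵥ v = a • v := by
  obtain ⟨a, ha⟩ := Module.End.exists_eigenvalue (Matrix.toLin' A)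
  obtain ⟨v, hv⟩ := ha.exists_hasEigenvector
  exact ⟨a, v, hv.2, by simpa using hv.apply_eq_smul⟩

/-- The adjoint leaves the orthogonal complement of an eigenvector of A invariant, so it has an
eigenvector there. That vector closes the basis in `exists_unitary_triangular`. -/
lemma exists_adjoint_eigenvector (A : Matrix (Fin 3) (Fin 3) ℂ) {a : ℂ} {v : Fin 3 → ℂ}
    (h : A *ᵥ v = a • v) :
    ∃ (b : ℂ) (w : Fin 3 → ℂ), w ≠ 0 ∧ Aᴴ *ᵥ w = b • w ∧ star v ⬝ᵥ w = 0 := by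
  let L : (Fin 3 → ℂ) →ₗ[ℂ] ℂ := ⟨⟨fun w => star v ⬝ᵥ w, fun x y => dotProduct_add _ _ _⟩,
    fun c x => by simp⟩
  have hL : ∀ w, w ∈ LinearMap.ker L ↔ star v ⬝ᵥ w = 0 := fun w => LinearMap.mem_ker
  have hinv : ∀ w ∈ LinearMap.ker L, Matrix.toLin' Aᴴ w ∈ LinearMap.ker L := by
    intro w hw
    rw [hL] at hw ⊢
    rw [Matrix.toLin'_apply, Matrix.dotProduct_mulVec, ← Matrix.star_mulVec, h, star_smul,
      smul_dotProduct, hw, smul_zero]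
  have : Nontrivial (LinearMap.ker L) := by
    obtain ⟨f, hf, hf1, -⟩ := exists_orthogonal_ne_zero (star v) 0
    exact ⟨⟨⟨f, (hL f).2 hf1⟩, 0, fun hh => hf (congrArg Subtype.val hh)⟩⟩
  obtain ⟨b, hb⟩ := Module.End.exists_eigenvalue ((Matrix.toLin' Aᴴ).restrict hinv)
  obtain ⟨w, hw⟩ := hb.exists_hasEigenvector
  refine ⟨b, w, fun hh => hw.2 (Subtype.ext hh), ?_, (hL _).1 w.2⟩
  simpa using congrArg Subtype.val hw.apply_eq_smul

/-- The basis is v, u, w with v an eigenvector of A, w ⊥ v an eigenvector of Aᴴ, and u orthogonal to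
both. The first column is triangular because of v, the last row because of w. -/
lemma exists_unitary_triangular (A : Matrix (Fin 3) (Fin 3) ℂ) :
    ∃ U : Matrix (Fin 3) (Fin 3) ℂ, U * Uᴴ = 1 ∧ (U * A * Uᴴ) 1 0 = 0 ∧
      (U * A * Uᴴ) 2 0 = 0 ∧ (U * A * Uᴴ) 2 1 = 0 := by
  obtain ⟨a, v₀, hv₀, hA₀⟩ := exists_eigenvector A
  obtain ⟨c, hc⟩ := exists_smul_unit hv₀
  set v := c • v₀
  have hA : A *ᵥ v = a • v := by rw [Matrix.mulVec_smul, hA₀, smul_comm]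
  obtain ⟨b, w₀, hw₀, hB₀, ho₀⟩ := exists_adjoint_eigenvector A hA
  obtain ⟨d, hd⟩ := exists_smul_unit hw₀
  set w := d • w₀
  have hB : Aᴴ *ᵥ w = b • w := by rw [Matrix.mulVec_smul, hB₀, smul_comm]
  have hvw : star v ⬝ᵥ w = 0 := by rw [dotProduct_smul, ho₀, smul_zero]
  obtain ⟨u₀, hu₀, h1, h2⟩ := exists_orthogonal_ne_zero (star v) (star w)
  obtain ⟨f, hf⟩ := exists_smul_unit hu₀
  set u := f • u₀
  have hvu : star v ⬝ᵥ u = 0 := by rw [dotProduct_smul, h1, smul_zero]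
  have hwu : star w ⬝ᵥ u = 0 := by rw [dotProduct_smul, h2, smul_zero]
  have hs : ∀ x y : Fin 3 → ℂ, star x ⬝ᵥ y = 0 → star y ⬝ᵥ x = 0 := fun x y hxy => by
    have := congrArg star hxy
    rwa [← Matrix.star_dotProduct_star, star_star, star_zero] at this
  have key : ∀ i j, (Matrix.of ![star v, star u, star w] * A *
      (Matrix.of ![star v, star u, star w])ᴴ) i j =
      ![star v, star u, star w] i ⬝ᵥ (A *ᵥ ![v, u, w] j) := by
    intro i j
    have : (Matrix.of ![star v, star u, star w])ᴴ = (Matrix.of ![v, u, w])ᵀ := by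
      ext k l; fin_cases l <;> simp
    rw [this, Matrix.mul_assoc, Matrix.mul_apply]
    rfl
  refine ⟨Matrix.of ![star v, star u, star w], ?_, ?_, ?_, ?_⟩
  · have : (Matrix.of ![star v, star u, star w])ᴴ = (Matrix.of ![v, u, w])ᵀ := by
      ext k l; fin_cases l <;> simp
    rw [this]
    ext i j
    have : (Matrix.of ![star v, star u, star w] * (Matrix.of ![v, u, w])ᵀ) i j =
      ![star v, star u, star w] i ⬝ᵥ ![v, u, w] j := rfl
    rw [this]
    fin_cases i <;> fin_cases j
    · simpa using hc
    · simpa using hvu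
    · simpa using hvw
    · simpa using hs _ _ hvu
    · simpa using hf
    · simpa using hs _ _ hwu
    · simpa using hs _ _ hvw
    · simpa using hwu
    · simpa using hd
  · rw [key]
    simp only [Matrix.cons_val_zero, Matrix.cons_val_one]
    rw [hA, dotProduct_smul, hs _ _ hvu, smul_zero]
  · rw [key]
    simp only [Matrix.cons_val_zero, Matrix.cons_val]
    rw [hA, dotProduct_smul, hs _ _ hvw, smul_zero]
  · rw [key]
    simp only [Matrix.cons_val_one, Matrix.cons_val]
    rw [Matrix.dotProduct_mulVec, ← Matrix.conjTranspose_conjTranspose A, ← Matrix.star_mulVec,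
      hB, star_smul, smul_dotProduct, hwu, smul_zero]

lemma frob_eq_trace (A : Matrix (Fin 3) (Fin 3) ℂ) : ((frob A : ℝ) : ℂ) = (A * Aᴴ).trace := by
  rw [frob_eq, Matrix.trace]
  exact Finset.sum_congr rfl fun i _ => by rw [Matrix.diag_apply, Matrix.mul_apply]; rfl

lemma frob_unitary_conj {U : Matrix (Fin 3) (Fin 3) ℂ} (hU : U * Uᴴ = 1)
    (A : Matrix (Fin 3) (Fin 3) ℂ) : frob (U * A * Uᴴ) = frob A := by
  apply Complex.ofReal_injective
  have hU' : Uᴴ * U = 1 := mul_eq_one_comm.mp hU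
  rw [frob_eq_trace, frob_eq_trace, Matrix.conjTranspose_mul, Matrix.conjTranspose_mul,
    Matrix.conjTranspose_conjTranspose]
  calc (U * A * Uᴴ * (U * (Aᴴ * Uᴴ))).trace = (U * (A * (Uᴴ * U) * Aᴴ * Uᴴ)).trace := by
        simp only [Matrix.mul_assoc]
    _ = (A * Aᴴ * (Uᴴ * U)).trace := by
        rw [hU', Matrix.mul_one, Matrix.trace_mul_comm, Matrix.mul_assoc, hU']
    _ = _ := by rw [hU', Matrix.mul_one]

lemma charpoly_of_triangular {B : Matrix (Fin 3) (Fin 3) ℂ} (h1 : B 1 0 = 0) (h2 : B 2 0 = 0)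
    (h3 : B 2 1 = 0) : B.charpoly.roots = {B 0 0, B 1 1, B 2 2} := by
  have : B.charpoly = (Polynomial.X - Polynomial.C (B 0 0)) *
      ((Polynomial.X - Polynomial.C (B 1 1)) * (Polynomial.X - Polynomial.C (B 2 2))) := by
    rw [Matrix.charpoly, Matrix.det_fin_three]
    simp [h1, h2, h3]
    ring
  have n := fun a : ℂ => Polynomial.X_sub_C_ne_zero a
  rw [this, Polynomial.roots_mul (mul_ne_zero (n _) (mul_ne_zero (n _) (n _))),
    Polynomial.roots_mul (mul_ne_zero (n _) (n _))]
  simp only [Polynomial.roots_X_sub_C]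
  rfl

/-- The unit given by a unitary matrix. -/
def unitaryUnit (U : Matrix (Fin 3) (Fin 3) ℂ) (h : U * Uᴴ = 1) :
    (Matrix (Fin 3) (Fin 3) ℂ)ˣ :=
  ⟨U, Uᴴ, h, mul_eq_one_comm.mp h⟩

/-- Schur's inequalities for a matrix and its square, and the normal case of equality. -/
theorem schur (A : Matrix (Fin 3) (Fin 3) ℂ) : ∃ a b c : ℂ, A.charpoly.roots = {a, b, c} ∧
    A.trace = a + b + c ∧ (A * A).trace = a ^ 2 + b ^ 2 + c ^ 2 ∧
    ‖a‖ ^ 2 + ‖b‖ ^ 2 + ‖c‖ ^ 2 ≤ frob A ∧ ‖a‖ ^ 4 + ‖b‖ ^ 4 + ‖c‖ ^ 4 ≤ frob (A * A) ∧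
    (A * Aᴴ = Aᴴ * A → frob A = ‖a‖ ^ 2 + ‖b‖ ^ 2 + ‖c‖ ^ 2 ∧
      ∃ u : (Matrix (Fin 3) (Fin 3) ℂ)ˣ, u.val * A * u⁻¹.val = Matrix.diagonal ![a, b, c]) := by
  obtain ⟨U, hU, h1, h2, h3⟩ := exists_unitary_triangular A
  have hU' : Uᴴ * U = 1 := mul_eq_one_comm.mp hU
  set B := U * A * Uᴴ with hB
  have hBB : B * B = U * (A * A) * Uᴴ := by
    calc B * B = U * A * (Uᴴ * U) * A * Uᴴ := by simp only [hB, Matrix.mul_assoc]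
      _ = _ := by rw [hU']; simp only [Matrix.mul_assoc, Matrix.one_mul]
  have htr : ∀ X : Matrix (Fin 3) (Fin 3) ℂ, (U * X * Uᴴ).trace = X.trace := fun X => by
    rw [Matrix.trace_mul_comm, ← Matrix.mul_assoc, hU', Matrix.one_mul]
  have hf := frob_unitary_conj hU A
  have hf2 := frob_unitary_conj hU (A * A)
  have ht := htr A
  have ht2 := htr (A * A)
  rw [← hBB] at hf2 ht2
  rw [← hB] at hf ht
  refine ⟨B 0 0, B 1 1, B 2 2, ?_, ?_, ?_, ?_, ?_, ?_⟩
  · have hi : U⁻¹ = Uᴴ := Matrix.inv_eq_right_inv hU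
    have := Matrix.charpoly_units_conj (unitaryUnit U hU) A
    rw [show (unitaryUnit U hU).val = U from rfl, hi] at this
    rw [← this, ← hB, charpoly_of_triangular h1 h2 h3]
  · rw [← ht, Matrix.trace, Fin.sum_univ_three]; rfl
  · rw [← ht2, Matrix.trace]
    simp only [Matrix.diag_apply, Matrix.mul_apply, Fin.sum_univ_three, h1, h2, h3]
    ring
  -- The Frobenius norm is unitarily invariant; dropping the off-diagonal entries of the triangular
  -- matrix B gives the bound. The same works for B², whose diagonal consists of squares.
  · rw [← hf, frob]
    simp only [Fin.sum_univ_three]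
    nlinarith [sq_nonneg ‖B 0 1‖, sq_nonneg ‖B 0 2‖, sq_nonneg ‖B 1 2‖, sq_nonneg ‖B 1 0‖,
      sq_nonneg ‖B 2 0‖, sq_nonneg ‖B 2 1‖]
  · rw [← hf2, frob]
    have e0 : (B * B) 0 0 = B 0 0 ^ 2 := by
      simp only [Matrix.mul_apply, Fin.sum_univ_three, h1, h2]; ring
    have e1 : (B * B) 1 1 = B 1 1 ^ 2 := by
      simp only [Matrix.mul_apply, Fin.sum_univ_three, h1, h3]; ring
    have e2 : (B * B) 2 2 = B 2 2 ^ 2 := by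
      simp only [Matrix.mul_apply, Fin.sum_univ_three, h2, h3]; ring
    simp only [Fin.sum_univ_three, e0, e1, e2, norm_pow, ← pow_mul, show 2 * 2 = 4 from rfl]
    nlinarith [sq_nonneg ‖(B * B) 0 1‖, sq_nonneg ‖(B * B) 0 2‖, sq_nonneg ‖(B * B) 1 2‖,
      sq_nonneg ‖(B * B) 1 0‖, sq_nonneg ‖(B * B) 2 0‖, sq_nonneg ‖(B * B) 2 1‖]
  · intro hn
    have hBn : B * Bᴴ = Bᴴ * B := by
      have e1 : Bᴴ = U * Aᴴ * Uᴴ := by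
        rw [hB, Matrix.conjTranspose_mul, Matrix.conjTranspose_mul,
          Matrix.conjTranspose_conjTranspose, Matrix.mul_assoc]
      calc B * Bᴴ = U * A * (Uᴴ * U) * Aᴴ * Uᴴ := by
            rw [e1]; simp only [hB, Matrix.mul_assoc]
        _ = U * (A * Aᴴ) * Uᴴ := by rw [hU']; simp only [Matrix.mul_assoc, Matrix.one_mul]
        _ = U * Aᴴ * (Uᴴ * U) * A * Uᴴ := by
            rw [hn, hU']; simp only [Matrix.mul_assoc, Matrix.one_mul]
        _ = Bᴴ * B := by rw [e1]; simp only [hB, Matrix.mul_assoc]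
    -- A normal triangular matrix is diagonal: entry (0,0) of BBᴴ = BᴴB kills the rest of the first
    -- row, and entry (1,1) then kills B 1 2.
    have d0 := congrFun (congrFun hBn 0) 0
    have d1 := congrFun (congrFun hBn 1) 1
    simp only [Matrix.mul_apply, Fin.sum_univ_three, Matrix.conjTranspose_apply, h1, h2, h3,
      Complex.star_def, Complex.mul_conj', Complex.conj_mul'] at d0 d1
    have d0' : ‖B 0 0‖ ^ 2 + ‖B 0 1‖ ^ 2 + ‖B 0 2‖ ^ 2 = ‖B 0 0‖ ^ 2 := by
      have : ((‖B 0 0‖ ^ 2 + ‖B 0 1‖ ^ 2 + ‖B 0 2‖ ^ 2 : ℝ) : ℂ) = ((‖B 0 0‖ ^ 2 : ℝ) : ℂ) := by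
        push_cast; rw [d0]; simp
      exact_mod_cast this
    have d1' : ‖B 1 1‖ ^ 2 + ‖B 1 2‖ ^ 2 = ‖B 0 1‖ ^ 2 + ‖B 1 1‖ ^ 2 := by
      have : ((‖B 1 1‖ ^ 2 + ‖B 1 2‖ ^ 2 : ℝ) : ℂ) = ((‖B 0 1‖ ^ 2 + ‖B 1 1‖ ^ 2 : ℝ) : ℂ) := by
        push_cast; simpa using d1
      exact_mod_cast this
    have b01 : B 0 1 = 0 := by
      rw [← norm_eq_zero, ← sq_eq_zero_iff]
      nlinarith [sq_nonneg ‖B 0 1‖, sq_nonneg ‖B 0 2‖]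
    have b02 : B 0 2 = 0 := by
      rw [← norm_eq_zero, ← sq_eq_zero_iff]
      nlinarith [sq_nonneg ‖B 0 1‖, sq_nonneg ‖B 0 2‖]
    have b12 : B 1 2 = 0 := by
      rw [← norm_eq_zero, ← sq_eq_zero_iff]
      rw [b01] at d1'
      simp at d1'
      simp [d1']
    refine ⟨?_, unitaryUnit U hU, ?_⟩
    · rw [← hf, frob]
      simp [Fin.sum_univ_three, h1, h2, h3, b01, b02, b12]
    · change B = _
      ext i j
      fin_cases i <;> fin_cases j <;> simp [h1, h2, h3, b01, b02, b12]

/-! ### Rest observers and bounds of the super-energy scalars -/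

lemma map_conj_eq {M : Matrix (Fin 3) (Fin 3) ℂ} (hM : M.IsSymm) :
    M.map (starRingEnd ℂ) = Mᴴ := by
  ext i j
  rw [Matrix.map_apply, Matrix.conjTranspose_apply, ← hM.apply i j]
  rfl

lemma qPerp_frame_zero (he : IsOrthonormalFrame g e) : qPerp g e W (e 0) (e 0) = 0 := by
  rw [qPerp, proj_frame_zero he, (belRobinson_zero e W).2.2.2, neg_zero]

lemma qPerp_eq_zero_iff (u : V) :
    (∀ x, qPerp g e W u x = 0) ↔ ∀ i, qPerp g e W u (e i) = 0 := by
  refine ⟨fun h i => h _, fun h x => ?_⟩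
  have hl : IsLinearMap ℝ fun x => qPerp g e W u x := by
    have := (proj_isLinearMap g u (belRobinson_isLinearMap_four e W u u u)).const_mul' (-1)
    simpa [qPerp] using this
  have : qPerp g e W u x = (IsLinearMap.mk' _ hl) x := rfl
  rw [this, ← e.sum_repr x, map_sum]
  refine Finset.sum_eq_zero fun i _ => ?_
  rw [map_smul, IsLinearMap.mk'_apply, h, smul_zero]

/-- The super-Poynting vector vanishes if and only if the complex matrix is normal. -/
lemma qPerp_frame_eq_zero_iff (he : IsOrthonormalFrame g e) (hW : IsWeylTensor e W) :
    (∀ x, qPerp g e W (e 0) x = 0) ↔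
      weylMatrix e W * (weylMatrix e W)ᴴ = (weylMatrix e W)ᴴ * weylMatrix e W := by
  have hM := weylMatrix_isSymm hW
  rw [qPerp_eq_zero_iff, ← map_conj_eq hM]
  set M := weylMatrix e W
  set N := M.map (starRingEnd ℂ) with hN
  have hNs : N.IsSymm := conj_isSymm hM
  have hq : ∀ i : Fin 3, ((qPerp g e W (e 0) (e i.succ) : ℝ) : ℂ) =
      - (1 / 4) * (M * N * (frameMatrix 0 i.succ)ᵀ).trace := fun i => by
    rw [qPerp, proj_frame_succ he]
    push_cast
    rw [belRobinson_frame hW, frameMatrix_zero_zero, mul_one]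
    ring
  -- The components of q are those of the antisymmetric part of MN. As (MN)ᵀ = NM, they vanish
  -- exactly when M commutes with N = Mᴴ.
  have hT : (M * N)ᵀ = N * M := by rw [Matrix.transpose_mul, hM, hNs]
  have s1 : (Fin.succ (1 : Fin 3)) = 2 := rfl
  have s2 : (Fin.succ (2 : Fin 3)) = 3 := rfl
  have t0 : (M * N * (frameMatrix 0 1)ᵀ).trace =
      Complex.I * ((M * N) 1 2 - (M * N) 2 1) := by
    generalize M * N = P
    simp [frameMatrix, hermCoord, Matrix.trace, Matrix.mul_apply, Fin.sum_univ_three]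
    ring
  have t1 : (M * N * (frameMatrix 0 2)ᵀ).trace =
      Complex.I * ((M * N) 2 0 - (M * N) 0 2) := by
    generalize M * N = P
    simp [frameMatrix, hermCoord, Matrix.trace, Matrix.mul_apply, Fin.sum_univ_three]
    ring
  have t2 : (M * N * (frameMatrix 0 3)ᵀ).trace =
      Complex.I * ((M * N) 0 1 - (M * N) 1 0) := by
    generalize M * N = P
    simp [frameMatrix, hermCoord, Matrix.trace, Matrix.mul_apply, Fin.sum_univ_three]
    ring
  have q0 := hq 0
  have q1 := hq 1
  have q2 := hq 2
  rw [Fin.succ_zero_eq_one, t0] at q0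
  rw [s1, t1] at q1
  rw [s2, t2] at q2
  constructor
  · intro h
    rw [h 1] at q0
    rw [h 2] at q1
    rw [h 3] at q2
    simp [sub_eq_zero] at q0 q1 q2
    rw [← hT]
    ext i j
    fin_cases i <;> fin_cases j <;> simp [q0, q1, q2]
  · intro h
    rw [← hT] at h
    have h12 : (M * N) 1 2 = (M * N) 2 1 := congrFun (congrFun h 1) 2
    have h20 : (M * N) 2 0 = (M * N) 0 2 := congrFun (congrFun h 2) 0
    have h01 : (M * N) 0 1 = (M * N) 1 0 := congrFun (congrFun h 0) 1
    rw [h12] at q0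
    rw [h20] at q1
    rw [h01] at q2
    simp at q0 q1 q2
    intro i
    fin_cases i
    · exact qPerp_frame_zero he
    · exact q0
    · exact q1
    · exact q2

/-- The difference is a sum of squares, those of the components of q. This is what allows the square
root in `absq_frame` to be squared away. -/
lemma momentumSq_le (hW : IsWeylTensor e W) :
    0 ≤ tau e W (e 0) ^ 2 - momentumSq (weylMatrix e W) / 16 := by
  have hM := weylMatrix_isSymm hW
  have ht := weylMatrix_trace hW
  have h := quartic_two hM ht (conj_isSymm hM) (conj_trace_zero ht)
  rw [← momentumSq_eq, trace_mul_conj hM] at h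
  have h2 : ((∑ i : Fin 3, (4 * belRobinson e W (e 0) (e 0) (e 0) (e i.succ)) ^ 2 : ℝ) : ℂ) =
      ((frob (weylMatrix e W) ^ 2 - momentumSq (weylMatrix e W) : ℝ) : ℂ) := by
    push_cast
    rw [← h]
    refine Finset.sum_congr rfl fun i _ => ?_
    rw [belRobinson_frame hW]
    ring
  have h3 := Complex.ofReal_injective h2
  have h4 : 0 ≤ ∑ i : Fin 3, (4 * belRobinson e W (e 0) (e 0) (e 0) (e i.succ)) ^ 2 := by
    positivity
  rw [tau_frame hW]
  linarith

/-- A polynomial identity in a, b and their conjugates. It turns the Schur bound for M² into the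
sharp inequality τ² - |q|² ≥ ξ². -/
lemma norm_sq_identity {a b c : ℂ} (h : a + b + c = 0) :
    (‖a‖ ^ 2 + ‖b‖ ^ 2 + ‖c‖ ^ 2) ^ 2 = 3 * (‖a‖ ^ 4 + ‖b‖ ^ 4 + ‖c‖ ^ 4)
      - (1 / 2) * ‖a ^ 2 + b ^ 2 + c ^ 2‖ ^ 2 := by
  have hc : c = - a - b := by linear_combination h
  subst hc
  apply Complex.ofReal_injective
  push_cast
  have h4 : ∀ z : ℂ, ((‖z‖ : ℝ) : ℂ) ^ 4 = (z * (starRingEnd ℂ) z) ^ 2 := fun z => by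
    rw [Complex.mul_conj']; ring
  simp only [h4, ← Complex.mul_conj']
  simp only [map_add, map_sub, map_neg, map_pow]
  ring

/-- The relations between the super-energy scalars of an observer and the proper scalars. -/
structure ScalarRelations (g : LinearMap.BilinForm ℝ V) (e : Module.Basis (Fin 4) ℝ V)
    (W : Tensor4 V) (u : V) : Prop where
  tau_ge : xi e W ≤ tau e W u
  momentum_ge : xi e W ^ 2 ≤ tau e W u ^ 2 - absq g e W u ^ 2
  abst_eq : abst g e W u = √((1 / 3) * tau e W u ^ 2 + (1 / 6) * alpha e W ^ 2
    + (2 / 3) * absq g e W u ^ 2)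
  absQ_eq : absQ g e W u = √(tau e W u ^ 2 + (tau e W u ^ 2 - absq g e W u ^ 2)
    - (1 / 2) * alpha e W ^ 2)
  absT_eq : absT g e W u = √(tau e W u ^ 2 + 4 * (tau e W u ^ 2 - absq g e W u ^ 2)
    + alpha e W ^ 2)
  rest : (∀ x, qPerp g e W u x = 0) → tau e W u = xi e W

lemma xi_of_roots {a b c : ℂ} (h : (weylMatrix e W).charpoly.roots = {a, b, c}) :
    xi e W = (‖a‖ ^ 2 + ‖b‖ ^ 2 + ‖c‖ ^ 2) / 4 := by
  rw [xi, h]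
  simp
  ring

lemma xi_nonneg (e : Module.Basis (Fin 4) ℝ V) (W : Tensor4 V) : 0 ≤ xi e W := by
  obtain ⟨a, b, c, h, -⟩ := schur (weylMatrix e W)
  rw [xi_of_roots h]
  positivity

lemma alpha_nonneg (e : Module.Basis (Fin 4) ℝ V) (W : Tensor4 V) : 0 ≤ alpha e W := by
  unfold alpha; positivity

/-- The triangle inequality for tr M² = Σ ρ². It makes the radicand 2ξ² - ½α² nonnegative. -/
lemma alpha_le (hW : IsWeylTensor e W) : alpha e W ≤ 2 * xi e W := by
  obtain ⟨a, b, c, h, -, h2, -⟩ := schur (weylMatrix e W)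
  rw [xi_of_roots h, alpha_frame hW, h2]
  have := norm_add₃_le (a := a ^ 2) (b := b ^ 2) (c := c ^ 2)
  simp only [norm_pow] at this
  linarith

lemma scalarRelations_frame (he : IsOrthonormalFrame g e) (hW : IsWeylTensor e W) :
    ScalarRelations g e W (e 0) := by
  obtain ⟨a, b, c, h, h1, h2, h3, h4, h5⟩ := schur (weylMatrix e W)
  have hx := xi_of_roots h
  have ht := tau_frame hW
  have hq : absq g e W (e 0) ^ 2 = tau e W (e 0) ^ 2 - momentumSq (weylMatrix e W) / 16 := by
    rw [absq_frame he hW, Real.sq_sqrt (momentumSq_le hW)]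
  have hp : tau e W (e 0) ^ 2 - absq g e W (e 0) ^ 2 = momentumSq (weylMatrix e W) / 16 := by
    rw [hq]; ring
  refine ⟨?_, ?_, ?_, ?_, ?_, ?_⟩
  · rw [hx, ht]; linarith
  · rw [hp, hx, momentumSq, h2]
    rw [weylMatrix_trace hW] at h1
    have := norm_sq_identity h1.symm
    linarith
  · rw [abst_frame he hW, hq]
  · rw [absQ_frame he hW, hp]
  · rw [absT_frame he hW, hp]
  · intro h0
    rw [ht, hx, (h5 ((qPerp_frame_eq_zero_iff he hW).1 h0)).1]

/-- The relations hold for all observers. -/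
lemma scalarRelations (he : IsOrthonormalFrame g e) (hW : IsWeylTensor e W) {u : V}
    (hu : IsObserver g e u) : ScalarRelations g e W u := by
  obtain ⟨e', h, rfl⟩ := exists_frame_of_observer he hu
  have hr := scalarRelations_frame h.right (h.isWeylTensor hW)
  obtain ⟨h1, h2, h3, h4, h5, h6⟩ := hr
  rw [h.tau_eq, h.xi_eq hW] at h1
  rw [h.tau_eq, h.xi_eq hW, h.absq_eq] at h2
  rw [h.tau_eq, h.abst_eq, h.absq_eq, h.alpha_eq] at h3
  rw [h.tau_eq, h.absQ_eq, h.absq_eq, h.alpha_eq] at h4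
  rw [h.tau_eq, h.absT_eq, h.absq_eq, h.alpha_eq] at h5
  rw [h.tau_eq, h.xi_eq hW, h.qPerp_eq] at h6
  exact ⟨h1, h2, h3, h4, h5, h6⟩

/-! ### Fundamental directions -/

/-- The symmetric traceless matrices with the null eigenvector `(1, -i, 0)`. -/
noncomputable def nullMatrix (a p r : ℂ) : Matrix (Fin 3) (Fin 3) ℂ :=
  !![a + p, - (Complex.I * p), r; - (Complex.I * p), a - p, - (Complex.I * r);
    r, - (Complex.I * r), - (2 * a)]

/-- The two equations say that (1, -i, 0) is an eigenvector; its eigenvalue is the parameter a. -/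
lemma eq_nullMatrix {M : Matrix (Fin 3) (Fin 3) ℂ} (hs : M.IsSymm) (ht : M.trace = 0)
    (h1 : M 0 0 - 2 * Complex.I * M 0 1 - M 1 1 = 0) (h2 : M 0 2 - Complex.I * M 1 2 = 0) :
    ∃ a p r, M = nullMatrix a p r := by
  have hI := Complex.I_mul_I
  refine ⟨M 0 0 - Complex.I * M 0 1, Complex.I * M 0 1, M 0 2, ?_⟩
  rw [Matrix.trace, Fin.sum_univ_three] at ht
  simp only [Matrix.diag_apply] at ht
  have s1 := hs.apply 0 1
  have s2 := hs.apply 0 2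
  have s3 := hs.apply 1 2
  ext i j
  fin_cases i <;> fin_cases j <;> simp [nullMatrix, s1, s2, s3]
  · linear_combination M 0 1 * hI
  · linear_combination M 0 1 * hI
  · linear_combination - h1
  · linear_combination Complex.I * h2 + M 1 2 * hI
  · linear_combination Complex.I * h2 + M 1 2 * hI
  · linear_combination ht + h1

lemma selfDual_null (e : Module.Basis (Fin 4) ℝ V) (k : ℝ) (y : V) :
    selfDual e (k • (e 0 + e 3)) y =
      ![- (k * (e.repr y 1 + Complex.I * e.repr y 2)),
        Complex.I * (k * (e.repr y 1 + Complex.I * e.repr y 2)),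
        k * (e.repr y 0 - e.repr y 3)] := by
  have hI := Complex.I_mul_I
  ext i
  fin_cases i <;> simp [selfDual]
  · ring
  · linear_combination - (k : ℂ) * e.repr y 2 * hI
  · ring

lemma selfDual_null_form (e : Module.Basis (Fin 4) ℝ V) (M : Matrix (Fin 3) (Fin 3) ℂ)
    (hs : M.IsSymm) (k : ℝ) (x y : V) :
    ∑ i, ∑ j, selfDual e (k • (e 0 + e 3)) x i * M i j * selfDual e (k • (e 0 + e 3)) y j =
      (k : ℂ) ^ 2 * ((e.repr x 1 + Complex.I * e.repr x 2) * (e.repr y 1 + Complex.I * e.repr y 2) *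
        (M 0 0 - 2 * Complex.I * M 0 1 - M 1 1)
      - ((e.repr x 0 - e.repr x 3) * (e.repr y 1 + Complex.I * e.repr y 2) +
        (e.repr y 0 - e.repr y 3) * (e.repr x 1 + Complex.I * e.repr x 2)) *
        (M 0 2 - Complex.I * M 1 2)
      + (e.repr x 0 - e.repr x 3) * (e.repr y 0 - e.repr y 3) * M 2 2) := by
  have hI := Complex.I_mul_I
  have s1 := hs.apply 0 1
  have s2 := hs.apply 0 2
  have s3 := hs.apply 1 2
  simp only [selfDual_null, Fin.sum_univ_three, Matrix.cons_val_zero, Matrix.cons_val_one,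
    Matrix.cons_val, s1, s2, s3]
  linear_combination (k : ℂ) ^ 2 * ((e.repr x 1 + Complex.I * e.repr x 2) *
    (e.repr y 1 + Complex.I * e.repr y 2)) * M 1 1 * hI

/-- By `selfDual_null_form`, W(ℓ,x,ℓ,y) is the real part of a form in which only the last term is a
multiple of ℓ ⊗ ℓ. The coefficients of the other terms vanish exactly when M is a `nullMatrix`. -/
lemma isFundamental_iff (he : IsOrthonormalFrame g e) (hW : IsWeylTensor e W) {k : ℝ}
    (hk : k ≠ 0) : IsFundamental g W (k • (e 0 + e 3)) ↔
      ∃ a p r, weylMatrix e W = nullMatrix a p r := by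
  have hs := weylMatrix_isSymm hW
  have hgl : ∀ x, g (k • (e 0 + e 3)) x = - k * (e.repr x 0 - e.repr x 3) := fun x => by
    rw [he.symm, map_smul, map_add, he.metric_frame, he.metric_frame]
    simp
    ring
  have hWl := fun x y => (weyl_add_dual hW (k • (e 0 + e 3)) x (k • (e 0 + e 3)) y).trans
    (selfDual_null_form e _ hs k x y)
  constructor
  · rintro ⟨-, -, c, hc⟩
    have hre : ∀ x y, c * g (k • (e 0 + e 3)) x * g (k • (e 0 + e 3)) y =
        ((W (k • (e 0 + e 3)) x (k • (e 0 + e 3)) y : ℂ) + Complex.I *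
          (dual e W (k • (e 0 + e 3)) x (k • (e 0 + e 3)) y : ℝ)).re := fun x y => by
      rw [← hc]; simp
    -- The vectors e₁ and e₂ enter through the factors 1 and i, so real values of W give both the
    -- real and the imaginary part of each coefficient.
    have h11 := hre (e 1) (e 1)
    have h12 := hre (e 1) (e 2)
    have h10 := hre (e 1) (e 0)
    have h20 := hre (e 2) (e 0)
    rw [hWl, hgl] at h11 h12 h10 h20
    simp [← Complex.ofReal_pow, hk] at h11 h12 h10 h20
    refine eq_nullMatrix hs (weylMatrix_trace hW) (Complex.ext ?_ ?_) (Complex.ext ?_ ?_)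
    · simp; linarith
    · simp; linarith
    · simp; linarith
    · simp; linarith
  · rintro ⟨a, p, r, h⟩
    have hI := Complex.I_mul_I
    refine ⟨?_, ?_, - 2 * a.re, fun x y => ?_⟩
    · intro h0
      have := congrArg (fun x => e.repr x 0) h0
      simp [hk] at this
    · rw [hgl]; simp
    · rw [hgl, hgl]
      have := hWl x y
      rw [h] at this
      generalize W (k • (e 0 + e 3)) x (k • (e 0 + e 3)) y = ω at this ⊢
      have h2 := congrArg Complex.re this
      simp only [nullMatrix] at h2
      simp [← Complex.ofReal_pow] at h2
      rw [h2]
      ring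

/-- With c - s = e^{-φ}, the parameters a, r, p have boost weights 0, 1, 2, so everything except a
decays towards ℓ. -/
lemma nullMatrix_boost {c s : ℂ} (hcs : c ^ 2 - s ^ 2 = 1) (a p r : ℂ) :
    !![c, - (Complex.I * s), 0; Complex.I * s, c, 0; 0, 0, 1] * nullMatrix a p r *
      !![c, - (Complex.I * s), 0; Complex.I * s, c, 0; 0, 0, 1]ᵀ =
      nullMatrix a ((c - s) ^ 2 * p) ((c - s) * r) := by
  have hI := Complex.I_mul_I
  ext i j
  fin_cases i <;> fin_cases j <;> simp [nullMatrix, Matrix.mul_apply, Fin.sum_univ_three]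
  · linear_combination a * hcs + (2 * c * s * p + s ^ 2 * (a - p)) * hI
  · linear_combination (Complex.I * s ^ 2 * p) * hI
  · linear_combination r * s * hI
  · linear_combination (Complex.I * s ^ 2 * p) * hI
  · linear_combination a * hcs + (s ^ 2 * (a + p) - 2 * c * s * p) * hI
  · ring
  · linear_combination r * s * hI
  · ring

lemma nullMatrix_frob (a p r : ℂ) :
    frob (nullMatrix a p r) = 6 * ‖a‖ ^ 2 + 4 * ‖p‖ ^ 2 + 4 * ‖r‖ ^ 2 := by
  have hI := Complex.I_mul_I
  apply Complex.ofReal_injective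
  rw [frob_eq]
  push_cast
  simp only [← Complex.mul_conj']
  simp [nullMatrix, Fin.sum_univ_three, map_ofNat]
  linear_combination (- 2 * p * (starRingEnd ℂ) p - 2 * r * (starRingEnd ℂ) r) * hI

/-- The spectrum does not involve p and r, so ξ depends on a alone. -/
lemma nullMatrix_charpoly (a p r : ℂ) : (nullMatrix a p r).charpoly.roots = {a, a, - (2 * a)} := by
  have hI : (Polynomial.C Complex.I) * (Polynomial.C Complex.I) = -1 := by
    rw [← Polynomial.C_mul, Complex.I_mul_I]; simp
  have : (nullMatrix a p r).charpoly = (Polynomial.X - Polynomial.C a) *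
      ((Polynomial.X - Polynomial.C a) * (Polynomial.X - Polynomial.C (- (2 * a)))) := by
    rw [Matrix.charpoly, Matrix.det_fin_three]
    simp [nullMatrix]
    generalize Polynomial.C a = A
    generalize Polynomial.C p = P
    generalize Polynomial.C r = R
    generalize Polynomial.C Complex.I = J at *
    linear_combination (- Polynomial.X * P ^ 2 - Polynomial.X * R ^ 2 -
      Polynomial.C 2 * A * P ^ 2 + A * R ^ 2 - P * R ^ 2) * hI
  have n := fun a : ℂ => Polynomial.X_sub_C_ne_zero a
  rw [this, Polynomial.roots_mul (mul_ne_zero (n _) (mul_ne_zero (n _) (n _))),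
    Polynomial.roots_mul (mul_ne_zero (n _) (n _))]
  simp only [Polynomial.roots_X_sub_C]
  rfl

lemma nullMatrix_momentumSq (a p r : ℂ) : momentumSq (nullMatrix a p r) =
    36 * ‖a‖ ^ 4 + 12 * ‖a‖ ^ 2 * ‖r‖ ^ 2 + 12 * ‖2 * a * p + r ^ 2‖ ^ 2 := by
  have hI : Complex.I ^ 2 = -1 := Complex.I_sq
  apply Complex.ofReal_injective
  rw [momentumSq_eq]
  push_cast
  have h4 : ((‖a‖ : ℝ) : ℂ) ^ 4 = (a * (starRingEnd ℂ) a) ^ 2 := by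
    rw [Complex.mul_conj']; ring
  simp only [h4, ← Complex.mul_conj']
  simp [nullMatrix, Matrix.trace, Matrix.mul_apply, Fin.sum_univ_three, map_ofNat]
  ring_nf
  simp only [hI, Complex.I_pow_four]
  ring

/-- Apart from g(u,u), the density depends on u only through u₀ - u₃ and u₁ + i u₂, which vanish on
ℓ. For a unit u the first term is ξ and the others tend to 0 near the line of ℓ. -/
lemma tau_nullMatrix (hW : IsWeylTensor e W) {a p r : ℂ} (h : weylMatrix e W = nullMatrix a p r)
    (u : V) : tau e W u =
      (3 / 2) * ‖a‖ ^ 2 * (e.repr u 0 ^ 2 - e.repr u 1 ^ 2 - e.repr u 2 ^ 2 - e.repr u 3 ^ 2) ^ 2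
      + (e.repr u 0 ^ 2 - e.repr u 1 ^ 2 - e.repr u 2 ^ 2 - e.repr u 3 ^ 2) *
        ‖(e.repr u 0 - e.repr u 3) * r - 3 * a * (e.repr u 1 + Complex.I * e.repr u 2)‖ ^ 2
      + ‖(e.repr u 0 - e.repr u 3) ^ 2 * p +
          2 * (e.repr u 0 - e.repr u 3) * (e.repr u 1 + Complex.I * e.repr u 2) * r
          - 3 * a * (e.repr u 1 + Complex.I * e.repr u 2) ^ 2‖ ^ 2 := by
  have hI : Complex.I ^ 2 = -1 := Complex.I_sq
  apply Complex.ofReal_injective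
  rw [tau, belRobinson_eq_trace hW, h]
  push_cast
  simp only [← Complex.mul_conj']
  simp only [Matrix.trace, Matrix.diag_apply, Matrix.mul_apply, Fin.sum_univ_three,
    Matrix.transpose_apply, Matrix.map_apply]
  simp [nullMatrix, hermMatrix, hermCoord, map_ofNat]
  generalize ((e.repr u 0 : ℝ) : ℂ) = t
  generalize ((e.repr u 1 : ℝ) : ℂ) = x
  generalize ((e.repr u 2 : ℝ) : ℂ) = y
  generalize ((e.repr u 3 : ℝ) : ℂ) = z
  generalize (starRingEnd ℂ) a = a'
  generalize (starRingEnd ℂ) p = p'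
  generalize (starRingEnd ℂ) r = r'
  ring_nf
  have hI3 : Complex.I ^ 3 = - Complex.I := by rw [pow_succ, hI]; ring
  simp only [hI, hI3, Complex.I_pow_four]
  ring

/-! ### Comparison of the super-energy scalars -/

lemma absq_nonneg (g : LinearMap.BilinForm ℝ V) (e : Module.Basis (Fin 4) ℝ V) (W : Tensor4 V)
    (u : V) : 0 ≤ absq g e W u := Real.sqrt_nonneg _

lemma ScalarRelations.bounds {u : V} (h : ScalarRelations g e W u) :
    √((1 / 3) * xi e W ^ 2 + (1 / 6) * alpha e W ^ 2) ≤ abst g e W u ∧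
    √(2 * xi e W ^ 2 - (1 / 2) * alpha e W ^ 2) ≤ absQ g e W u ∧
    √(5 * xi e W ^ 2 + alpha e W ^ 2) ≤ absT g e W u := by
  have h1 := pow_le_pow_left₀ (xi_nonneg e W) h.tau_ge 2
  have h2 := h.momentum_ge
  have h3 := sq_nonneg (absq g e W u)
  rw [h.abst_eq, h.absQ_eq, h.absT_eq]
  exact ⟨Real.sqrt_le_sqrt (by linarith), Real.sqrt_le_sqrt (by linarith),
    Real.sqrt_le_sqrt (by linarith)⟩

/-- |t| increases with τ and |q|, while |Q| and |T| increase with τ and τ² - |q|². Strictness comes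
from τ, so weak monotonicity of τ² - |q|² suffices. -/
lemma ScalarRelations.lt_of_lt (hW : IsWeylTensor e W) {u v : V} (hu : ScalarRelations g e W u)
    (hv : ScalarRelations g e W v) (ht : tau e W v < tau e W u)
    (hq : absq g e W v < absq g e W u)
    (hp : tau e W v ^ 2 - absq g e W v ^ 2 ≤ tau e W u ^ 2 - absq g e W u ^ 2) :
    abst g e W v < abst g e W u ∧ absQ g e W v < absQ g e W u ∧
      absT g e W v < absT g e W u := by
  have hx := xi_nonneg e W
  have h1 := pow_lt_pow_left₀ ht (hx.trans hv.tau_ge) two_ne_zero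
  have h2 := pow_lt_pow_left₀ hq (absq_nonneg g e W v) two_ne_zero
  have h3 := pow_le_pow_left₀ hx hv.tau_ge 2
  have h4 := hv.momentum_ge
  have h5 := pow_le_pow_left₀ (alpha_nonneg e W) (alpha_le hW) 2
  rw [hu.abst_eq, hu.absQ_eq, hu.absT_eq, hv.abst_eq, hv.absQ_eq, hv.absT_eq]
  have h6 := sq_nonneg (xi e W)
  refine ⟨Real.sqrt_lt_sqrt (by positivity) (by linarith),
    Real.sqrt_lt_sqrt (by nlinarith) (by linarith),
    Real.sqrt_lt_sqrt (by nlinarith [sq_nonneg (alpha e W)]) (by linarith)⟩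

/-- The scalar `S` is close to `c` for the observers whose super-energy density is close to the
proper one. -/
def ControlledByDensity (g : LinearMap.BilinForm ℝ V) (e : Module.Basis (Fin 4) ℝ V)
    (W : Tensor4 V) (S : V → ℝ) (c : ℝ) : Prop :=
  ∀ ε : ℝ, 0 < ε → ∃ η : ℝ, 0 < η ∧ ∀ u, IsObserver g e u → |tau e W u - xi e W| < η →
    |S u - c| < ε

lemma controlledByDensity_of_tendsto {S : V → ℝ} {c : ℝ}
    (h : Tendsto S (comap (tau e W) (𝓝 (xi e W)) ⊓ 𝓟 {u | IsObserver g e u}) (𝓝 c)) :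
    ControlledByDensity g e W S c := by
  intro ε hε
  have h1 := h (Metric.ball_mem_nhds c hε)
  rw [mem_map, mem_inf_principal, mem_comap] at h1
  obtain ⟨t, ht, hts⟩ := h1
  obtain ⟨η, hη, hb⟩ := Metric.mem_nhds_iff.1 ht
  refine ⟨η, hη, fun u hu hd => ?_⟩
  have : u ∈ tau e W ⁻¹' t := hb (by rwa [Metric.mem_ball, Real.dist_eq])
  have := hts this hu
  rwa [Set.mem_preimage, Metric.mem_ball, Real.dist_eq] at this

/-- From |q|² ≤ τ² - ξ², the limit τ → ξ forces |q| → 0, and the remaining scalars are continuous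
functions of τ and |q|. -/
lemma controlledByDensity (he : IsOrthonormalFrame g e) (hW : IsWeylTensor e W) :
    ControlledByDensity g e W (tau e W) (xi e W) ∧
    ControlledByDensity g e W (absq g e W) 0 ∧
    ControlledByDensity g e W (abst g e W) √((1 / 3) * xi e W ^ 2 + (1 / 6) * alpha e W ^ 2) ∧
    ControlledByDensity g e W (absQ g e W) √(2 * xi e W ^ 2 - (1 / 2) * alpha e W ^ 2) ∧
    ControlledByDensity g e W (absT g e W) √(5 * xi e W ^ 2 + alpha e W ^ 2) := by
  set l : Filter V := comap (tau e W) (𝓝 (xi e W)) ⊓ 𝓟 {u | IsObserver g e u} with hl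
  have hobs : ∀ᶠ u in l, IsObserver g e u := by
    rw [hl]; exact eventually_inf_principal.2 (Eventually.of_forall fun u hu => hu)
  have ht : Tendsto (tau e W) l (𝓝 (xi e W)) := tendsto_comap.mono_left inf_le_left
  have hq2 : Tendsto (fun u => absq g e W u ^ 2) l (𝓝 0) := by
    have h1 : Tendsto (fun u => tau e W u ^ 2 - xi e W ^ 2) l (𝓝 0) := by
      have := (ht.pow 2).sub_const (xi e W ^ 2)
      rwa [sub_self] at this
    refine squeeze_zero' (Eventually.of_forall fun u => sq_nonneg _) ?_ h1
    filter_upwards [hobs] with u hu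
    linarith [(scalarRelations he hW hu).momentum_ge]
  have hq : Tendsto (absq g e W) l (𝓝 0) := by
    have := hq2.sqrt
    simpa [Real.sqrt_sq (absq_nonneg g e W _)] using this
  refine ⟨fun ε hε => ⟨ε, hε, fun u _ h => h⟩, controlledByDensity_of_tendsto hq,
    controlledByDensity_of_tendsto ?_, controlledByDensity_of_tendsto ?_,
    controlledByDensity_of_tendsto ?_⟩
  · have h := ((((ht.pow 2).const_mul (1 / 3)).add_const ((1 / 6) * alpha e W ^ 2)).add
      (hq2.const_mul (2 / 3))).sqrt
    rw [mul_zero, add_zero] at h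
    refine h.congr' ?_
    filter_upwards [hobs] with u hu
    rw [(scalarRelations he hW hu).abst_eq]
  · have h := (((ht.pow 2).add ((ht.pow 2).sub hq2)).sub_const ((1 / 2) * alpha e W ^ 2)).sqrt
    rw [sub_zero, ← two_mul] at h
    refine h.congr' ?_
    filter_upwards [hobs] with u hu
    rw [(scalarRelations he hW hu).absQ_eq]
  · have h := (((ht.pow 2).add (((ht.pow 2).sub hq2).const_mul 4)).add_const
      (alpha e W ^ 2)).sqrt
    rw [sub_zero, show xi e W ^ 2 + 4 * xi e W ^ 2 = 5 * xi e W ^ 2 by ring] at h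
    refine h.congr' ?_
    filter_upwards [hobs] with u hu
    rw [(scalarRelations he hW hu).absT_eq]

/-- To identify all five infima it is enough to bring the density close to ξ. -/
lemma isProperScalar_of_controlled {S : V → ℝ} {c : ℝ} (h : ControlledByDensity g e W S c)
    (hc : ∀ u, IsObserver g e u → c ≤ S u)
    (hx : ∀ η : ℝ, 0 < η → ∃ u, IsObserver g e u ∧ |tau e W u - xi e W| < η) :
    IsProperScalar g e S c := by
  refine ⟨?_, fun b hb => ?_⟩
  · rintro _ ⟨u, hu, rfl⟩
    exact hc u hu
  · refine le_of_forall_pos_lt_add fun ε hε => ?_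
    obtain ⟨η, hη, h1⟩ := h ε hε
    obtain ⟨u, hu, h2⟩ := hx η hη
    have h3 := h1 u hu h2
    have h4 := hb ⟨u, hu, rfl⟩
    linarith [(abs_lt.1 h3).2]

/-! ### Boosts towards a fundamental direction -/

lemma isObserver_frame (h : FrameEquiv g e e') : IsObserver g e (e' 0) := by
  rw [h.observer_iff]
  have := h.right 0 0
  simp at this
  exact ⟨this, by rw [this]; norm_num⟩

lemma boost_eq (he : IsOrthonormalFrame g e) {k : ℝ} (hk : k ≠ 0) (φ : ℝ) :
    boost g (e 0) (k • (e 0 + e 3)) φ = Real.cosh φ • e 0 + Real.sinh φ • e 3 := by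
  have : g (e 0) (k • (e 0 + e 3)) = -k := by
    simp [he 0 0, he 0 3]
  rw [boost, this, neg_neg, smul_smul, inv_mul_cancel₀ hk, one_smul, add_sub_cancel_left]

lemma exists_boosted_null_frame (he : IsOrthonormalFrame g e) (hW : IsWeylTensor e W) {k : ℝ}
    (hk : k ≠ 0) {a p r : ℂ} (h : weylMatrix e W = nullMatrix a p r) (φ : ℝ) :
    ∃ e' : Module.Basis (Fin 4) ℝ V, FrameEquiv g e e' ∧
      e' 0 = boost g (e 0) (k • (e 0 + e 3)) φ ∧
      weylMatrix e' W = nullMatrix a ((Real.exp (-φ) : ℂ) ^ 2 * p) ((Real.exp (-φ) : ℂ) * r) := by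
  have hcs := Real.cosh_sq_sub_sinh_sq φ
  obtain ⟨e', hf, h0, h1, h2, h3⟩ := exists_boosted_frame he (Real.cosh_pos φ) hcs
  refine ⟨e', hf, by rw [h0, boost_eq he hk], ?_⟩
  have hcs' : (Real.cosh φ : ℂ) ^ 2 - (Real.sinh φ : ℂ) ^ 2 = 1 := by exact_mod_cast hcs
  rw [hf.weylMatrix_eq hW, frameRotation_boosted hcs h0 h1 h2 h3, h, nullMatrix_boost hcs',
    ← Real.cosh_sub_sinh, Complex.ofReal_sub]

lemma xi_of_nullMatrix {a p r : ℂ} (h : weylMatrix e W = nullMatrix a p r) :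
    xi e W = (3 / 2) * ‖a‖ ^ 2 := by
  have h1 := nullMatrix_charpoly a p r
  rw [← h] at h1
  rw [xi_of_roots h1, norm_neg, norm_mul]
  simp
  ring

/-- The density, the norm of the four-momentum and the norm of the super-Poynting vector along the
boosts towards a fundamental direction. -/
lemma boost_scalars (he : IsOrthonormalFrame g e) (hW : IsWeylTensor e W) {k : ℝ}
    (hk : k ≠ 0) {a p r : ℂ} (h : weylMatrix e W = nullMatrix a p r) (φ : ℝ) :
    IsObserver g e (boost g (e 0) (k • (e 0 + e 3)) φ) ∧
    tau e W (boost g (e 0) (k • (e 0 + e 3)) φ) = (3 / 2) * ‖a‖ ^ 2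
      + ‖r‖ ^ 2 * Real.exp (-φ) ^ 2 + ‖p‖ ^ 2 * (Real.exp (-φ) ^ 2) ^ 2 ∧
    tau e W (boost g (e 0) (k • (e 0 + e 3)) φ) ^ 2 -
      absq g e W (boost g (e 0) (k • (e 0 + e 3)) φ) ^ 2 = (9 / 4) * ‖a‖ ^ 4
      + (3 / 4) * ‖a‖ ^ 2 * ‖r‖ ^ 2 * Real.exp (-φ) ^ 2
      + (3 / 4) * ‖2 * a * p + r ^ 2‖ ^ 2 * (Real.exp (-φ) ^ 2) ^ 2 := by
  obtain ⟨e', hf, h0, hm⟩ := exists_boosted_null_frame he hW hk h φ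
  have hW' := hf.isWeylTensor hW
  have hn : ‖(Real.exp (-φ) : ℂ)‖ = Real.exp (-φ) := by
    rw [Complex.norm_real, Real.norm_eq_abs, abs_of_pos (Real.exp_pos _)]
  have ht : tau e W (boost g (e 0) (k • (e 0 + e 3)) φ) = tau e' W (e' 0) := by
    rw [hf.tau_eq, h0]
  have hq : absq g e W (boost g (e 0) (k • (e 0 + e 3)) φ) = absq g e' W (e' 0) := by
    rw [hf.absq_eq, h0]
  refine ⟨h0 ▸ isObserver_frame hf, ?_, ?_⟩
  · rw [ht, tau_frame hW', hm, nullMatrix_frob, norm_mul, norm_mul, norm_pow, hn]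
    ring
  · rw [hq, absq_frame hf.right hW', Real.sq_sqrt (momentumSq_le hW'), ht, hm,
      nullMatrix_momentumSq]
    have : 2 * a * ((Real.exp (-φ) : ℂ) ^ 2 * p) + ((Real.exp (-φ) : ℂ) * r) ^ 2 =
        (Real.exp (-φ) : ℂ) ^ 2 * (2 * a * p + r ^ 2) := by ring
    rw [this, norm_mul, norm_mul, norm_pow, hn]
    ring

/-- This is |q|² as a function of s = e^{-2φ}, with A = |a|, B = |r|, C = |p| and D = |2ap + r²|. -/
lemma quartic_strictMono {A B C D s t : ℝ} (hB : 0 ≤ B) (hC : 0 ≤ C) (hD : 0 ≤ D)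
    (hD' : D ≤ 2 * A * C + B ^ 2) (hBC : B ≠ 0 ∨ C ≠ 0) (hs : 0 < s) (hst : s < t) :
    ((3 / 2) * A ^ 2 + B ^ 2 * s + C ^ 2 * s ^ 2) ^ 2 - ((9 / 4) * A ^ 4
      + (3 / 4) * A ^ 2 * B ^ 2 * s + (3 / 4) * D ^ 2 * s ^ 2) <
    ((3 / 2) * A ^ 2 + B ^ 2 * t + C ^ 2 * t ^ 2) ^ 2 - ((9 / 4) * A ^ 4
      + (3 / 4) * A ^ 2 * B ^ 2 * t + (3 / 4) * D ^ 2 * t ^ 2) := by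
  have hD2 : D ^ 2 ≤ (2 * A * C + B ^ 2) ^ 2 := pow_le_pow_left₀ hD hD' 2
  have ht := hs.trans hst
  -- The divided difference of the polynomial between s and t.
  have key : 0 < (9 / 4) * A ^ 2 * B ^ 2 + (3 * A ^ 2 * C ^ 2 + B ^ 4 - (3 / 4) * D ^ 2) * (s + t)
      + 2 * B ^ 2 * C ^ 2 * (s ^ 2 + s * t + t ^ 2) + C ^ 4 * (s + t) * (s ^ 2 + t ^ 2) := by
    have h1 : (3 * A ^ 2 * C ^ 2 + B ^ 4 - (3 / 4) * (2 * A * C + B ^ 2) ^ 2) * (s + t) ≤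
        (3 * A ^ 2 * C ^ 2 + B ^ 4 - (3 / 4) * D ^ 2) * (s + t) :=
      mul_le_mul_of_nonneg_right (by linarith) (by positivity)
    -- Replacing D by its bound leaves the negative term -3AB²C(s + t), which is absorbed by
    -- completing the square with (9/4)A²B² and part of the cubic contribution.
    have h2 : 0 ≤ B ^ 2 * ((3 / 2 * A - C * (s + t)) ^ 2 + C ^ 2 * ((s + t) ^ 2 / 2
        + (s - t) ^ 2 / 2)) := by positivity
    have h3 : 0 < (1 / 4) * B ^ 4 * (s + t) + C ^ 4 * (s + t) * (s ^ 2 + t ^ 2) := by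
      rcases hBC with h | h
      · have : 0 < B := lt_of_le_of_ne hB (Ne.symm h)
        positivity
      · have : 0 < C := lt_of_le_of_ne hC (Ne.symm h)
        positivity
    nlinarith [h1, h2, h3]
  nlinarith [mul_pos (sub_pos.2 hst) key]

lemma tendsto_tau_boost (he : IsOrthonormalFrame g e) (hW : IsWeylTensor e W) {k : ℝ}
    (hk : k ≠ 0) {a p r : ℂ} (h : weylMatrix e W = nullMatrix a p r) :
    Tendsto (fun φ => tau e W (boost g (e 0) (k • (e 0 + e 3)) φ)) atTop (𝓝 (xi e W)) := by
  have h1 : Tendsto (fun φ : ℝ => Real.exp (-φ) ^ 2) atTop (𝓝 0) := by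
    simpa using (Real.tendsto_exp_neg_atTop_nhds_zero.pow 2)
  have h2 := ((h1.const_mul (‖r‖ ^ 2)).const_add ((3 / 2) * ‖a‖ ^ 2)).add
    ((h1.pow 2).const_mul (‖p‖ ^ 2))
  rw [mul_zero, zero_pow two_ne_zero, mul_zero, add_zero, add_zero,
    ← xi_of_nullMatrix h] at h2
  refine h2.congr fun φ => ?_
  rw [(boost_scalars he hW hk h φ).2.1, xi_of_nullMatrix h]

lemma strictAnti_boost (he : IsOrthonormalFrame g e) (hW : IsWeylTensor e W) {k : ℝ}
    (hk : k ≠ 0) {a p r : ℂ} (h : weylMatrix e W = nullMatrix a p r)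
    (hrp : ‖r‖ ≠ 0 ∨ ‖p‖ ≠ 0) :
    StrictAnti (fun φ => tau e W (boost g (e 0) (k • (e 0 + e 3)) φ)) ∧
    StrictAnti (fun φ => absq g e W (boost g (e 0) (k • (e 0 + e 3)) φ)) ∧
    StrictAnti (fun φ => abst g e W (boost g (e 0) (k • (e 0 + e 3)) φ)) ∧
    StrictAnti (fun φ => absQ g e W (boost g (e 0) (k • (e 0 + e 3)) φ)) ∧
    StrictAnti (fun φ => absT g e W (boost g (e 0) (k • (e 0 + e 3)) φ)) := by
  have key : ∀ φ ψ : ℝ, φ < ψ →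
      let u := boost g (e 0) (k • (e 0 + e 3)) φ
      let v := boost g (e 0) (k • (e 0 + e 3)) ψ
      tau e W v < tau e W u ∧ absq g e W v < absq g e W u ∧ abst g e W v < abst g e W u ∧
        absQ g e W v < absQ g e W u ∧ absT g e W v < absT g e W u := by
    intro φ ψ hφ u v
    obtain ⟨hou, htu, hpu⟩ := boost_scalars he hW hk h φ
    obtain ⟨hov, htv, hpv⟩ := boost_scalars he hW hk h ψ
    have hs : 0 < Real.exp (-ψ) ^ 2 := by positivity
    have hst : Real.exp (-ψ) ^ 2 < Real.exp (-φ) ^ 2 :=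
      pow_lt_pow_left₀ (Real.exp_lt_exp.2 (neg_lt_neg hφ)) (Real.exp_pos _).le two_ne_zero
    have hD : ‖2 * a * p + r ^ 2‖ ≤ 2 * ‖a‖ * ‖p‖ + ‖r‖ ^ 2 := by
      refine (norm_add_le _ _).trans ?_
      rw [norm_mul, norm_mul, norm_pow]
      simp
    have hst2 := pow_lt_pow_left₀ hst hs.le two_ne_zero
    have hq := quartic_strictMono (A := ‖a‖) (norm_nonneg r) (norm_nonneg p) (norm_nonneg _) hD
      hrp hs hst
    rw [← htu, ← htv, ← hpu, ← hpv, sub_sub_cancel, sub_sub_cancel] at hq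
    have hq' := lt_of_pow_lt_pow_left₀ 2 (absq_nonneg g e W _) hq
    have hτ : tau e W v < tau e W u := by
      rw [htu, htv]
      rcases hrp with h | h
      · have : 0 < ‖r‖ ^ 2 := by positivity
        nlinarith [mul_lt_mul_of_pos_left hst this, mul_le_mul_of_nonneg_left hst2.le
          (sq_nonneg ‖p‖)]
      · have : 0 < ‖p‖ ^ 2 := by positivity
        nlinarith [mul_lt_mul_of_pos_left hst2 this, mul_le_mul_of_nonneg_left hst.le
          (sq_nonneg ‖r‖)]
    have hP : tau e W v ^ 2 - absq g e W v ^ 2 ≤ tau e W u ^ 2 - absq g e W u ^ 2 := by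
      rw [hpu, hpv]
      have c1 : 0 ≤ (3 / 4) * ‖a‖ ^ 2 * ‖r‖ ^ 2 := by positivity
      have c2 : 0 ≤ (3 / 4) * ‖2 * a * p + r ^ 2‖ ^ 2 := by positivity
      linarith [mul_le_mul_of_nonneg_left hst.le c1, mul_le_mul_of_nonneg_left hst2.le c2]
    exact ⟨hτ, hq', (scalarRelations he hW hou).lt_of_lt hW (scalarRelations he hW hov)
      hτ hq' hP⟩
  exact ⟨fun φ ψ h => (key φ ψ h).1, fun φ ψ h => (key φ ψ h).2.1,
    fun φ ψ h => (key φ ψ h).2.2.1, fun φ ψ h => (key φ ψ h).2.2.2.1,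
    fun φ ψ h => (key φ ψ h).2.2.2.2⟩

/-- Near a fundamental direction the density is close to the proper one. -/
lemma tau_near_null (he : IsOrthonormalFrame g e) (hW : IsWeylTensor e W) {a p r : ℂ}
    (h : weylMatrix e W = nullMatrix a p r) {ε : ℝ} (hε : 0 < ε) :
    ∃ η : ℝ, 0 < η ∧ ∀ u, g u u = -1 → |e.repr u 0 - e.repr u 3| < η → |e.repr u 1| < η →
      |e.repr u 2| < η → |tau e W u - xi e W| < ε := by
  let G : ℝ × ℝ × ℝ → ℝ := fun z =>
    ‖(z.1 : ℂ) * r - 3 * a * (z.2.1 + Complex.I * z.2.2)‖ ^ 2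
      + ‖(z.1 : ℂ) ^ 2 * p + 2 * z.1 * (z.2.1 + Complex.I * z.2.2) * r
          - 3 * a * (z.2.1 + Complex.I * z.2.2) ^ 2‖ ^ 2
  have hG : Continuous G := by fun_prop
  have hG0 : G 0 = 0 := by simp [G]
  obtain ⟨η, hη, hb⟩ := Metric.continuous_iff.1 hG 0 ε hε
  refine ⟨η, hη, fun u hu hs hx hy => ?_⟩
  have hd : dist ((e.repr u 0 - e.repr u 3, e.repr u 1, e.repr u 2) : ℝ × ℝ × ℝ) 0 < η := by
    rw [dist_zero_right, Prod.norm_def, Prod.norm_def]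
    exact max_lt hs (max_lt hx hy)
  have h1 := hb _ hd
  rw [hG0, Real.dist_eq, sub_zero] at h1
  have hN : e.repr u 0 ^ 2 - e.repr u 1 ^ 2 - e.repr u 2 ^ 2 - e.repr u 3 ^ 2 = 1 := by
    rw [he.metric_eq, Fin.sum_univ_four] at hu
    simp only [sgn_zero, sgn_one, sgn_two, sgn_three] at hu
    linarith
  have h2 : tau e W u - xi e W = G (e.repr u 0 - e.repr u 3, e.repr u 1, e.repr u 2) := by
    rw [tau_nullMatrix hW h, xi_of_nullMatrix h, hN]
    simp only [G]
    push_cast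
    ring
  rwa [h2]

lemma abs_apply_le_of_repr (e : Module.Basis (Fin 4) ℝ V) (f : V →ₗ[ℝ] ℝ) {x : V} {δ : ℝ}
    (hx : ∀ i, |e.repr x i| < δ) : |f x| ≤ (∑ i, |f (e i)|) * δ := by
  conv_lhs => rw [← e.sum_repr x, map_sum]
  rw [Finset.sum_mul]
  refine (Finset.abs_sum_le_sum_abs _ _).trans (Finset.sum_le_sum fun i _ => ?_)
  rw [map_smul, smul_eq_mul, abs_mul, mul_comm]
  exact mul_le_mul_of_nonneg_left (hx i).le (abs_nonneg _)

/-- As f kills ℓ, it sees only u - aℓ. Quantifying over all δ' ≤ δ lets the minimum of several δ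
serve several functionals at once. -/
lemma exists_delta (e : Module.Basis (Fin 4) ℝ V) (f : V →ₗ[ℝ] ℝ) {ℓ : V} (hf : f ℓ = 0)
    {η : ℝ} (hη : 0 < η) : ∃ δ : ℝ, 0 < δ ∧ ∀ u, ∀ δ' ≤ δ,
      (∃ a : ℝ, ∀ i, |e.repr (u - a • ℓ) i| < δ') → |f u| < η := by
  have hC : 0 ≤ ∑ i, |f (e i)| := Finset.sum_nonneg fun i _ => abs_nonneg _
  refine ⟨η / (∑ i, |f (e i)| + 1), by positivity, fun u δ' hδ' ⟨a, ha⟩ => ?_⟩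
  have h1 := abs_apply_le_of_repr e f (fun i => (ha i).trans_le hδ')
  rw [map_sub, map_smul, hf, smul_zero, sub_zero] at h1
  refine h1.trans_lt ?_
  rw [mul_div_assoc', div_lt_iff₀ (by positivity)]
  nlinarith

/-- The functionals u₀ - u₃, u₁, u₂ of a frame adapted to ℓ vanish on ℓ, hence are small near its
line, even when the distance is measured in `e`. -/
lemma tau_near_line (he : IsOrthonormalFrame g e) (hW : IsWeylTensor e W) {ℓ : V}
    (hℓ : IsFundamental g W ℓ) {ε : ℝ} (hε : 0 < ε) :
    ∃ δ : ℝ, 0 < δ ∧ ∀ u, IsObserver g e u →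
      (∃ a : ℝ, ∀ i, |e.repr (u - a • ℓ) i| < δ) → |tau e W u - xi e W| < ε := by
  obtain ⟨e', hf, -, k, hk, hkl⟩ := exists_frame_of_null he hℓ.1 hℓ.2.1
  have hW' := hf.isWeylTensor hW
  obtain ⟨a, p, r, hm⟩ := (isFundamental_iff hf.right hW' hk).1 (hkl ▸ hℓ)
  obtain ⟨η, hη, h⟩ := tau_near_null hf.right hW' hm hε
  obtain ⟨δ₁, h1, h1'⟩ := exists_delta e (e'.coord 0 - e'.coord 3) (ℓ := ℓ)
    (by rw [hkl]; simp) hη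
  obtain ⟨δ₂, h2, h2'⟩ := exists_delta e (e'.coord 1) (ℓ := ℓ) (by rw [hkl]; simp) hη
  obtain ⟨δ₃, h3, h3'⟩ := exists_delta e (e'.coord 2) (ℓ := ℓ) (by rw [hkl]; simp) hη
  refine ⟨min δ₁ (min δ₂ δ₃), lt_min h1 (lt_min h2 h3), fun u hu hd => ?_⟩
  rw [← hf.tau_eq, ← hf.xi_eq hW]
  exact h u hu.1 (h1' u _ (min_le_left _ _) hd)
    (h2' u _ ((min_le_right _ _).trans (min_le_left _ _)) hd)
    (h3' u _ ((min_le_right _ _).trans (min_le_right _ _)) hd)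

lemma nullMatrix_normal {a : ℂ} : nullMatrix a 0 0 * (nullMatrix a 0 0)ᴴ =
    (nullMatrix a 0 0)ᴴ * nullMatrix a 0 0 := by
  ext i j
  fin_cases i <;> fin_cases j <;> simp [nullMatrix, Matrix.mul_apply, Fin.sum_univ_three] <;> ring

/-- For p = r = 0 the matrix is normal, and `e 0` would be at rest. -/
lemma nullMatrix_ne_of_radiative (he : IsOrthonormalFrame g e) (hW : IsWeylTensor e W)
    (hr : IsBelRadiative g e W) {a p r : ℂ} (h : weylMatrix e W = nullMatrix a p r) :
    ‖r‖ ≠ 0 ∨ ‖p‖ ≠ 0 := by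
  by_contra! hc
  rw [norm_eq_zero, norm_eq_zero] at hc
  rw [hc.1, hc.2] at h
  obtain ⟨x, hx⟩ := hr (e 0) (isObserver_frame (FrameEquiv.refl he))
  refine hx ((qPerp_frame_eq_zero_iff he hW).2 ?_ x)
  rw [h, nullMatrix_normal]

lemma FrameEquiv.isBelRadiative (h : FrameEquiv g e e') (hr : IsBelRadiative g e W) :
    IsBelRadiative g e' W := fun u hu => by
  rw [h.qPerp_eq]; exact hr u ((h.observer_iff u).2 hu)

lemma decreasesTo (he : IsOrthonormalFrame g e) (hW : IsWeylTensor e W)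
    (hr : IsBelRadiative g e W) {ℓ : V} (hℓ : IsFundamental g W ℓ) :
    DecreasesTo g e ℓ (tau e W) (xi e W) ∧
    DecreasesTo g e ℓ (absq g e W) 0 ∧
    DecreasesTo g e ℓ (abst g e W) √((1 / 3) * xi e W ^ 2 + (1 / 6) * alpha e W ^ 2) ∧
    DecreasesTo g e ℓ (absQ g e W) √(2 * xi e W ^ 2 - (1 / 2) * alpha e W ^ 2) ∧
    DecreasesTo g e ℓ (absT g e W) √(5 * xi e W ^ 2 + alpha e W ^ 2) := by
  have hu : ∀ u, IsObserver g e u → (∀ φ, IsObserver g e (boost g u ℓ φ)) ∧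
      Tendsto (fun φ => tau e W (boost g u ℓ φ)) atTop (𝓝 (xi e W)) ∧
      StrictAnti (fun φ => tau e W (boost g u ℓ φ)) ∧
      StrictAnti (fun φ => absq g e W (boost g u ℓ φ)) ∧
      StrictAnti (fun φ => abst g e W (boost g u ℓ φ)) ∧
      StrictAnti (fun φ => absQ g e W (boost g u ℓ φ)) ∧
      StrictAnti (fun φ => absT g e W (boost g u ℓ φ)) := by
    intro u hu
    obtain ⟨e', hf, rfl, k, hk, hkl⟩ := exists_frame_of_observer_of_null he hu hℓ.1 hℓ.2.1
    have hW' := hf.isWeylTensor hW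
    obtain ⟨a, p, r, hm⟩ := (isFundamental_iff hf.right hW' hk).1 (hkl ▸ hℓ)
    have hrp := nullMatrix_ne_of_radiative hf.right hW' (hf.isBelRadiative hr) hm
    have h1 := tendsto_tau_boost hf.right hW' hk hm
    have h2 := strictAnti_boost hf.right hW' hk hm hrp
    have h3 := fun φ => (boost_scalars hf.right hW' hk hm φ).1
    rw [hf.tau_eq, hf.xi_eq hW, ← hkl] at h1
    rw [hf.tau_eq, hf.absq_eq, hf.abst_eq, hf.absQ_eq, hf.absT_eq, ← hkl] at h2
    rw [← hkl] at h3
    exact ⟨fun φ => (hf.observer_iff _).2 (h3 φ), h1, h2⟩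
  -- Both limits pass from τ to S through `ControlledByDensity`; only monotonicity is specific to S.
  have main : ∀ (S : V → ℝ) (c : ℝ), ControlledByDensity g e W S c →
      (∀ u, IsObserver g e u → StrictAnti (fun φ => S (boost g u ℓ φ))) →
      DecreasesTo g e ℓ S c := by
    intro S c hS hanti
    refine ⟨fun u huo => ⟨hanti u huo, ?_⟩, fun ε hε => ?_⟩
    · rw [Metric.tendsto_nhds]
      intro ε hε
      obtain ⟨η, hη, h⟩ := hS ε hε
      filter_upwards [Metric.tendsto_nhds.1 (hu u huo).2.1 η hη] with φ hφ
      rw [Real.dist_eq] at hφ ⊢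
      exact h _ ((hu u huo).1 φ) hφ
    · obtain ⟨η, hη, h⟩ := hS ε hε
      obtain ⟨δ, hδ, h'⟩ := tau_near_line he hW hℓ hη
      exact ⟨δ, hδ, fun u huo hd => h u huo (h' u huo hd)⟩
  obtain ⟨c1, c2, c3, c4, c5⟩ := controlledByDensity he hW
  exact ⟨main _ _ c1 fun u h => (hu u h).2.2.1, main _ _ c2 fun u h => (hu u h).2.2.2.1,
    main _ _ c3 fun u h => (hu u h).2.2.2.2.1, main _ _ c4 fun u h => (hu u h).2.2.2.2.2.1,
    main _ _ c5 fun u h => (hu u h).2.2.2.2.2.2⟩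

/-! ### Minimal polynomials -/

/-- Linear independence of 1, M, M² excludes an annihilating polynomial of lower degree. -/
lemma minpoly_eq_of_degree_three {M : Matrix (Fin 3) (Fin 3) ℂ} {P : Polynomial ℂ}
    (hP : P.Monic) (hd : P.degree = 3) (h0 : Polynomial.aeval M P = 0)
    (h : ∀ a b c : ℂ, a • 1 + b • M + c • (M * M) = 0 → a = 0 ∧ b = 0 ∧ c = 0) :
    minpoly ℂ M = P := by
  refine (minpoly.unique' ℂ M hP h0 fun q hq => or_iff_not_imp_right.2 fun hq0 => ?_).symm
  rw [not_not, Polynomial.aeval_eq_sum_range' (n := 3)] at hq0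
  · rw [Finset.sum_range_succ, Finset.sum_range_succ, Finset.sum_range_one, pow_zero, pow_one,
      pow_two] at hq0
    obtain ⟨h1, h2, h3⟩ := h _ _ _ hq0
    ext n
    rw [Polynomial.coeff_zero]
    rcases lt_or_ge n 3 with hn | hn
    · interval_cases n <;> assumption
    · refine Polynomial.coeff_eq_zero_of_degree_lt (hq.trans_le ?_)
      rw [hd]; exact_mod_cast hn
  · by_cases hq1 : q = 0
    · simp [hq1]
    · rw [hd] at hq
      rw [Polynomial.natDegree_lt_iff_degree_lt hq1]
      exact_mod_cast hq

lemma minpoly_eq_of_degree_two {M : Matrix (Fin 3) (Fin 3) ℂ} {P : Polynomial ℂ}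
    (hP : P.Monic) (hd : P.degree = 2) (h0 : Polynomial.aeval M P = 0)
    (h : ∀ a b : ℂ, a • 1 + b • M = 0 → a = 0 ∧ b = 0) : minpoly ℂ M = P := by
  refine (minpoly.unique' ℂ M hP h0 fun q hq => or_iff_not_imp_right.2 fun hq0 => ?_).symm
  rw [not_not, Polynomial.aeval_eq_sum_range' (n := 2)] at hq0
  · rw [Finset.sum_range_succ, Finset.sum_range_one, pow_zero, pow_one] at hq0
    obtain ⟨h1, h2⟩ := h _ _ hq0
    ext n
    rw [Polynomial.coeff_zero]
    rcases lt_or_ge n 2 with hn | hn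
    · interval_cases n <;> assumption
    · refine Polynomial.coeff_eq_zero_of_degree_lt (hq.trans_le ?_)
      rw [hd]; exact_mod_cast hn
  · by_cases hq1 : q = 0
    · simp [hq1]
    · rw [hd] at hq
      rw [Polynomial.natDegree_lt_iff_degree_lt hq1]
      exact_mod_cast hq

lemma isTypeII_of_nullMatrix {a p : ℂ} (ha : a ≠ 0) (hp : p ≠ 0)
    (h : weylMatrix e W = nullMatrix a p 0) : IsTypeII e W := by
  have hI := Complex.I_mul_I
  refine ⟨a, ha, ?_⟩
  rw [h]
  apply minpoly_eq_of_degree_three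
  · monicity!
  · compute_degree!
  · simp only [map_mul, map_pow, map_sub, map_add, Polynomial.aeval_X, Polynomial.aeval_C,
      Matrix.algebraMap_eq_diagonal]
    ext i j
    fin_cases i <;> fin_cases j <;>
      simp [nullMatrix, Matrix.mul_apply, pow_two, Fin.sum_univ_three] <;> grind
  · intro x y z hx
    have h00 := congrFun (congrFun hx 0) 0
    have h01 := congrFun (congrFun hx 0) 1
    have h11 := congrFun (congrFun hx 1) 1
    have h22 := congrFun (congrFun hx 2) 2
    simp [nullMatrix] at h00 h01 h11 h22
    have h1 : p * (y + 2 * a * z) = 0 := by linear_combination (h00 - h11) / 2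
    have h2 := (mul_eq_zero.1 h1).resolve_left hp
    have hz : 9 * a ^ 2 * z = 0 := by
      linear_combination h22 - (h00 + h11) / 2 + 3 * a * h2 + z * p ^ 2 * hI
    have hz : z = 0 := by simpa [ha] using hz
    have hy : y = 0 := by simpa [hz] using h2
    refine ⟨?_, hy, hz⟩
    simpa [hy, hz] using h22

lemma isTypeIII_of_nullMatrix {p r : ℂ} (hr : r ≠ 0)
    (h : weylMatrix e W = nullMatrix 0 p r) : IsTypeIII e W := by
  have hI := Complex.I_mul_I
  unfold IsTypeIII
  rw [h]
  apply minpoly_eq_of_degree_three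
  · monicity!
  · compute_degree!
  · simp only [map_pow, Polynomial.aeval_X]
    ext i j
    fin_cases i <;> fin_cases j <;>
      simp [nullMatrix, Matrix.mul_apply, pow_succ, Fin.sum_univ_three] <;> grind
  · intro x y z hx
    have h01 := congrFun (congrFun hx 0) 1
    have h02 := congrFun (congrFun hx 0) 2
    have h22 := congrFun (congrFun hx 2) 2
    simp [nullMatrix] at h01 h02 h22
    have hy : r * y = 0 := by linear_combination h02 - z * r * p * hI
    have hy : y = 0 := (mul_eq_zero.1 hy).resolve_left hr
    have hz : z * r ^ 2 = 0 := by
      linear_combination Complex.I * h01 + (z * r ^ 2 + y * p) * hI - p * hy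
    have hz : z = 0 := by simpa [hr] using hz
    refine ⟨?_, hy, hz⟩
    simpa [hy, hz] using h22

lemma isTypeN_of_nullMatrix {p : ℂ} (hp : p ≠ 0)
    (h : weylMatrix e W = nullMatrix 0 p 0) : IsTypeN e W := by
  have hI := Complex.I_mul_I
  unfold IsTypeN
  rw [h]
  apply minpoly_eq_of_degree_two
  · monicity!
  · compute_degree!
  · simp only [map_pow, Polynomial.aeval_X]
    ext i j
    fin_cases i <;> fin_cases j <;>
      simp [nullMatrix, Matrix.mul_apply, pow_succ, Fin.sum_univ_three] <;> grind
  · intro x y hx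
    have h00 := congrFun (congrFun hx 0) 0
    have h22 := congrFun (congrFun hx 2) 2
    simp [nullMatrix] at h00 h22
    refine ⟨h22, ?_⟩
    simpa [h22, hp] using h00

/-- The minimal polynomial of a field of type N, III or II has a multiple root. -/
lemma sq_dvd_minpoly (h : IsTypeN e W ∨ IsTypeIII e W ∨ IsTypeII e W) :
    ∃ c : ℂ, (Polynomial.X - Polynomial.C c) ^ 2 ∣ minpoly ℂ (weylMatrix e W) := by
  rcases h with h | h | ⟨a, -, h⟩
  · exact ⟨0, by rw [h]; simp⟩
  · exact ⟨0, by rw [h]; simpa using pow_dvd_pow _ (by norm_num)⟩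
  · exact ⟨a, by rw [h]; exact dvd_mul_right _ _⟩

lemma eval_derivative_of_sq_dvd {P : Polynomial ℂ} {c : ℂ}
    (h : (Polynomial.X - Polynomial.C c) ^ 2 ∣ P) :
    P.eval c = 0 ∧ (Polynomial.derivative P).eval c = 0 := by
  obtain ⟨k, rfl⟩ := h
  simp [Polynomial.derivative_mul, pow_two]

lemma not_isTypeI_of_sq_dvd {c : ℂ}
    (h : (Polynomial.X - Polynomial.C c) ^ 2 ∣ minpoly ℂ (weylMatrix e W)) : ¬ IsTypeI e W := by
  intro h1
  have h2 := h.trans (Matrix.minpoly_dvd_charpoly (weylMatrix e W))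
  have h3 := (Polynomial.le_rootMultiplicity_iff (Matrix.charpoly_monic _).ne_zero).2 h2
  rw [← Polynomial.count_roots] at h3
  have := Multiset.nodup_iff_count_le_one.1 h1 c
  omega

lemma not_isTypeD_of_sq_dvd {c : ℂ}
    (h : (Polynomial.X - Polynomial.C c) ^ 2 ∣ minpoly ℂ (weylMatrix e W)) : ¬ IsTypeD e W := by
  rintro ⟨a, ha, h1⟩
  rw [h1] at h
  obtain ⟨h2, h3⟩ := eval_derivative_of_sq_dvd h
  simp [Polynomial.derivative_mul] at h2 h3
  have : 9 * a ^ 2 = 0 := by grind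
  simp [ha] at this

lemma weylMatrix_ne_zero_of_sq_dvd {c : ℂ}
    (h : (Polynomial.X - Polynomial.C c) ^ 2 ∣ minpoly ℂ (weylMatrix e W)) :
    weylMatrix e W ≠ 0 := by
  intro h1
  rw [h1, minpoly.zero] at h
  simpa using (eval_derivative_of_sq_dvd h).2

lemma eq_zero_of_weylMatrix (hW : IsWeylTensor e W) (h : weylMatrix e W = 0) : W = 0 := by
  ext x y z w
  have := weyl_add_dual hW x y z w
  simp only [h, Matrix.zero_apply, mul_zero, zero_mul, Finset.sum_const_zero] at this
  simpa using congrArg Complex.re this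

/-! ### The types of the fields with observers at rest -/

lemma isTypeD_of_conj_diagonal {a : ℂ} (ha : a ≠ 0) {d : Fin 3 → ℂ}
    (hd : ∀ i, d i = a ∨ d i = -(2 * a)) (h1 : ∃ i, d i = a) (h2 : ∃ i, d i = -(2 * a))
    (h : minpoly ℂ (weylMatrix e W) = minpoly ℂ (Matrix.diagonal d)) : IsTypeD e W := by
  refine ⟨a, ha, ?_⟩
  rw [h]
  apply minpoly_eq_of_degree_two
  · monicity!
  · compute_degree!
  · simp only [map_mul, map_sub, map_add, Polynomial.aeval_X, Polynomial.aeval_C,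
      Matrix.algebraMap_eq_diagonal, Matrix.diagonal_sub, Matrix.diagonal_add,
      Matrix.diagonal_mul_diagonal]
    rw [Matrix.diagonal_eq_zero]
    ext i
    rcases hd i with hi | hi <;> simp [hi]
  · intro x y hx
    obtain ⟨i, hi⟩ := h1
    obtain ⟨j, hj⟩ := h2
    have e1 := congrFun (congrFun hx i) i
    have e2 := congrFun (congrFun hx j) j
    simp [hi, hj] at e1 e2
    have hy : 3 * a * y = 0 := by linear_combination e1 - e2
    have hy : y = 0 := by simpa [ha] using hy
    exact ⟨by simpa [hy] using e1, hy⟩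

/-- An observer at rest makes M normal, hence similar to a diagonal matrix of trace zero. Its
eigenvalues are either distinct or of the form x, x, -2x. -/
lemma type_of_atRest (he : IsOrthonormalFrame g e) (hW : IsWeylTensor e W)
    (h : ¬ IsBelRadiative g e W) : weylMatrix e W = 0 ∨ IsTypeI e W ∨ IsTypeD e W := by
  unfold IsBelRadiative at h
  push Not at h
  obtain ⟨u, hu, hq⟩ := h
  obtain ⟨e', hf, rfl⟩ := exists_frame_of_observer he hu
  rw [← hf.qPerp_eq] at hq
  have hW' := hf.isWeylTensor hW
  rw [qPerp_frame_eq_zero_iff hf.right hW'] at hq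
  obtain ⟨a, b, c, hroots, htr, -, -, -, hn⟩ := schur (weylMatrix e' W)
  obtain ⟨-, v, hv⟩ := hn hq
  have hmin := minpoly_units_conj v (weylMatrix e' W)
  rw [hv, hf.minpoly_eq hW] at hmin
  rw [weylMatrix_trace hW'] at htr
  rw [hf.charpoly_eq hW] at hroots
  by_cases hnd : IsTypeI e W
  · exact Or.inr (Or.inl hnd)
  -- The case of a repeated eigenvalue x: type D for x ≠ 0; for x = 0 the minimal polynomial is X
  -- and the matrix vanishes.
  have hD : ∀ x : ℂ, (∀ i, ![a, b, c] i = x ∨ ![a, b, c] i = -(2 * x)) →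
      (∃ i, ![a, b, c] i = x) → (∃ i, ![a, b, c] i = -(2 * x)) →
      weylMatrix e W = 0 ∨ IsTypeI e W ∨ IsTypeD e W := by
    intro x h1 h2 h3
    by_cases hx : x = 0
    · subst hx
      have h4 : Matrix.diagonal ![a, b, c] = (0 : Matrix (Fin 3) (Fin 3) ℂ) := by
        rw [Matrix.diagonal_eq_zero]
        ext i
        simpa using h1 i
      rw [h4, minpoly.zero] at hmin
      have := minpoly.aeval ℂ (weylMatrix e W)
      rw [← hmin, Polynomial.aeval_X] at this
      exact Or.inl this
    · exact Or.inr (Or.inr (isTypeD_of_conj_diagonal hx h1 h2 h3 hmin.symm))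
  have h3 : a = b ∨ a = c ∨ b = c := by
    by_contra! hne
    apply hnd
    rw [IsTypeI, hroots]
    simp [hne]
  rcases h3 with rfl | rfl | rfl
  · have : c = -(2 * a) := by linear_combination -htr
    subst this
    exact hD a (fun i => by fin_cases i <;> simp) ⟨0, rfl⟩ ⟨2, rfl⟩
  · have : b = -(2 * a) := by linear_combination -htr
    subst this
    exact hD a (fun i => by fin_cases i <;> simp) ⟨0, rfl⟩ ⟨1, rfl⟩
  · have : a = -(2 * b) := by linear_combination -htr
    subst this
    exact hD b (fun i => by fin_cases i <;> simp) ⟨1, rfl⟩ ⟨0, rfl⟩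

/-! ### Canonical frames of radiative fields -/

lemma FrameEquiv.mulVec_eq_smul (h : FrameEquiv g e e') (hW : IsWeylTensor e W) {w : Fin 3 → ℂ}
    {t : ℂ} (hw : weylMatrix e W *ᵥ w = t • w) :
    weylMatrix e' W *ᵥ (frameRotation e e' *ᵥ w) = t • (frameRotation e e' *ᵥ w) := by
  rw [h.weylMatrix_eq hW, Matrix.mulVec_mulVec, Matrix.mul_assoc,
    mul_eq_one_comm.mp h.rotation_mul_transpose, mul_one, ← Matrix.mulVec_mulVec, hw,
    Matrix.mulVec_smul]

lemma exists_frame_of_orthogonal (he : IsOrthonormalFrame g e) (w : Fin 3 → ℂ)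
    (hw : (fun i => (w i).re) ⬝ᵥ (fun i => (w i).im) = 0) :
    ∃ e' : Module.Basis (Fin 4) ℝ V, FrameEquiv g e e' ∧
      frameRotation e e' *ᵥ w = ![((√((fun i => (w i).re) ⬝ᵥ fun i => (w i).re) : ℝ) : ℂ),
        -(Complex.I * (√((fun i => (w i).im) ⬝ᵥ fun i => (w i).im) : ℝ)), 0] := by
  set x : Fin 3 → ℝ := fun i => (w i).re with hx
  set y : Fin 3 → ℝ := fun i => (w i).im with hy
  -- Taking -y instead of y makes a null w a multiple of (1, -i, 0), the eigenvector built into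
  -- `nullMatrix`.
  obtain ⟨R, h1, h2, h3, h4⟩ := exists_rotation x (-y) (by rw [dotProduct_neg, hw, neg_zero])
  rw [neg_dotProduct_neg] at h4
  obtain ⟨e', hf, h0, hs⟩ := exists_rotated_frame he R h1 h2
  refine ⟨e', hf, ?_⟩
  rw [frameRotation_rotated h0 hs]
  have h5 : ∀ i, (R.map (fun x : ℝ => (x : ℂ)) *ᵥ w) i =
      ((R *ᵥ x) i : ℝ) - Complex.I * ((R *ᵥ (-y)) i : ℝ) := fun i => by
    simp only [Matrix.mulVec, dotProduct, Matrix.map_apply, Complex.ofReal_sum, Finset.mul_sum,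
      ← Finset.sum_sub_distrib, Pi.neg_apply]
    refine Finset.sum_congr rfl fun j _ => ?_
    conv_lhs => rw [← Complex.re_add_im (w j)]
    simp only [hx, hy]
    push_cast
    ring
  ext i
  rw [h5, h3, h4]
  fin_cases i <;> simp

lemma dotProduct_self_re_im (w : Fin 3 → ℂ) : w ⬝ᵥ w =
    (((fun i => (w i).re) ⬝ᵥ (fun i => (w i).re) - (fun i => (w i).im) ⬝ᵥ (fun i => (w i).im) : ℝ)
      : ℂ) + (2 * ((fun i => (w i).re) ⬝ᵥ (fun i => (w i).im)) : ℝ) * Complex.I := by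
  apply Complex.ext <;> simp [dotProduct, Fin.sum_univ_three] <;> ring

/-- The equation w · w = 0 says that the real and imaginary parts of w are orthogonal and of equal
length, so a rotation alone suffices. -/
lemma exists_frame_of_null_eigenvector (he : IsOrthonormalFrame g e) (hW : IsWeylTensor e W)
    {w : Fin 3 → ℂ} {t : ℂ} (hw0 : w ≠ 0) (hn : w ⬝ᵥ w = 0) (hw : weylMatrix e W *ᵥ w = t • w) :
    ∃ e' : Module.Basis (Fin 4) ℝ V, FrameEquiv g e e' ∧
      ∃ a p r, weylMatrix e' W = nullMatrix a p r := by
  rw [dotProduct_self_re_im] at hn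
  have h1 := congrArg Complex.re hn
  have h2 := congrArg Complex.im hn
  simp at h1 h2
  obtain ⟨e', hf, hr⟩ := exists_frame_of_orthogonal he w h2
  have h3 := hf.mulVec_eq_smul hW hw
  rw [hr, ← sub_eq_zero.1 h1] at h3
  set k := √((fun i => (w i).re) ⬝ᵥ fun i => (w i).re) with hk
  have hk0 : (k : ℂ) ≠ 0 := by
    rw [Complex.ofReal_ne_zero]
    intro h4
    have h5 : frameRotation e e' *ᵥ w = 0 := by
      rw [hr, ← sub_eq_zero.1 h1, ← hk, h4]
      ext i; fin_cases i <;> simp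
    apply hw0
    have h6 := congrArg (fun v => (frameRotation e e')ᵀ *ᵥ v) h5
    simpa [Matrix.mulVec_mulVec, mul_eq_one_comm.mp hf.rotation_mul_transpose] using h6
  have hW' := hf.isWeylTensor hW
  have hs := weylMatrix_isSymm hW'
  have e0 := congrFun h3 0
  have e1 := congrFun h3 1
  have e2 := congrFun h3 2
  simp [Matrix.mulVec, dotProduct, Fin.sum_univ_three] at e0 e1 e2
  have s1 := hs.apply 0 1
  have s2 := hs.apply 0 2
  have s3 := hs.apply 1 2
  rw [s1] at e1
  rw [s2, s3] at e2
  refine ⟨e', hf, eq_nullMatrix hs (weylMatrix_trace hW') ?_ ?_⟩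
  · apply mul_left_cancel₀ hk0
    linear_combination e0 - Complex.I * e1 +
      (- k * weylMatrix e' W 1 1 + t * k) * Complex.I_mul_I
  · apply mul_left_cancel₀ hk0
    linear_combination e2

/-- The matrix of a Weyl tensor with the third spatial vector as an eigenvector. -/
noncomputable def blockMatrix (s p q : ℂ) : Matrix (Fin 3) (Fin 3) ℂ :=
  !![s + p + q, -(Complex.I * (p - q)), 0; -(Complex.I * (p - q)), s - p - q, 0; 0, 0, -(2 * s)]

lemma blockMatrix_zero_right (s p : ℂ) : blockMatrix s p 0 = nullMatrix s p 0 := by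
  simp [blockMatrix, nullMatrix]

/-- p and q have opposite boost weights, so a boost can balance |p| and |q| when both are nonzero.
-/
lemma blockMatrix_boost {c s : ℂ} (hcs : c ^ 2 - s ^ 2 = 1) (a p q : ℂ) :
    !![c, - (Complex.I * s), 0; Complex.I * s, c, 0; 0, 0, 1] * blockMatrix a p q *
      !![c, - (Complex.I * s), 0; Complex.I * s, c, 0; 0, 0, 1]ᵀ =
    blockMatrix a ((c - s) ^ 2 * p) ((c + s) ^ 2 * q) := by
  have hI := Complex.I_mul_I
  ext i j
  fin_cases i <;> fin_cases j <;> simp [blockMatrix, Matrix.mul_apply, Fin.sum_univ_three] <;> grind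

lemma blockMatrix_normal {s p q : ℂ} (h : ‖p‖ = ‖q‖) : blockMatrix s p q * (blockMatrix s p q)ᴴ =
    (blockMatrix s p q)ᴴ * blockMatrix s p q := by
  have h1 : p * (starRingEnd ℂ) p = q * (starRingEnd ℂ) q := by
    rw [Complex.mul_conj', Complex.mul_conj', h]
  have hI := Complex.I_mul_I
  ext i j
  fin_cases i <;> fin_cases j <;> simp [blockMatrix, Matrix.mul_apply, Fin.sum_univ_three] <;> grind

/-- Once w · w = 1, its real and imaginary parts are orthogonal with |x|² - |y|² = 1. A rotation
gives (|x|, -i|y|, 0), the boost with c = |x| and s = |y| gives (1, 0, 0), and a cyclic permutation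
gives (0, 0, 1). -/
lemma exists_frame_of_eigenvector (he : IsOrthonormalFrame g e) (hW : IsWeylTensor e W)
    {w : Fin 3 → ℂ} {t : ℂ} (hn : w ⬝ᵥ w ≠ 0) (hw : weylMatrix e W *ᵥ w = t • w) :
    ∃ e' : Module.Basis (Fin 4) ℝ V, FrameEquiv g e e' ∧
      ∃ s p q, weylMatrix e' W = blockMatrix s p q := by
  obtain ⟨w, hn, hw⟩ : ∃ v : Fin 3 → ℂ, v ⬝ᵥ v = 1 ∧ weylMatrix e W *ᵥ v = t • v := by
    obtain ⟨k, hk⟩ := IsAlgClosed.exists_pow_nat_eq (w ⬝ᵥ w) (n := 2) (by norm_num)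
    refine ⟨k⁻¹ • w, ?_, by rw [Matrix.mulVec_smul, hw, smul_comm]⟩
    rw [smul_dotProduct, dotProduct_smul, ← hk, smul_eq_mul, smul_eq_mul]
    have : k ≠ 0 := fun h => hn (by rw [← hk, h]; simp)
    field_simp
  rw [dotProduct_self_re_im] at hn
  have h1 := congrArg Complex.re hn
  have h2 := congrArg Complex.im hn
  simp at h1 h2
  obtain ⟨e₁, f₁, hr⟩ := exists_frame_of_orthogonal he w h2
  have hw1 := f₁.mulVec_eq_smul hW hw
  have hW1 := f₁.isWeylTensor hW
  have hy : 0 ≤ (fun i => (w i).im) ⬝ᵥ fun i => (w i).im :=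
    Finset.sum_nonneg fun i _ => mul_self_nonneg _
  rw [hr] at hw1
  generalize (fun i => (w i).im) ⬝ᵥ (fun i => (w i).im) = y at *
  generalize (fun i => (w i).re) ⬝ᵥ (fun i => (w i).re) = x at *
  have hx : 0 < x := by linarith
  have hcs : √x ^ 2 - √y ^ 2 = 1 := by rw [Real.sq_sqrt hx.le, Real.sq_sqrt hy, h1]
  have hcs' : (√x : ℂ) ^ 2 - (√y : ℂ) ^ 2 = 1 := by exact_mod_cast hcs
  obtain ⟨e₂, f₂, a0, a1, a2, a3⟩ := exists_boosted_frame f₁.right (Real.sqrt_pos.2 hx) hcs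
  have hw2 := f₂.mulVec_eq_smul hW1 hw1
  have hW2 := f₂.isWeylTensor hW1
  have hv2 : frameRotation e₁ e₂ *ᵥ ![(√x : ℂ), -(Complex.I * √y), 0] = ![1, 0, 0] := by
    rw [frameRotation_boosted hcs a0 a1 a2 a3]
    ext i
    fin_cases i <;> simp [Matrix.mulVec, dotProduct, Fin.sum_univ_three]
    · linear_combination hcs' + (√y : ℂ) ^ 2 * Complex.I_mul_I
    · ring
  rw [hv2] at hw2
  have hP : (!![0, 1, 0; 0, 0, 1; 1, 0, 0] : Matrix (Fin 3) (Fin 3) ℝ) *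
      (!![0, 1, 0; 0, 0, 1; 1, 0, 0] : Matrix (Fin 3) (Fin 3) ℝ)ᵀ = 1 := by
    ext i j
    fin_cases i <;> fin_cases j <;> simp [Matrix.mul_apply, Fin.sum_univ_three]
  obtain ⟨e₃, f₃, b0, bs⟩ := exists_rotated_frame f₂.right _ hP
    (by simp [Matrix.det_fin_three])
  have hw3 := f₃.mulVec_eq_smul hW2 hw2
  have hW3 := f₃.isWeylTensor hW2
  have hv3 : frameRotation e₂ e₃ *ᵥ ![1, 0, 0] = ![0, 0, 1] := by
    rw [frameRotation_rotated b0 bs]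
    ext i
    fin_cases i <;> simp [Matrix.mulVec, dotProduct, Fin.sum_univ_three]
  rw [hv3] at hw3
  refine ⟨e₃, (f₁.trans f₂).trans f₃, ?_⟩
  have hs := weylMatrix_isSymm hW3
  have ht := weylMatrix_trace hW3
  rw [Matrix.trace, Fin.sum_univ_three] at ht
  simp only [Matrix.diag_apply] at ht
  set M := weylMatrix e₃ W
  have e0 := congrFun hw3 0
  have e1 := congrFun hw3 1
  simp [Matrix.mulVec, dotProduct, Fin.sum_univ_three] at e0 e1
  have s1 := hs.apply 0 1
  have s2 := hs.apply 0 2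
  have s3 := hs.apply 1 2
  have hI := Complex.I_mul_I
  -- p and q are the coefficients of v vᵀ in the upper block for the null vectors v = (1, -i) and v
  -- = (1, i).
  refine ⟨(M 0 0 + M 1 1) / 2, (M 0 0 - M 1 1) / 4 + Complex.I * M 0 1 / 2,
    (M 0 0 - M 1 1) / 4 - Complex.I * M 0 1 / 2, ?_⟩
  ext i j
  fin_cases i <;> fin_cases j <;> simp [blockMatrix, e0, e1, s1, s2, s3]
  · ring
  · linear_combination M 0 1 * hI
  · linear_combination M 0 1 * hI
  · ring
  · linear_combination ht

lemma exists_nullMatrix_of_blockMatrix (he : IsOrthonormalFrame g e) (hW : IsWeylTensor e W)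
    (hr : IsBelRadiative g e W) {s p q : ℂ} (h : weylMatrix e W = blockMatrix s p q) :
    ∃ e' : Module.Basis (Fin 4) ℝ V, FrameEquiv g e e' ∧
      ∃ p', weylMatrix e' W = nullMatrix s p' 0 := by
  by_cases hq : q = 0
  · exact ⟨e, FrameEquiv.refl he, p, by rw [h, hq, blockMatrix_zero_right]⟩
  by_cases hp : p = 0
  · have hP : (!![1, 0, 0; 0, -1, 0; 0, 0, -1] : Matrix (Fin 3) (Fin 3) ℝ) *
        (!![1, 0, 0; 0, -1, 0; 0, 0, -1] : Matrix (Fin 3) (Fin 3) ℝ)ᵀ = 1 := by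
      ext i j
      fin_cases i <;> fin_cases j <;> simp [Matrix.mul_apply, Fin.sum_univ_three]
    -- The half-turn about e₁ reverses e₃ and exchanges the roles of p and q.
    obtain ⟨e', hf, b0, bs⟩ := exists_rotated_frame he _ hP (by simp [Matrix.det_fin_three])
    refine ⟨e', hf, q, ?_⟩
    rw [hf.weylMatrix_eq hW, h, frameRotation_rotated b0 bs, hp]
    ext i j
    fin_cases i <;> fin_cases j <;>
      simp [blockMatrix, nullMatrix, Matrix.mul_apply, Fin.sum_univ_three]
  exfalso
  have hp' : 0 < ‖p‖ := norm_pos_iff.2 hp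
  have hq' : 0 < ‖q‖ := norm_pos_iff.2 hq
  -- The boost with e^φ = k replaces |p| and |q| by |p|/k² and k²|q|, which agree when k⁴ = |p|/|q|.
  -- The matrix is then normal and its observer at rest, a contradiction.
  set k := √(√(‖p‖ / ‖q‖)) with hk
  have hk0 : 0 < k := Real.sqrt_pos.2 (Real.sqrt_pos.2 (by positivity))
  have hk4 : k ^ 4 * ‖q‖ = ‖p‖ := by
    rw [show k ^ 4 = (k ^ 2) ^ 2 by ring, hk, Real.sq_sqrt (by positivity),
      Real.sq_sqrt (by positivity)]
    field_simp
  have hcs : ((k + k⁻¹) / 2) ^ 2 - ((k - k⁻¹) / 2) ^ 2 = 1 := by field_simp; ring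
  obtain ⟨e', hf, a0, a1, a2, a3⟩ := exists_boosted_frame he (c := (k + k⁻¹) / 2) (by positivity) hcs
  have hM := hf.weylMatrix_eq hW
  rw [frameRotation_boosted hcs a0 a1 a2 a3, h,
    blockMatrix_boost (by exact_mod_cast hcs)] at hM
  have hm : (((k + k⁻¹) / 2 : ℝ) : ℂ) - ((k - k⁻¹) / 2 : ℝ) = (k⁻¹ : ℝ) := by push_cast; ring
  have hp : (((k + k⁻¹) / 2 : ℝ) : ℂ) + ((k - k⁻¹) / 2 : ℝ) = (k : ℝ) := by push_cast; ring
  rw [hm, hp] at hM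
  obtain ⟨x, hx⟩ := hf.isBelRadiative hr (e' 0) (isObserver_frame (FrameEquiv.refl hf.right))
  refine hx ((qPerp_frame_eq_zero_iff hf.right (hf.isWeylTensor hW)).2 ?_ x)
  rw [hM, blockMatrix_normal]
  rw [norm_mul, norm_mul, norm_pow, norm_pow, Complex.norm_real, Complex.norm_real,
    Real.norm_of_nonneg hk0.le, Real.norm_of_nonneg (by positivity), ← hk4]
  field_simp

/-- A non-null eigenvector leads through `blockMatrix` to r = 0. If the eigenvector found is null,
either a = 0 or the eigenvalue -2a differs from a and has a non-null eigenvector. -/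
theorem exists_canonical_frame (he : IsOrthonormalFrame g e) (hW : IsWeylTensor e W)
    (hr : IsBelRadiative g e W) : ∃ e' : Module.Basis (Fin 4) ℝ V, FrameEquiv g e e' ∧
      ∃ a p r, weylMatrix e' W = nullMatrix a p r ∧ (a = 0 ∨ r = 0) := by
  have key : ∀ e₁ : Module.Basis (Fin 4) ℝ V, FrameEquiv g e e₁ → ∀ (w : Fin 3 → ℂ) (t : ℂ),
      w ⬝ᵥ w ≠ 0 → weylMatrix e₁ W *ᵥ w = t • w →
      ∃ e' : Module.Basis (Fin 4) ℝ V, FrameEquiv g e e' ∧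
        ∃ a p r, weylMatrix e' W = nullMatrix a p r ∧ (a = 0 ∨ r = 0) := by
    intro e₁ f₁ w t hn hw
    have hW1 := f₁.isWeylTensor hW
    obtain ⟨e₂, f₂, s, p, q, h⟩ := exists_frame_of_eigenvector f₁.right hW1 hn hw
    obtain ⟨e₃, f₃, p', h'⟩ := exists_nullMatrix_of_blockMatrix f₂.right (f₂.isWeylTensor hW1)
      (f₂.isBelRadiative (f₁.isBelRadiative hr)) h
    exact ⟨e₃, (f₁.trans f₂).trans f₃, s, p', 0, h', Or.inr rfl⟩
  obtain ⟨t, w, hw0, hw⟩ := exists_eigenvector (weylMatrix e W)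
  by_cases hn : w ⬝ᵥ w = 0
  · obtain ⟨e₁, f₁, a, p, r, h⟩ := exists_frame_of_null_eigenvector he hW hw0 hn hw
    by_cases ha : a = 0
    · exact ⟨e₁, f₁, a, p, r, h, Or.inl ha⟩
    · have hI := Complex.I_mul_I
      -- The eigenvector of `nullMatrix a p r` for -2a; the squares of its first two entries cancel,
      -- so its square is 1.
      refine key e₁ f₁ ![-(r / (3 * a)), Complex.I * (r / (3 * a)), 1] (-(2 * a)) ?_ ?_
      · simp only [dotProduct, Fin.sum_univ_three]
        simp
        grind
      · rw [h]
        ext i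
        fin_cases i <;> simp [nullMatrix, Matrix.mulVec, dotProduct, Fin.sum_univ_three] <;> grind
  · exact key e (FrameEquiv.refl he) w t hn hw

theorem type_of_radiative (he : IsOrthonormalFrame g e) (hW : IsWeylTensor e W)
    (hr : IsBelRadiative g e W) : IsTypeN e W ∨ IsTypeIII e W ∨ IsTypeII e W := by
  obtain ⟨e', hf, a, p, r, h, har⟩ := exists_canonical_frame he hW hr
  have hne := nullMatrix_ne_of_radiative hf.right (hf.isWeylTensor hW) (hf.isBelRadiative hr) h
  rw [norm_ne_zero_iff, norm_ne_zero_iff] at hne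
  have hmin := hf.minpoly_eq hW
  suffices IsTypeN e' W ∨ IsTypeIII e' W ∨ IsTypeII e' W by
    simpa only [IsTypeN, IsTypeIII, IsTypeII, hmin] using this
  by_cases hr0 : r = 0
  · subst hr0
    have hp : p ≠ 0 := by simpa using hne
    by_cases ha : a = 0
    · subst ha
      exact Or.inl (isTypeN_of_nullMatrix hp h)
    · exact Or.inr (Or.inr (isTypeII_of_nullMatrix ha hp h))
  · have ha := har.resolve_right hr0
    subst ha
    exact Or.inr (Or.inl (isTypeIII_of_nullMatrix hr0 h))

theorem exists_fundamental (he : IsOrthonormalFrame g e) (hW : IsWeylTensor e W)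
    (hr : IsBelRadiative g e W) : ∃ ℓ, IsFundamental g W ℓ := by
  obtain ⟨e', hf, a, p, r, h, -⟩ := exists_canonical_frame he hW hr
  exact ⟨_, (isFundamental_iff hf.right (hf.isWeylTensor hW) one_ne_zero).2 ⟨a, p, r, h⟩⟩

/-- Two independent null vectors span a plane that contains an observer. In a frame adapted to it
they are multiples of e₀ + e₃ and e₀ - e₃, so M has the null form both before and after a half-turn
that reverses e₃. This forces p = r = 0. -/
theorem fundamental_unique (he : IsOrthonormalFrame g e) (hW : IsWeylTensor e W)
    (hr : IsBelRadiative g e W) {ℓ ℓ' : V} (hℓ : IsFundamental g W ℓ)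
    (hℓ' : IsFundamental g W ℓ') : ∃ a : ℝ, ℓ' = a • ℓ := by
  by_contra hne
  -- Orthogonal null vectors are proportional.
  have hG : g ℓ ℓ' ≠ 0 := by
    intro hG
    obtain ⟨e₁, f₁, -, k, hk, hkl⟩ := exists_frame_of_null he hℓ.1 hℓ.2.1
    have h1 := metric_self_eq f₁.right ℓ'
    rw [hℓ'.2.1] at h1
    rw [hkl, map_smul, map_add, LinearMap.smul_apply, LinearMap.add_apply,
      f₁.right.symm _ ℓ', f₁.right.symm _ ℓ', f₁.right.metric_frame, f₁.right.metric_frame,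
      smul_eq_mul] at hG
    have h2 := (mul_eq_zero.1 hG).resolve_left hk
    simp at h2
    have h3 : e₁.repr ℓ' 3 = e₁.repr ℓ' 0 := by linarith
    simp only [dotProduct, Fin.sum_univ_three, spatial] at h1
    change 0 = -(e₁.repr ℓ' 0) ^ 2 + (e₁.repr ℓ' 1 * e₁.repr ℓ' 1 + e₁.repr ℓ' 2 * e₁.repr ℓ' 2 +
      e₁.repr ℓ' 3 * e₁.repr ℓ' 3) at h1
    have h4 : e₁.repr ℓ' 1 = 0 := by rw [h3] at h1; nlinarith
    have h5 : e₁.repr ℓ' 2 = 0 := by rw [h3] at h1; nlinarith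
    refine hne ⟨e₁.repr ℓ' 0 * k⁻¹, ?_⟩
    rw [hkl, smul_smul, mul_assoc, inv_mul_cancel₀ hk, mul_one]
    conv_lhs => rw [← e₁.sum_repr ℓ', Fin.sum_univ_four, h3, h4, h5]
    rw [zero_smul, zero_smul, add_zero, add_zero, smul_add]
  -- The condition g(u,u) = -1 reads 2xy g(ℓ,ℓ') = -1; the common sign of x and y is still free and
  -- is chosen to make u future-directed.
  obtain ⟨x, y, hx, hy, hu⟩ : ∃ x y : ℝ, x ≠ 0 ∧ y ≠ 0 ∧ IsObserver g e (x • ℓ + y • ℓ') := by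
    have hself : ∀ x y : ℝ, g (x • ℓ + y • ℓ') (x • ℓ + y • ℓ') = 2 * (x * y * g ℓ ℓ') := by
      intro x y
      simp only [map_add, map_smul, LinearMap.add_apply, LinearMap.smul_apply, smul_eq_mul,
        hℓ.2.1, hℓ'.2.1, he.symm ℓ' ℓ]
      ring
    have h1 : g ((1 : ℝ) • ℓ + (-(2 * g ℓ ℓ')⁻¹) • ℓ') ((1 : ℝ) • ℓ + (-(2 * g ℓ ℓ')⁻¹) • ℓ') =
        -1 := by
      rw [hself]; field_simp
    have h2 : g ((1 : ℝ) • ℓ + (-(2 * g ℓ ℓ')⁻¹) • ℓ') (e 0) ≠ 0 := by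
      intro h2
      rw [he.metric_frame] at h2
      rw [metric_self_eq he] at h1
      have h3 : 0 ≤ spatial e ((1 : ℝ) • ℓ + (-(2 * g ℓ ℓ')⁻¹) • ℓ') ⬝ᵥ
        spatial e ((1 : ℝ) • ℓ + (-(2 * g ℓ ℓ')⁻¹) • ℓ') :=
        Finset.sum_nonneg fun i _ => mul_self_nonneg _
      simp only [sgn_zero] at h2
      have h4 := (mul_eq_zero.1 h2).resolve_left (by norm_num)
      rw [h4] at h1
      linarith
    have hy : -(2 * g ℓ ℓ')⁻¹ ≠ 0 := by simpa using hG
    rcases lt_or_gt_of_ne h2 with h3 | h3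
    · exact ⟨1, _, one_ne_zero, hy, h1, h3⟩
    · refine ⟨-1, -(-(2 * g ℓ ℓ')⁻¹), by norm_num, neg_ne_zero.2 hy, ?_⟩
      rw [neg_smul, neg_smul, ← neg_add]
      refine ⟨by rwa [map_neg, map_neg, LinearMap.neg_apply, neg_neg], by simpa using h3⟩
  obtain ⟨e₁, f₁, hu0, k, hk, hkl⟩ := exists_frame_of_observer_of_null he hu hℓ.1 hℓ.2.1
  have hW1 := f₁.isWeylTensor hW
  obtain ⟨a, p, r, h⟩ := (isFundamental_iff f₁.right hW1 hk).1 (hkl ▸ hℓ)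
  have hℓ2 : ℓ' = (2 * y)⁻¹ • (e₁ 0 - e₁ 3) := by
    have h1 : ℓ' = y⁻¹ • (e₁ 0 - (x * k) • (e₁ 0 + e₁ 3)) := by
      rw [← smul_smul, ← hkl, hu0, add_sub_cancel_left, smul_smul, inv_mul_cancel₀ hy, one_smul]
    -- The value for which the remainder u - xℓ is null.
    have h2 : x * k = 1 / 2 := by
      have h3 := hℓ'.2.1
      rw [h1] at h3
      simp only [map_smul, map_sub, map_add, LinearMap.smul_apply, LinearMap.sub_apply,
        LinearMap.add_apply, f₁.right 0 0, f₁.right 0 3, f₁.right 3 0, f₁.right 3 3] at h3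
      simp [hy] at h3
      have h4 : y⁻¹ * (2 * (x * k) - 1) = 0 := by linear_combination h3
      linarith [(mul_eq_zero.1 h4).resolve_left (inv_ne_zero hy)]
    rw [h1, h2]
    module
  have hP : (!![1, 0, 0; 0, -1, 0; 0, 0, -1] : Matrix (Fin 3) (Fin 3) ℝ) *
      (!![1, 0, 0; 0, -1, 0; 0, 0, -1] : Matrix (Fin 3) (Fin 3) ℝ)ᵀ = 1 := by
    ext i j
    fin_cases i <;> fin_cases j <;> simp [Matrix.mul_apply, Fin.sum_univ_three]
  obtain ⟨e₂, f₂, b0, bs⟩ := exists_rotated_frame f₁.right _ hP (by simp [Matrix.det_fin_three])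
  have b3 : e₂ 3 = - e₁ 3 := by
    have := bs 2
    simpa [Fin.sum_univ_three] using this
  have hy2 : (2 * y)⁻¹ ≠ 0 := by simpa using hy
  have hℓ3 : ℓ' = (2 * y)⁻¹ • (e₂ 0 + e₂ 3) := by rw [hℓ2, b0, b3, sub_eq_add_neg]
  obtain ⟨a', p', r', h'⟩ := (isFundamental_iff f₂.right (f₂.isWeylTensor hW1) hy2).1 (hℓ3 ▸ hℓ')
  rw [f₂.weylMatrix_eq hW1, h, frameRotation_rotated b0 bs] at h'
  have e00 := congrFun (congrFun h' 0) 0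
  have e01 := congrFun (congrFun h' 0) 1
  have e11 := congrFun (congrFun h' 1) 1
  have e02 := congrFun (congrFun h' 0) 2
  have e12 := congrFun (congrFun h' 1) 2
  simp [nullMatrix, Matrix.mul_apply, Fin.sum_univ_three] at e00 e01 e11 e02 e12
  have hI := Complex.I_mul_I
  -- The half-turn changes the signs of the entries (0,1) and (0,2) but not of (0,0), (1,1) and
  -- (1,2), which is compatible with the null form only if p = r = 0.
  have hp : p = 0 := by grind
  have hr0 : r = 0 := by grind
  rcases nullMatrix_ne_of_radiative f₁.right hW1 (f₁.isBelRadiative hr) h with h1 | h1 <;>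
    simp [hp, hr0] at h1

/-! ### Proper scalars -/

/-- Radiative fields approach ξ along boosts of the canonical frame; the other fields attain it at
an observer at rest. -/
lemma exists_observer_near (he : IsOrthonormalFrame g e) (hW : IsWeylTensor e W) {η : ℝ}
    (hη : 0 < η) : ∃ u, IsObserver g e u ∧ |tau e W u - xi e W| < η := by
  by_cases hr : IsBelRadiative g e W
  · obtain ⟨e', hf, a, p, r, h, -⟩ := exists_canonical_frame he hW hr
    have hW' := hf.isWeylTensor hW
    obtain ⟨φ, hφ⟩ := (Metric.tendsto_nhds.1
      (tendsto_tau_boost hf.right hW' one_ne_zero h) η hη).exists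
    rw [Real.dist_eq, hf.tau_eq, hf.xi_eq hW] at hφ
    exact ⟨_, (hf.observer_iff _).2 (boost_scalars hf.right hW' one_ne_zero h φ).1, hφ⟩
  · unfold IsBelRadiative at hr
    push Not at hr
    obtain ⟨u, hu, hq⟩ := hr
    exact ⟨u, hu, by rw [(scalarRelations he hW hu).rest hq, sub_self, abs_zero]; exact hη⟩

theorem isProperScalar (he : IsOrthonormalFrame g e) (hW : IsWeylTensor e W) :
    IsProperScalar g e (tau e W) (xi e W) ∧
    IsProperScalar g e (absq g e W) 0 ∧
    IsProperScalar g e (abst g e W) √((1 / 3) * xi e W ^ 2 + (1 / 6) * alpha e W ^ 2) ∧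
    IsProperScalar g e (absQ g e W) √(2 * xi e W ^ 2 - (1 / 2) * alpha e W ^ 2) ∧
    IsProperScalar g e (absT g e W) √(5 * xi e W ^ 2 + alpha e W ^ 2) := by
  obtain ⟨c1, c2, c3, c4, c5⟩ := controlledByDensity he hW
  have hx : ∀ η : ℝ, 0 < η → ∃ u, IsObserver g e u ∧ |tau e W u - xi e W| < η :=
    fun _ => exists_observer_near he hW
  have hs := fun u (hu : IsObserver g e u) => scalarRelations he hW hu
  exact ⟨isProperScalar_of_controlled c1 (fun u hu => (hs u hu).tau_ge) hx,
    isProperScalar_of_controlled c2 (fun u _ => absq_nonneg g e W u) hx,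
    isProperScalar_of_controlled c3 (fun u hu => (hs u hu).bounds.1) hx,
    isProperScalar_of_controlled c4 (fun u hu => (hs u hu).bounds.2.1) hx,
    isProperScalar_of_controlled c5 (fun u hu => (hs u hu).bounds.2.2) hx⟩

theorem scalars_atRest (he : IsOrthonormalFrame g e) (hW : IsWeylTensor e W) {u : V}
    (hu : IsAtRest g e W u) :
    tau e W u = xi e W ∧ absq g e W u = 0 ∧
    abst g e W u = √((1 / 3) * xi e W ^ 2 + (1 / 6) * alpha e W ^ 2) ∧
    absQ g e W u = √(2 * xi e W ^ 2 - (1 / 2) * alpha e W ^ 2) ∧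
    absT g e W u = √(5 * xi e W ^ 2 + alpha e W ^ 2) := by
  have hs := scalarRelations he hW hu.1
  have h1 := hs.rest hu.2
  have h2 : absq g e W u = 0 := by simp [absq, hu.2]
  refine ⟨h1, h2, ?_, ?_, ?_⟩
  · rw [hs.abst_eq, h1, h2]; congr 1; ring
  · rw [hs.absQ_eq, h1, h2]; congr 1; ring
  · rw [hs.absT_eq, h1, h2]; congr 1; ring

/-! ### Petrov-Bel types -/

/-- Types N, III and II have a multiple root in the minimal polynomial, which is incompatible with
each outcome of `type_of_atRest`. -/
theorem isBelRadiative_iff (he : IsOrthonormalFrame g e) (hW : IsWeylTensor e W) :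
    IsBelRadiative g e W ↔ IsTypeN e W ∨ IsTypeIII e W ∨ IsTypeII e W := by
  refine ⟨type_of_radiative he hW, fun h => ?_⟩
  obtain ⟨c, hc⟩ := sq_dvd_minpoly h
  by_contra hr
  rcases type_of_atRest he hW hr with h1 | h1 | h1
  · exact weylMatrix_ne_zero_of_sq_dvd hc h1
  · exact not_isTypeI_of_sq_dvd hc h1
  · exact not_isTypeD_of_sq_dvd hc h1

theorem not_isBelRadiative_iff (he : IsOrthonormalFrame g e) (hW : IsWeylTensor e W)
    (h0 : W ≠ 0) : ¬ IsBelRadiative g e W ↔ IsTypeI e W ∨ IsTypeD e W := by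
  refine ⟨fun h => (type_of_atRest he hW h).resolve_left
    fun h1 => h0 (eq_zero_of_weylMatrix hW h1), fun h hr => ?_⟩
  obtain ⟨c, hc⟩ := sq_dvd_minpoly ((isBelRadiative_iff he hW).1 hr)
  rcases h with h1 | h1
  · exact not_isTypeI_of_sq_dvd hc h1
  · exact not_isTypeD_of_sq_dvd hc h1

end SuperEnergy

theorem mainTheorem5 {V : Type*} [AddCommGroup V] [Module ℝ V]
    (g : LinearMap.BilinForm ℝ V) (e : Module.Basis (Fin 4) ℝ V) (he : IsOrthonormalFrame g e)
    (W : Tensor4 V) (hW : IsWeylTensor e W) :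
    -- the radicands are not negative
    (0 ≤ belRobinsonSq e W ∧ 0 ≤ 2 * xi e W ^ 2 - (1 / 2) * alpha e W ^ 2) ∧
    -- the proper scalars
    (IsProperScalar g e (tau e W) (xi e W) ∧
      IsProperScalar g e (absq g e W) 0 ∧
      IsProperScalar g e (abst g e W) √((1 / 3) * xi e W ^ 2 + (1 / 6) * alpha e W ^ 2) ∧
      IsProperScalar g e (absQ g e W) √(2 * xi e W ^ 2 - (1 / 2) * alpha e W ^ 2) ∧
      IsProperScalar g e (absT g e W) √(5 * xi e W ^ 2 + alpha e W ^ 2)) ∧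
    -- Bel non radiative and Bel radiative fields, and their Petrov-Bel types
    (W ≠ 0 → (¬ IsBelRadiative g e W ↔ IsTypeI e W ∨ IsTypeD e W)) ∧
    (IsBelRadiative g e W ↔ IsTypeN e W ∨ IsTypeIII e W ∨ IsTypeII e W) ∧
    -- Bel non radiative fields: the proper scalars are acquired by the observers at rest
    (¬ IsBelRadiative g e W →
      (∃ e₀, IsAtRest g e W e₀) ∧
      ∀ e₀, IsAtRest g e W e₀ →
        tau e W e₀ = xi e W ∧
        absq g e W e₀ = 0 ∧
        abst g e W e₀ = √((1 / 3) * xi e W ^ 2 + (1 / 6) * alpha e W ^ 2) ∧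
        absQ g e W e₀ = √(2 * xi e W ^ 2 - (1 / 2) * alpha e W ^ 2) ∧
        absT g e W e₀ = √(5 * xi e W ^ 2 + alpha e W ^ 2)) ∧
    -- Bel radiative fields: the scalars decrease to the proper scalars towards the unique
    -- fundamental direction
    (IsBelRadiative g e W →
      (∃ ℓ, IsFundamental g W ℓ) ∧
      (∀ ℓ ℓ', IsFundamental g W ℓ → IsFundamental g W ℓ' → ∃ a : ℝ, ℓ' = a • ℓ) ∧
      ∀ ℓ, IsFundamental g W ℓ →
        DecreasesTo g e ℓ (tau e W) (xi e W) ∧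
        DecreasesTo g e ℓ (absq g e W) 0 ∧
        DecreasesTo g e ℓ (abst g e W) √((1 / 3) * xi e W ^ 2 + (1 / 6) * alpha e W ^ 2) ∧
        DecreasesTo g e ℓ (absQ g e W) √(2 * xi e W ^ 2 - (1 / 2) * alpha e W ^ 2) ∧
        DecreasesTo g e ℓ (absT g e W) √(5 * xi e W ^ 2 + alpha e W ^ 2)) := by
  refine ⟨⟨?_, ?_⟩, isProperScalar he hW, not_isBelRadiative_iff he hW, isBelRadiative_iff he hW,
    fun hr => ⟨?_, fun _ => scalars_atRest he hW⟩,
    fun hr => ⟨exists_fundamental he hW hr, fun _ _ => fundamental_unique he hW hr,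
      fun _ => decreasesTo he hW hr⟩⟩
  · rw [belRobinsonSq_frame hW]
    positivity
  · have h := pow_le_pow_left₀ (alpha_nonneg e W) (alpha_le hW) 2
    linarith
  · unfold IsBelRadiative at hr
    push Not at hr
    exact hr
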